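/- **Theorem.** Let $\lambda>0$, $k>0$ and $T\in\mathbb R$. There is a function $\varphi:[0,\infty)\to\mathbb R$ such that * $\varphi$ is differentiable on $[0,\infty)$ (one-sidedly at $0$) and twice differentiable on $(0,\infty)$; $\varphi$ and $\varphi'$ satisfy a Hölder condition on $[0,\infty)$, and $\varphi''$ satisfies a Hölder condition on $[a,\infty)$ for every $a>0$; * for every $x>0$ the integral below exists as a Cauchy principal value and $$\varphi(x)-\frac{\lambda}{\pi}\int_0^\infty\frac{\varphi'(t)\,dt}{t-x}-k\varphi''(x)=0,\qquad \varphi(0)=T,\quad \lim_{x\to\infty}\varphi(x)=0;$$ * (boundedness of the contact stress) $\varphi'(x)=O(1)$ as $x\to0^+$; * (explicit representation) $\varphi'$ is given by each of the two Wiener–Hopf formulas (A), (B) below. For a positive function $G$ on $\mathbb R$ put $X(z)=\exp\Big\{\frac1{2\pi i}\int_{-\infty}^{\infty}\frac{\ln G(s)}{s-z}\,ds\Big\}$ for $\operatorname{Im} z\ne0$. In both cases below the integral converges absolutely, $X$ is holomorphic off $\mathbb R$ and extends continuously to $\mathbb R$ from above and from below, with boundary values $X^{\pm}$ satisfying $X^+=G\,X^-$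 on $\mathbb R$ and $X^{\pm}(s)\to1$ as $|s|\to\infty$. In both cases $$\varphi'(x)=\lim_{R\to\infty}\frac1{2\pi}\int_{-R}^{R}K(t)\,e^{-itx}\,dt,\qquad x>0,$$ where $K$ is holomorphic in $\operatorname{Im}z>0$, is $O(|z|^{-(1-\varepsilon)})$ as $|z|\to\infty$ there for every $\varepsilon\in(0,1)$, extends continuously to the real axis (this extension is the $K(t)$ in the integral), and is defined for $\operatorname{Im}z>0$ as follows, all integrals being absolutely convergent. (A) With $\tilde k=k/\lambda$, $\displaystyle G(s)=\frac{1+\lambda|s|+ks^2}{\sqrt{1+\lambda^2s^2}\sqrt{1+\tilde k^2s^2}}$ and $D(z)=X(z)\sqrt{\lambda z+i}\,\sqrt{\tilde kz+i}$ (principal square roots, also below): $$K(z)=-T+\frac{\lambda Tz}{\pi i\,D(z)}\int_0^\infty\frac{X^-(s)\,ds}{\sqrt{\lambda s-i}\,\sqrt{\tilde ks-i}\,(s-z)}+\frac{z\sqrt k\,T}{D(z)}.$$ (B) With $\displaystyle G(s)=\frac{1+\lambda|s|+ks^2}{1+ks^2}$ and $D(z)=X(z)(1-i\sqrt k\,z)$: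 $$K(z)=-T-\frac{i\lambda Tz}{\pi D(z)}\int_0^\infty\frac{X^-(s)\,ds}{(1+i\sqrt k\,s)(s-z)}-\frac{iz\sqrt k\,T}{D(z)}.$$ -/

import Mathlib

open MeasureTheory Set Filter Topology
open scoped NNReal

namespace AdhesivePatch

noncomputable section

/-- `f` satisfies a Hölder condition on `s`, with some exponent in `(0, 1]`. -/
def HolderClassOn (f : ℝ → ℝ) (s : Set ℝ) : Prop :=
  ∃ C μ : ℝ≥0, 0 < μ ∧ μ ≤ 1 ∧ HolderOnWith C μ f s

/-- The Cauchy principal value of `∫₀^∞ f(t) / (t - x) dt` exists and equals `v`. -/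
def HasPrincipalValue (f : ℝ → ℝ) (x v : ℝ) : Prop :=
  (∀ ε > 0, IntegrableOn (fun t => f t / (t - x)) {t | 0 < t ∧ ε < |t - x|}) ∧
  Tendsto (fun ε => ∫ t in {t | 0 < t ∧ ε < |t - x|}, f t / (t - x)) (𝓝[>] 0) (𝓝 v)

/-- `φ`, with first derivative `dφ` on `[0, ∞)` (one-sided at `0`) and second derivative `ddφ`
on `(0, ∞)`, solves `φ - (lam / π) ∫₀^∞ φ'(t) / (t - x) dt - k φ'' = 0` on `(0, ∞)`,
`φ(0) = T`, `φ(∞) = 0`, in the class `φ, φ' ∈ H[0, ∞)`, `φ'' ∈ H(0, ∞)`. -/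
structure IsSolution (lam k T : ℝ) (φ dφ ddφ : ℝ → ℝ) : Prop where
  hasDeriv : ∀ x, 0 ≤ x → HasDerivWithinAt φ (dφ x) (Ici 0) x
  hasDeriv₂ : ∀ x, 0 < x → HasDerivAt dφ (ddφ x) x
  holder : HolderClassOn φ (Ici 0)
  holder₁ : HolderClassOn dφ (Ici 0)
  holder₂ : ∀ a, 0 < a → HolderClassOn ddφ (Ici a)
  equation : ∀ x, 0 < x →
    ∃ v, HasPrincipalValue dφ x v ∧ φ x - lam / Real.pi * v - k * ddφ x = 0
  at_zero : φ 0 = T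
  at_infinity : Tendsto φ atTop (𝓝 0)

/-- The open upper half-plane. -/
def upperHalf : Set ℂ := {z | 0 < z.im}

/-- The open lower half-plane. -/
def lowerHalf : Set ℂ := {z | z.im < 0}

/-- The principal square root. For real `a > 0` and real `s`, `a s + i` lies in the upper and
`a s - i` in the lower half-plane, and the product of their roots is `√(1 + a² s²) > 0`. -/
def csqrt (z : ℂ) : ℂ := z ^ (1 / 2 : ℂ)

/-- Coefficient of the linear conjugation problem, case A; here `k / lam` is `k̃`. -/
def symbolA (lam k s : ℝ) : ℝ :=
  (1 + lam * |s| + k * s ^ 2) /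
    (Real.sqrt (1 + lam ^ 2 * s ^ 2) * Real.sqrt (1 + (k / lam) ^ 2 * s ^ 2))

/-- Coefficient of the linear conjugation problem, case B. -/
def symbolB (lam k s : ℝ) : ℝ :=
  (1 + lam * |s| + k * s ^ 2) / (1 + k * s ^ 2)

/-- `X(z) = exp ((1 / 2πi) ∫ ln G(s) / (s - z) ds)`, for `z` off the real axis. -/
def canonical (G : ℝ → ℝ) (z : ℂ) : ℂ :=
  Complex.exp (1 / (2 * Real.pi * Complex.I) * ∫ s : ℝ, (Real.log (G s) : ℂ) / ((s : ℂ) - z))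

/-- `canonical G` is a (convergent) canonical solution of `X⁺ = G X⁻` on the real line, with
boundary values `Xp` from above and `Xm` from below and `X^±(∞) = 1`. -/
structure IsFactorization (G : ℝ → ℝ) (Xp Xm : ℝ → ℂ) : Prop where
  integrable : ∀ z : ℂ, z.im ≠ 0 →
    Integrable (fun s : ℝ => (Real.log (G s) : ℂ) / ((s : ℂ) - z))
  holomorphic : DifferentiableOn ℂ (canonical G) {z | z.im ≠ 0}
  upper : ∀ s : ℝ, Tendsto (canonical G) (𝓝[upperHalf] (s : ℂ)) (𝓝 (Xp s))
  lower : ∀ s : ℝ, Tendsto (canonical G) (𝓝[lowerHalf] (s : ℂ)) (𝓝 (Xm s))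
  jump : ∀ s : ℝ, Xp s = G s * Xm s
  upper_infinity : Tendsto Xp (cocompact ℝ) (𝓝 1)
  lower_infinity : Tendsto Xm (cocompact ℝ) (𝓝 1)

/-- Integrand in case A: `X⁻(s) / (√(lam s - i) √(k̃ s - i) (s - z))`. -/
def integrandA (lam k : ℝ) (Xm : ℝ → ℂ) (z : ℂ) (s : ℝ) : ℂ :=
  Xm s / (csqrt (lam * s - Complex.I) * csqrt ((k / lam : ℝ) * s - Complex.I) * ((s : ℂ) - z))

/-- `D(z) = X(z) √(lam z + i) √(k̃ z + i)`, case A. -/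
def denomA (lam k : ℝ) (z : ℂ) : ℂ :=
  canonical (symbolA lam k) z *
    (csqrt (lam * z + Complex.I) * csqrt ((k / lam : ℝ) * z + Complex.I))

/-- The transform in case A:
`-T + (lam T z / (π i D(z))) ∫₀^∞ X⁻(s) ds / (√(lam s - i) √(k̃ s - i) (s - z)) + z √k T / D(z)`. -/
def transformA (lam k T : ℝ) (Xm : ℝ → ℂ) (z : ℂ) : ℂ :=
  -(T : ℂ) +
    lam * T * z / (Real.pi * Complex.I * denomA lam k z) *
      (∫ s in Ioi (0 : ℝ), integrandA lam k Xm z s) +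
    z * Real.sqrt k * T / denomA lam k z

/-- Integrand in case B: `X⁻(s) / ((1 + i √k s) (s - z))`. -/
def integrandB (k : ℝ) (Xm : ℝ → ℂ) (z : ℂ) (s : ℝ) : ℂ :=
  Xm s / ((1 + Complex.I * Real.sqrt k * s) * ((s : ℂ) - z))

/-- `D(z) = X(z) (1 - i √k z)`, case B. -/
def denomB (lam k : ℝ) (z : ℂ) : ℂ :=
  canonical (symbolB lam k) z * (1 - Complex.I * Real.sqrt k * z)

/-- The transform in case B:
`-T - (i lam T z / (π D(z))) ∫₀^∞ X⁻(s) ds / ((1 + i √k s) (s - z)) - i z √k T / D(z)`. -/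
def transformB (lam k T : ℝ) (Xm : ℝ → ℂ) (z : ℂ) : ℂ :=
  -(T : ℂ) -
    Complex.I * lam * T * z / (Real.pi * denomB lam k z) *
      (∫ s in Ioi (0 : ℝ), integrandB k Xm z s) -
    Complex.I * z * Real.sqrt k * T / denomB lam k z

/-- `f` is represented on `(0, ∞)` by the inverse Fourier integral of `K`: `K` is holomorphic in
the upper half-plane, is `O(|z|^{-(1-ε)})` at infinity for every `ε ∈ (0, 1)`, extends continuously
to the real axis with boundary value `Kb`, and `f(x) = (1/2π) ∫ Kb(t) e^{-itx} dt` for `x > 0`,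
the integral being the limit of the integrals over `[-R, R]`. -/
structure IsInverseFourierOf (f : ℝ → ℝ) (K : ℂ → ℂ) (Kb : ℝ → ℂ) : Prop where
  holomorphic : DifferentiableOn ℂ K upperHalf
  decay : ∀ ε : ℝ, 0 < ε → ε < 1 →
    K =O[Bornology.cobounded ℂ ⊓ 𝓟 upperHalf] fun z => ‖z‖ ^ (-(1 - ε))
  continuous_boundary : Continuous Kb
  boundary : ∀ t : ℝ, Tendsto K (𝓝[upperHalf] (t : ℂ)) (𝓝 (Kb t))
  inversion : ∀ x : ℝ, 0 < x →
    Tendsto (fun R : ℝ => 1 / (2 * (Real.pi : ℂ)) *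
      ∫ t in (-R)..R, Kb t * Complex.exp (-(Complex.I * t * x))) atTop (𝓝 (f x : ℂ))

end

end AdhesivePatch

open MeasureTheory Set Filter Topology
open scoped NNReal

namespace AdhesivePatch

noncomputable section

open Complex (I)

/-! Put `a = lam / √k`, measure `x` in units of `√k` and write `p = -i √k z`. For `s ≥ 0` the symbol
`1 + a s + s²` splits as `D(is) D(-is)`, where `D` (`factor`) is holomorphic and zero-free in the
right half-plane. Its logarithm is an explicit average of `log (1 + p e^{-u})`. The splitting
(`logFactor_add_neg`) comes from Poisson's formula for the logarithmic derivative of `1 + a ζ + ζ²`,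
and the symmetry `D(p) = p D(1/p)` gives the behaviour at infinity.

In both cases the canonical function `X` is `D` divided by elementary factors, and these cancel
against the other terms of the formula. So (A) and (B) are the same function `K(p)`, namely
`derivTransform` (`transformA_eq`, `transformB_eq`). It remains to show that `K` is the transform of
the derivative of a solution.

Since `1 / D(iη) = D(-iη) / (1 + a η + η²)`, `K(iη)` continues from `η > 0` to the first quadrant
(`rotatedTransform`), that is, `K` continues across the positive imaginary axis to the upper side of
the cut `p = -r`, `r > 0`. There it satisfies Carleman's relation `(1 - r²) Im K = -a r Re K`
(`one_sub_sq_mul_im`). With `w(r) = Im K / (π r)`, Cauchy's formula with rotated contours gives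
`K(p) = -∫ r w(r) / (r + p) dr` (`derivTransform_eq`). Hence, in the scaled variable, `K` is the
Laplace transform of the derivative of `φ(x) = ∫ w(r) e^{-rx} dr`.

The principal value of the Cauchy integral of `φ'` is minus the Laplace integral of `Re K` on the
cut (`tendsto_integral_laplace_poisson`). The equation therefore reads `∫ ((1 - r²) w + (a / π) Re
K) e^{-rx} dr = 0`, and its integrand vanishes pointwise by Carleman's relation
(`laplace_equation`). The value `K(0) = -T` gives `φ(0) = T`. Carleman's relation also improves the
bound on `w` to `O((1 + r)^{-5/2})`, from which the Hölder classes and the boundedness of `φ'`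
follow. Jordan's lemma yields the inverse Fourier formula. -/

/-- The closed first quadrant. -/
def quadrant : Set ℂ := {z | 0 ≤ z.re ∧ 0 ≤ z.im}

/-- The closed right half-plane. -/
def rightHalf : Set ℂ := {z | 0 ≤ z.re}

/-! ### Holomorphic functions with power decay on a half-plane or quadrant -/

/-- `f` is continuous on `s` and holomorphic in the interior of `s`. -/
structure HoloOn (f : ℂ → ℂ) (s : Set ℂ) : Prop where
  cont : ContinuousOn f s
  diff : DifferentiableOn ℂ f (interior s)

/-- `f` is `O((1 + |z|)^{-α})` on `s`. -/
def PowerDecay (α : ℝ) (f : ℂ → ℂ) (s : Set ℂ) : Prop :=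
  ∃ C : ℝ, 0 ≤ C ∧ ∀ z ∈ s, ‖f z‖ ≤ C * (1 + ‖z‖) ^ (-α)

theorem interior_rightHalf : interior rightHalf = {z | 0 < z.re} :=
  Complex.interior_setOfPred_le_re 0

theorem interior_quadrant : interior quadrant = {z | 0 < z.re ∧ 0 < z.im} := by
  have : quadrant = {z : ℂ | 0 ≤ z.re} ∩ {z : ℂ | 0 ≤ z.im} := rfl
  rw [this, interior_inter, Complex.interior_setOfPred_le_re, Complex.interior_setOfPred_le_im]
  rfl

theorem isClosed_rightHalf : IsClosed rightHalf := isClosed_le continuous_const Complex.continuous_re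

theorem isClosed_quadrant : IsClosed quadrant :=
  (isClosed_le continuous_const Complex.continuous_re).inter
    (isClosed_le continuous_const Complex.continuous_im)

theorem PowerDecay.mul {α β : ℝ} {f g : ℂ → ℂ} {s : Set ℂ} (hf : PowerDecay α f s)
    (hg : PowerDecay β g s) : PowerDecay (α + β) (fun z => f z * g z) s := by
  obtain ⟨C, hC, hf⟩ := hf
  obtain ⟨C', hC', hg⟩ := hg
  refine ⟨C * C', by positivity, fun z hz => ?_⟩
  have h0 : 0 < 1 + ‖z‖ := by positivity
  rw [norm_mul, neg_add, Real.rpow_add h0]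
  calc ‖f z‖ * ‖g z‖ ≤ (C * (1 + ‖z‖) ^ (-α)) * (C' * (1 + ‖z‖) ^ (-β)) :=
        mul_le_mul (hf z hz) (hg z hz) (norm_nonneg _) (by positivity)
    _ = _ := by ring

theorem PowerDecay.add {α : ℝ} {f g : ℂ → ℂ} {s : Set ℂ} (hf : PowerDecay α f s)
    (hg : PowerDecay α g s) : PowerDecay α (fun z => f z + g z) s := by
  obtain ⟨C, hC, hf⟩ := hf
  obtain ⟨C', hC', hg⟩ := hg
  refine ⟨C + C', by positivity, fun z hz => ?_⟩
  rw [add_mul]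
  exact (norm_add_le _ _).trans (add_le_add (hf z hz) (hg z hz))

theorem PowerDecay.const_mul {α : ℝ} {f : ℂ → ℂ} {s : Set ℂ} (hf : PowerDecay α f s) (c : ℂ) :
    PowerDecay α (fun z => c * f z) s := by
  obtain ⟨C, hC, hf⟩ := hf
  refine ⟨‖c‖ * C, by positivity, fun z hz => ?_⟩
  rw [norm_mul, mul_assoc]
  exact mul_le_mul_of_nonneg_left (hf z hz) (norm_nonneg _)

theorem PowerDecay.mono {α β : ℝ} {f : ℂ → ℂ} {s : Set ℂ} (hf : PowerDecay α f s) (h : β ≤ α) :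
    PowerDecay β f s := by
  obtain ⟨C, hC, hf⟩ := hf
  refine ⟨C, hC, fun z hz => (hf z hz).trans (mul_le_mul_of_nonneg_left ?_ hC)⟩
  exact Real.rpow_le_rpow_of_exponent_le (by linarith [norm_nonneg z]) (by linarith)

/-- On a closed set, decay at infinity of a continuous function gives a global bound. -/
theorem PowerDecay.of_large {α : ℝ} (hα : 0 ≤ α) {f : ℂ → ℂ} {s : Set ℂ} (hs : IsClosed s)
    (hf : ContinuousOn f s) {R C : ℝ} (hR : 1 ≤ R)
    (h : ∀ z ∈ s, R ≤ ‖z‖ → ‖f z‖ ≤ C * ‖z‖ ^ (-α)) : PowerDecay α f s := by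
  have hcomp : IsCompact (s ∩ Metric.closedBall 0 R) :=
    (isCompact_closedBall (0 : ℂ) R).inter_left hs
  obtain ⟨M, hM⟩ := hcomp.exists_bound_of_continuousOn (hf.mono inter_subset_left)
  refine ⟨|M| * (1 + R) ^ α + |C| * 2 ^ α, by positivity, fun z hz => ?_⟩
  have h0 : 0 < 1 + ‖z‖ := by positivity
  rcases le_total ‖z‖ R with hzR | hzR
  · have h1 : ‖f z‖ ≤ |M| := (hM z ⟨hz, by simpa using hzR⟩).trans (le_abs_self M)
    have h2 : 1 ≤ (1 + R) ^ α * (1 + ‖z‖) ^ (-α) := by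
      rw [Real.rpow_neg h0.le, ← div_eq_mul_inv, one_le_div (by positivity)]
      exact Real.rpow_le_rpow h0.le (by linarith) hα
    have h3 : 0 ≤ |C| * 2 ^ α * (1 + ‖z‖) ^ (-α) := by positivity
    nlinarith [mul_le_mul_of_nonneg_left h2 (abs_nonneg M)]
  · have hz0 : 0 < ‖z‖ := by linarith
    have h1 := h z hz hzR
    have h2 : ‖z‖ ^ (-α) ≤ 2 ^ α * (1 + ‖z‖) ^ (-α) := by
      rw [Real.rpow_neg h0.le, Real.rpow_neg hz0.le, ← div_eq_mul_inv,
        le_div_iff₀ (by positivity), inv_mul_le_iff₀ (by positivity),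
        ← Real.mul_rpow (by positivity) (by positivity)]
      exact Real.rpow_le_rpow h0.le (by linarith) hα
    have h3 : 0 ≤ |M| * (1 + R) ^ α * (1 + ‖z‖) ^ (-α) := by positivity
    have h4 : C * ‖z‖ ^ (-α) ≤ |C| * ‖z‖ ^ (-α) :=
      mul_le_mul_of_nonneg_right (le_abs_self C) (by positivity)
    nlinarith [mul_le_mul_of_nonneg_left h2 (abs_nonneg C)]

/-- Decay of a simple fraction whose pole is at positive distance from the half-plane. -/
theorem one_add_norm_le_mul_norm_sub {q ζ : ℂ} (hq : q.re < 0) (hζ : ζ ∈ rightHalf) :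
    1 + ‖ζ‖ ≤ ((1 + ‖q‖) / |q.re| + 1) * ‖ζ - q‖ := by
  have h1 : |q.re| ≤ ‖ζ - q‖ := by
    have := Complex.abs_re_le_norm (ζ - q)
    have h2 : 0 ≤ ζ.re := hζ
    simp only [Complex.sub_re] at this
    rw [abs_of_neg hq]
    rw [abs_of_pos (by linarith)] at this
    linarith
  have hd : 0 < |q.re| := abs_pos.2 hq.ne
  have h2 : ‖ζ‖ ≤ ‖ζ - q‖ + ‖q‖ := by simpa using norm_add_le (ζ - q) q
  have h3 : 1 + ‖q‖ ≤ (1 + ‖q‖) / |q.re| * ‖ζ - q‖ := by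
    rw [div_mul_eq_mul_div, le_div_iff₀ hd]
    exact mul_le_mul_of_nonneg_left h1 (by positivity)
  linarith

theorem powerDecay_inv_sub {q : ℂ} (hq : q.re < 0) :
    PowerDecay 1 (fun ζ => (ζ - q)⁻¹) rightHalf := by
  refine ⟨(1 + ‖q‖) / |q.re| + 1, by positivity, fun ζ hζ => ?_⟩
  have h1 := one_add_norm_le_mul_norm_sub hq hζ
  have h0 : 0 < 1 + ‖ζ‖ := by positivity
  have hpos : 0 < ‖ζ - q‖ := by
    by_contra hcon
    have : ‖ζ - q‖ = 0 := le_antisymm (not_lt.1 hcon) (norm_nonneg _)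
    rw [this] at h1
    linarith
  rw [norm_inv, Real.rpow_neg_one, ← div_eq_mul_inv, inv_eq_one_div, div_le_div_iff₀ hpos h0]
  linarith

/-- The exponent 3/2 is 1/2 + 1: the decay of a function of order -1/2 multiplied by a Cauchy
kernel. -/
theorem integrable_rpow_three_halves : Integrable (fun x : ℝ => (1 + ‖x‖) ^ (-(3 / 2) : ℝ)) :=
  integrable_one_add_norm (by simp; norm_num)

theorem integrable_of_norm_le_three_halves {f : ℝ → ℂ} {s : Set ℝ} (hs : MeasurableSet s)
    (hf : ContinuousOn f s) {C : ℝ}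
    (h : ∀ x ∈ s, ‖f x‖ ≤ C * (1 + ‖x‖) ^ (-(3 / 2) : ℝ)) : IntegrableOn f s :=
  Integrable.mono' (integrable_rpow_three_halves.const_mul C).integrableOn
    (hf.aestronglyMeasurable hs) ((ae_restrict_mem hs).mono h)

theorem HoloOn.mul {f g : ℂ → ℂ} {s : Set ℂ} (hf : HoloOn f s) (hg : HoloOn g s) :
    HoloOn (fun z => f z * g z) s := ⟨hf.cont.mul hg.cont, hf.diff.mul hg.diff⟩

theorem HoloOn.of_differentiableAt {f : ℂ → ℂ} {s : Set ℂ}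
    (hf : ∀ z ∈ s, DifferentiableAt ℂ f z) : HoloOn f s :=
  ⟨fun z hz => (hf z hz).continuousAt.continuousWithinAt,
    fun z hz => (hf z (interior_subset hz)).differentiableWithinAt⟩

/-! ### Contour integrals in a quadrant and in the right half-plane -/

/-- Cauchy's theorem on the square `[0, L]²`. -/
theorem integral_square {g : ℂ → ℂ} (hg : HoloOn g quadrant) {L : ℝ} (hL : 0 ≤ L) :
    (∫ x : ℝ in (0)..L, g x) = I * (∫ y : ℝ in (0)..L, g (I * y)) +
      (∫ x : ℝ in (0)..L, g (x + L * I)) - I * ∫ y : ℝ in (0)..L, g (L + y * I) := by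
  have h := Complex.integral_boundary_rect_eq_zero_of_continuousOn_of_differentiableOn g 0
    (L + L * I) (hg.cont.mono ?_) (hg.diff.mono ?_)
  · simp only [Complex.zero_re, Complex.zero_im, Complex.add_re, Complex.ofReal_re, Complex.mul_re,
      Complex.I_re, mul_zero, Complex.ofReal_im, Complex.I_im, mul_one, sub_self, add_zero,
      Complex.add_im, Complex.mul_im, zero_add, Complex.ofReal_zero, zero_mul, smul_eq_mul] at h
    simp only [mul_comm I]
    simp only [mul_comm I] at h
    linear_combination h
  · intro z hz
    simp only [Complex.mem_reProdIm, Complex.zero_re, Complex.zero_im, Complex.add_re,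
      Complex.ofReal_re, Complex.mul_re, Complex.I_re, mul_zero, Complex.ofReal_im, Complex.I_im,
      mul_one, sub_self, add_zero, Complex.add_im, Complex.mul_im, zero_add, uIcc_of_le hL] at hz
    exact ⟨hz.1.1, hz.2.1⟩
  · rw [interior_quadrant]
    intro z hz
    simp only [Complex.mem_reProdIm, Complex.zero_re, Complex.zero_im, Complex.add_re,
      Complex.ofReal_re, Complex.mul_re, Complex.I_re, mul_zero, Complex.ofReal_im, Complex.I_im,
      mul_one, sub_self, add_zero, Complex.add_im, Complex.mul_im, zero_add, min_eq_left hL,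
      max_eq_right hL] at hz
    exact ⟨hz.1.1, hz.2.1⟩

theorem continuousOn_comp_ofReal {g : ℂ → ℂ} (hg : ContinuousOn g quadrant) :
    ContinuousOn (fun x : ℝ => g x) (Ici 0) :=
  hg.comp (by fun_prop) fun x hx => ⟨by simpa using hx, by simp⟩

theorem continuousOn_comp_I_mul {g : ℂ → ℂ} (hg : ContinuousOn g quadrant) :
    ContinuousOn (fun x : ℝ => g (I * x)) (Ici 0) :=
  hg.comp (by fun_prop) fun x hx => ⟨by simp, by simpa using hx⟩

/-- Jordan's lemma for a quadrant. -/
theorem tendsto_integral_of_exp_decay {g : ℂ → ℂ} (hg : HoloOn g quadrant) {C m : ℝ} (hm : 0 < m)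
    (hC : 0 ≤ C)
    (h : ∀ z ∈ quadrant, ‖g z‖ ≤ C * (1 + ‖z‖) ^ (-(1 / 2) : ℝ) * Real.exp (-(m * z.im))) :
    Tendsto (fun L : ℝ => ∫ x : ℝ in (0)..L, g x) atTop
      (𝓝 (I * ∫ y : ℝ in Ioi 0, g (I * y))) := by
  have hint : IntegrableOn (fun y : ℝ => g (I * y)) (Ioi 0) := by
    refine Integrable.mono' (g := fun y => C * Real.exp (-m * y))
      ((integrableOn_exp_mul_Ioi (neg_lt_zero.2 hm) 0).const_mul C)
      (((continuousOn_comp_I_mul hg.cont).mono Ioi_subset_Ici_self).aestronglyMeasurable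
        measurableSet_Ioi) ?_
    filter_upwards [ae_restrict_mem measurableSet_Ioi] with y hy
    refine (h _ ⟨by simp, by simpa using (le_of_lt hy)⟩).trans ?_
    have : (1 + ‖I * (y : ℂ)‖) ^ (-(1 / 2) : ℝ) ≤ 1 :=
      Real.rpow_le_one_of_one_le_of_nonpos (by linarith [norm_nonneg (I * (y : ℂ))]) (by norm_num)
    have h2 : (I * (y : ℂ)).im = y := by simp
    rw [h2, neg_mul]
    have := mul_le_mul_of_nonneg_left this hC
    rw [mul_one] at this
    exact mul_le_mul_of_nonneg_right this (Real.exp_pos _).le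
  have h1 : Tendsto (fun L : ℝ => ∫ y : ℝ in (0)..L, g (I * y)) atTop
      (𝓝 (∫ y : ℝ in Ioi 0, g (I * y))) := intervalIntegral_tendsto_integral_Ioi 0 hint tendsto_id
  -- Top side: length `L`, with the integrand of size `exp (-m L)`.
  have h2 : Tendsto (fun L : ℝ => ∫ x : ℝ in (0)..L, g (x + L * I)) atTop (𝓝 0) := by
    have hlim : Tendsto (fun L : ℝ => C * (L * Real.exp (-(m * L)))) atTop (𝓝 0) := by
      have := (Real.tendsto_pow_mul_exp_neg_atTop_nhds_zero 1).comp (tendsto_id.const_mul_atTop hm)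
      have := this.const_mul (C / m)
      rw [mul_zero] at this
      refine this.congr fun L => ?_
      simp only [Function.comp, id, pow_one]
      field_simp
    refine squeeze_zero_norm' ?_ hlim
    filter_upwards [eventually_ge_atTop 0] with L hL
    have := intervalIntegral.norm_integral_le_of_norm_le_const (a := 0) (b := L)
      (f := fun x : ℝ => g (x + L * I)) (C := C * Real.exp (-(m * L))) ?_
    · rw [sub_zero, abs_of_nonneg hL] at this
      linarith
    · intro x hx
      rw [uIoc_of_le hL] at hx
      refine (h _ ⟨by simpa using hx.1.le, by simpa using hL⟩).trans ?_
      have h3 : (1 + ‖(x : ℂ) + L * I‖) ^ (-(1 / 2) : ℝ) ≤ 1 :=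
        Real.rpow_le_one_of_one_le_of_nonpos (by linarith [norm_nonneg ((x : ℂ) + L * I)])
          (by norm_num)
      have h2 : ((x : ℂ) + L * I).im = L := by simp
      rw [h2]
      have := mul_le_mul_of_nonneg_left h3 hC
      rw [mul_one] at this
      exact mul_le_mul_of_nonneg_right this (Real.exp_pos _).le
  -- Right side: the exponential integrates to at most `1 / m`, and the factor `(1 + L) ^ (-1/2)`
  -- tends to zero.
  have h3 : Tendsto (fun L : ℝ => ∫ y : ℝ in (0)..L, g (L + y * I)) atTop (𝓝 0) := by
    have hlim : Tendsto (fun L : ℝ => C * (1 + L) ^ (-(1 / 2) : ℝ) * (1 / m)) atTop (𝓝 0) := by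
      have := (tendsto_rpow_neg_atTop (y := 1 / 2) (by norm_num)).comp
        (tendsto_atTop_add_const_left atTop 1 tendsto_id)
      have := (this.const_mul C).mul_const (1 / m)
      rw [mul_zero, zero_mul] at this
      exact this
    refine squeeze_zero_norm' ?_ hlim
    filter_upwards [eventually_ge_atTop 0] with L hL
    have hbd : ∀ y ∈ Ioc (0 : ℝ) L, ‖g (L + y * I)‖ ≤
        C * (1 + L) ^ (-(1 / 2) : ℝ) * Real.exp (-m * y) := by
      intro y hy
      refine (h _ ⟨by simpa using hL, by simpa using hy.1.le⟩).trans ?_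
      have h2 : ((L : ℂ) + y * I).im = y := by simp
      have h3 : L ≤ ‖(L : ℂ) + y * I‖ := by
        have := Complex.re_le_norm ((L : ℂ) + y * I)
        simpa using this
      rw [h2, neg_mul]
      refine mul_le_mul_of_nonneg_right (mul_le_mul_of_nonneg_left ?_ hC) (Real.exp_pos _).le
      exact Real.rpow_le_rpow_of_nonpos (by linarith) (by linarith) (by norm_num)
    have hexp := (integrableOn_exp_mul_Ioi (neg_lt_zero.2 hm) 0)
    rw [intervalIntegral.integral_of_le hL]
    refine (norm_integral_le_of_norm_le (g := fun y => C * (1 + L) ^ (-(1 / 2) : ℝ) *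
      Real.exp (-m * y)) ((hexp.mono_set Ioc_subset_Ioi_self).const_mul _)
      ((ae_restrict_mem measurableSet_Ioc).mono hbd)).trans ?_
    rw [integral_const_mul]
    refine mul_le_mul_of_nonneg_left ?_ (by positivity)
    refine (setIntegral_mono_set hexp (ae_of_all _ fun y => (Real.exp_pos _).le)
      Ioc_subset_Ioi_self.eventuallyLE).trans ?_
    rw [integral_exp_mul_Ioi (neg_lt_zero.2 hm)]
    simp
  have h4 := ((h1.const_mul I).add h2).sub (h3.const_mul I)
  rw [mul_zero, add_zero, sub_zero] at h4
  refine h4.congr' ?_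
  filter_upwards [eventually_ge_atTop 0] with L hL
  rw [integral_square hg hL]

theorem integrableOn_ofReal_of_decay {g : ℂ → ℂ} (hg : ContinuousOn g quadrant)
    (h : PowerDecay (3 / 2) g quadrant) : IntegrableOn (fun x : ℝ => g x) (Ioi 0) := by
  obtain ⟨C, hC, h⟩ := h
  refine integrable_of_norm_le_three_halves measurableSet_Ioi
    ((continuousOn_comp_ofReal hg).mono Ioi_subset_Ici_self) (C := C) fun x hx => ?_
  have := h x ⟨by simpa using le_of_lt hx, by simp⟩
  simpa using this

theorem integrableOn_I_mul_of_decay {g : ℂ → ℂ} (hg : ContinuousOn g quadrant)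
    (h : PowerDecay (3 / 2) g quadrant) : IntegrableOn (fun x : ℝ => g (I * x)) (Ioi 0) := by
  obtain ⟨C, hC, h⟩ := h
  refine integrable_of_norm_le_three_halves measurableSet_Ioi
    ((continuousOn_comp_I_mul hg).mono Ioi_subset_Ici_self) (C := C) fun x hx => ?_
  have := h (I * x) ⟨by simp, by simpa using le_of_lt hx⟩
  simpa using this

/-- Rotation of the ray of integration by a right angle. -/
theorem integral_ray_rotate {g : ℂ → ℂ} (hg : HoloOn g quadrant)
    (h : PowerDecay (3 / 2) g quadrant) :
    (∫ x : ℝ in Ioi 0, g x) = I * ∫ y : ℝ in Ioi 0, g (I * y) := by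
  have h0 : Tendsto (fun L : ℝ => ∫ x : ℝ in (0)..L, g x) atTop (𝓝 (∫ x : ℝ in Ioi 0, g x)) :=
    intervalIntegral_tendsto_integral_Ioi 0 (integrableOn_ofReal_of_decay hg.cont h) tendsto_id
  have h1 : Tendsto (fun L : ℝ => ∫ y : ℝ in (0)..L, g (I * y)) atTop
      (𝓝 (∫ y : ℝ in Ioi 0, g (I * y))) :=
    intervalIntegral_tendsto_integral_Ioi 0 (integrableOn_I_mul_of_decay hg.cont h) tendsto_id
  obtain ⟨C, hC, h⟩ := h
  have hlim : Tendsto (fun L : ℝ => C * (1 + L) ^ (-(1 / 2) : ℝ)) atTop (𝓝 0) := by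
    have := (tendsto_rpow_neg_atTop (y := 1 / 2) (by norm_num)).comp
      (tendsto_atTop_add_const_left atTop 1 tendsto_id)
    have := this.const_mul C
    rw [mul_zero] at this
    exact this
  -- A side of length `L` on which the integrand is at most `C (1 + L) ^ (-3/2)` contributes at most
  -- `C (1 + L) ^ (-1/2)`.
  have key : ∀ L : ℝ, 0 ≤ L → ∀ f : ℝ → ℂ, (∀ x ∈ Ioc 0 L, ‖f x‖ ≤ C * (1 + L) ^ (-(3 / 2) : ℝ)) →
      ‖∫ x in (0)..L, f x‖ ≤ C * (1 + L) ^ (-(1 / 2) : ℝ) := by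
    intro L hL f hf
    refine (intervalIntegral.norm_integral_le_of_norm_le_const
      (by rwa [uIoc_of_le hL])).trans ?_
    rw [sub_zero, abs_of_nonneg hL, mul_assoc]
    refine mul_le_mul_of_nonneg_left ?_ hC
    have : (1 + L) ^ (-(1 / 2) : ℝ) = (1 + L) ^ (-(3 / 2) : ℝ) * (1 + L) := by
      rw [← Real.rpow_add_one (by linarith)]
      norm_num
    rw [this]
    exact mul_le_mul_of_nonneg_left (by linarith) (by positivity)
  have hmono : ∀ L : ℝ, 0 ≤ L → ∀ z ∈ quadrant, L ≤ ‖z‖ →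
      ‖g z‖ ≤ C * (1 + L) ^ (-(3 / 2) : ℝ) := fun L hL z hz hLz =>
    (h z hz).trans (mul_le_mul_of_nonneg_left
      (Real.rpow_le_rpow_of_nonpos (by linarith) (by linarith) (by norm_num)) hC)
  have h2 : Tendsto (fun L : ℝ => ∫ x : ℝ in (0)..L, g (x + L * I)) atTop (𝓝 0) := by
    refine squeeze_zero_norm' ?_ hlim
    filter_upwards [eventually_ge_atTop 0] with L hL
    refine key L hL _ fun x hx => hmono L hL _ ⟨by simpa using hx.1.le, by simpa using hL⟩ ?_
    simpa using Complex.im_le_norm ((x : ℂ) + L * I)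
  have h3 : Tendsto (fun L : ℝ => ∫ y : ℝ in (0)..L, g (L + y * I)) atTop (𝓝 0) := by
    refine squeeze_zero_norm' ?_ hlim
    filter_upwards [eventually_ge_atTop 0] with L hL
    refine key L hL _ fun x hx => hmono L hL _ ⟨by simpa using hL, by simpa using hx.1.le⟩ ?_
    simpa using Complex.re_le_norm ((L : ℂ) + x * I)
  have h4 := ((h1.const_mul I).add h2).sub (h3.const_mul I)
  rw [mul_zero, add_zero, sub_zero] at h4
  refine tendsto_nhds_unique h0 (h4.congr' ?_)
  filter_upwards [eventually_ge_atTop 0] with L hL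
  rw [integral_square hg hL]

theorem HoloOn.mono {f : ℂ → ℂ} {s t : Set ℂ} (hf : HoloOn f s) (h : t ⊆ s) : HoloOn f t :=
  ⟨hf.cont.mono h, hf.diff.mono (interior_mono h)⟩

theorem PowerDecay.mono_set {α : ℝ} {f : ℂ → ℂ} {s t : Set ℂ} (hf : PowerDecay α f s)
    (h : t ⊆ s) : PowerDecay α f t := by
  obtain ⟨C, hC, hf⟩ := hf
  exact ⟨C, hC, fun z hz => hf z (h hz)⟩

theorem quadrant_subset_rightHalf : quadrant ⊆ rightHalf := fun _ hz => hz.1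

theorem neg_I_mul_mem_rightHalf {z : ℂ} (hz : z ∈ quadrant) : -I * z ∈ rightHalf := by
  have := hz.2
  simpa [rightHalf] using this

/-- Multiplication by `-I` carries the first quadrant onto the fourth, which lies in the right
half-plane. Results about the first quadrant thereby apply to the lower half of the right
half-plane. -/
theorem HoloOn.comp_neg_I_mul {f : ℂ → ℂ} (hf : HoloOn f rightHalf) :
    HoloOn (fun z => f (-I * z)) quadrant := by
  refine ⟨hf.cont.comp (by fun_prop) fun z hz => neg_I_mul_mem_rightHalf hz,
    hf.diff.comp (by fun_prop) fun z hz => ?_⟩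
  rw [interior_quadrant] at hz
  rw [interior_rightHalf]
  simpa using hz.2

theorem PowerDecay.comp_neg_I_mul {α : ℝ} {f : ℂ → ℂ} (hf : PowerDecay α f rightHalf) :
    PowerDecay α (fun z => f (-I * z)) quadrant := by
  obtain ⟨C, hC, hf⟩ := hf
  refine ⟨C, hC, fun z hz => ?_⟩
  simpa using hf (-I * z) (neg_I_mul_mem_rightHalf hz)

theorem continuous_comp_I_mul {f : ℂ → ℂ} (hf : ContinuousOn f rightHalf) :
    Continuous fun y : ℝ => f (I * y) :=
  hf.comp_continuous (by fun_prop) fun y => by simp [rightHalf]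

theorem integrable_I_mul_of_decay {g : ℂ → ℂ} (hg : ContinuousOn g rightHalf)
    (h : PowerDecay (3 / 2) g rightHalf) : Integrable (fun y : ℝ => g (I * y)) := by
  obtain ⟨C, hC, h⟩ := h
  rw [← integrableOn_univ]
  refine integrable_of_norm_le_three_halves MeasurableSet.univ
    (continuous_comp_I_mul hg).continuousOn (C := C) fun y _ => ?_
  simpa using h (I * y) (by simp [rightHalf])

theorem integral_eq_add_neg {f : ℝ → ℂ} (hf : Integrable f) :
    ∫ y, f y = (∫ y in Ioi 0, f y) + ∫ y in Ioi 0, f (-y) := by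
  rw [integral_comp_neg_Ioi, neg_zero, add_comm, ← intervalIntegral.integral_Iic_add_Ioi
    hf.integrableOn hf.integrableOn]

/-- Cauchy's theorem in the right half-plane. -/
theorem integral_imaginary_axis_eq_zero {g : ℂ → ℂ} (hg : HoloOn g rightHalf)
    (h : PowerDecay (3 / 2) g rightHalf) : ∫ y : ℝ, g (I * y) = 0 := by
  rw [integral_eq_add_neg (integrable_I_mul_of_decay hg.cont h)]
  -- The negative imaginary ray is turned onto the positive real one through the fourth quadrant
  -- (`h2`), and from there onto the positive imaginary one (`h1`). The factor `I * I = -1` makes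
  -- the two halves cancel.
  have h1 := integral_ray_rotate (hg.mono quadrant_subset_rightHalf)
    (h.mono_set quadrant_subset_rightHalf)
  have h2 := integral_ray_rotate hg.comp_neg_I_mul h.comp_neg_I_mul
  have h3 : ∀ y : ℝ, -I * (I * (y : ℂ)) = y := fun y => by
    rw [← mul_assoc, neg_mul, Complex.I_mul_I]; ring
  simp only [h3] at h2
  have h4 : ∀ y : ℝ, I * ((-y : ℝ) : ℂ) = -I * y := fun y => by push_cast; ring
  simp only [h4]
  rw [h2, h1, ← mul_assoc, Complex.I_mul_I]
  ring

theorem integral_cauchy_of_re_neg {H : ℂ → ℂ} (hH : HoloOn H rightHalf)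
    (h : PowerDecay (1 / 2) H rightHalf) {q : ℂ} (hq : q.re < 0) :
    ∫ y : ℝ, H (I * y) * (I * y - q)⁻¹ = 0 := by
  refine integral_imaginary_axis_eq_zero (g := fun ζ => H ζ * (ζ - q)⁻¹) (hH.mul ?_) ?_
  · refine HoloOn.of_differentiableAt fun z hz => ?_
    refine DifferentiableAt.inv (by fun_prop) (sub_ne_zero.2 ?_)
    rintro rfl
    exact absurd hz (not_le.2 hq)
  · have := h.mul (powerDecay_inv_sub hq)
    norm_num at this
    exact this

theorem integral_poisson_kernel {α β : ℝ} (hα : 0 < α) :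
    ∫ y : ℝ, (2 * α) / (α ^ 2 + (y - β) ^ 2) = 2 * Real.pi := by
  have h1 : ∀ y : ℝ, (2 * α) / (α ^ 2 + (y - β) ^ 2) =
      (2 / α) * (fun u : ℝ => (fun v : ℝ => (1 + v ^ 2)⁻¹) (u / α)) (y - β) := fun y => by
    have : (0 : ℝ) < α ^ 2 + (y - β) ^ 2 := by positivity
    field_simp
  simp_rw [h1]
  rw [integral_const_mul, integral_sub_right_eq_self (fun u : ℝ => (fun v : ℝ => (1 + v ^ 2)⁻¹) (u / α)) β,
    Measure.integral_comp_div (fun v : ℝ => (1 + v ^ 2)⁻¹) α, integral_univ_inv_one_add_sq, smul_eq_mul,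
    abs_of_pos hα]
  field_simp

/-- Cauchy's formula in the right half-plane. -/
theorem integral_cauchy_of_re_pos {H : ℂ → ℂ} (hH : HoloOn H rightHalf)
    (h : PowerDecay (1 / 2) H rightHalf) {q : ℂ} (hq : 0 < q.re) :
    ∫ y : ℝ, H (I * y) * (I * y - q)⁻¹ = -(2 * Real.pi) * H q := by
  set c : ℂ := -(starRingEnd ℂ) q with hc
  have hcre : c.re < 0 := by simp [hc, hq]
  -- `c` is the mirror image of `q` in the imaginary axis. Subtracting the constant `H q` would
  -- destroy the decay, so a simple fraction with pole `c` and value `H q` at `q` is subtracted.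
  -- Then `N / (ζ - q)` is holomorphic with decay 3/2, and what remains is `H q` times a Poisson
  -- kernel.
  set N : ℂ → ℂ := fun ζ => H ζ + (-(H q * (2 * q.re))) * (ζ - c)⁻¹ with hN
  have hcne : ∀ ζ ∈ rightHalf, ζ - c ≠ 0 := fun ζ hζ h0 => by
    rw [sub_eq_zero] at h0
    rw [h0] at hζ
    exact absurd hζ (not_le.2 hcre)
  have hNq : N q = 0 := by
    have hq0 : (q.re : ℂ) ≠ 0 := by exact_mod_cast hq.ne'
    have : q - c = 2 * q.re := by
      rw [hc, sub_neg_eq_add, Complex.add_conj]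
      push_cast
      ring
    simp only [hN, this]
    field_simp
    ring
  have hinv : HoloOn (fun ζ => (ζ - c)⁻¹) rightHalf :=
    HoloOn.of_differentiableAt fun z hz => DifferentiableAt.inv (by fun_prop) (hcne z hz)
  have hNH : HoloOn N rightHalf :=
    ⟨hH.cont.add (continuousOn_const.mul hinv.cont), hH.diff.add (hinv.diff.const_mul _)⟩
  have hNd : PowerDecay (1 / 2) N rightHalf :=
    h.add (((powerDecay_inv_sub hcre).mono (by norm_num)).const_mul _)
  have hqint : q ∈ interior rightHalf := by rw [interior_rightHalf]; exact hq
  have hqn : rightHalf ∈ 𝓝 q := mem_interior_iff_mem_nhds.1 hqint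
  have hg : HoloOn (dslope N q) rightHalf := by
    refine ⟨(continuousOn_dslope hqn).2 ⟨hNH.cont, ?_⟩, (Complex.differentiableOn_dslope
      (isOpen_interior.mem_nhds hqint)).2 hNH.diff⟩
    exact hNH.diff.differentiableAt (isOpen_interior.mem_nhds hqint)
  have hval : ∀ ζ, ζ ≠ q → dslope N q ζ = N ζ * (ζ - q)⁻¹ := fun ζ hζ => by
    rw [dslope_of_ne _ hζ, slope_def_field, hNq, sub_zero, div_eq_mul_inv]
  have hgd : PowerDecay (3 / 2) (dslope N q) rightHalf := by
    obtain ⟨C, hC, hNd⟩ := hNd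
    refine PowerDecay.of_large (by norm_num) isClosed_rightHalf hg.cont (R := 1 + 2 * ‖q‖)
      (C := C * 2) (by linarith [norm_nonneg q]) fun z hz hzR => ?_
    have hz0 : 0 < ‖z‖ := by linarith [norm_nonneg q]
    have h2 : ‖z‖ / 2 ≤ ‖z - q‖ := by
      have : ‖z‖ ≤ ‖z - q‖ + ‖q‖ := by simpa using norm_add_le (z - q) q
      linarith
    have hzq : z ≠ q := by
      rintro rfl
      linarith [norm_nonneg z]
    rw [hval z hzq, norm_mul, norm_inv]
    have h3 : (‖z - q‖)⁻¹ ≤ 2 * ‖z‖⁻¹ := by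
      rw [inv_eq_one_div, div_le_iff₀ (by linarith)]
      field_simp
      linarith
    have h4 : ‖N z‖ ≤ C * ‖z‖ ^ (-(1 / 2) : ℝ) := (hNd z hz).trans
      (mul_le_mul_of_nonneg_left
        (Real.rpow_le_rpow_of_nonpos hz0 (by linarith) (by norm_num)) hC)
    have h5 : ‖z‖ ^ (-(3 / 2) : ℝ) = ‖z‖ ^ (-(1 / 2) : ℝ) * ‖z‖⁻¹ := by
      rw [← Real.rpow_neg_one, ← Real.rpow_add hz0]
      norm_num
    rw [h5]
    calc ‖N z‖ * ‖z - q‖⁻¹ ≤ (C * ‖z‖ ^ (-(1 / 2) : ℝ)) * (2 * ‖z‖⁻¹) :=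
          mul_le_mul h4 h3 (by positivity) (by positivity)
      _ = _ := by ring
  have hzero := integral_imaginary_axis_eq_zero hg hgd
  have hne : ∀ y : ℝ, I * (y : ℂ) ≠ q := fun y hy => by
    have := congrArg Complex.re hy
    simp at this
    exact hq.ne this
  have hker : ∀ y : ℝ, (I * (y : ℂ) - c)⁻¹ * (I * y - q)⁻¹ * (2 * q.re) =
      -((((2 * q.re) / (q.re ^ 2 + (y - q.im) ^ 2) : ℝ)) : ℂ) := fun y => by
    have h1 : (I * (y : ℂ) - c) * (I * y - q) = -((q.re ^ 2 + (y - q.im) ^ 2 : ℝ) : ℂ) := by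
      rw [← Complex.ofReal_neg]
      apply Complex.ext
      · rw [Complex.ofReal_re]
        simp [hc]
        ring
      · rw [Complex.ofReal_im]
        simp [hc]
        ring
    rw [← mul_inv, h1, inv_neg]
    push_cast
    rw [div_eq_mul_inv]
    ring
  have hpt : ∀ y : ℝ, H (I * y) * (I * y - q)⁻¹ = dslope N q (I * y) +
      (-H q) * ((((2 * q.re) / (q.re ^ 2 + (y - q.im) ^ 2) : ℝ)) : ℂ) := fun y => by
    rw [hval _ (hne y)]
    simp only [hN]
    linear_combination (H q) * hker y
  simp_rw [hpt]
  -- The integral is nonzero, so it cannot be the default value 0 of a divergent one.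
  have hkint : Integrable (fun y : ℝ => (2 * q.re) / (q.re ^ 2 + (y - q.im) ^ 2)) := by
    by_contra hcon
    have := integral_poisson_kernel (β := q.im) hq
    rw [integral_undef hcon] at this
    linarith [Real.pi_pos]
  have hkint' : Integrable (fun y : ℝ =>
      (-H q) * ((((2 * q.re) / (q.re ^ 2 + (y - q.im) ^ 2) : ℝ)) : ℂ)) :=
    hkint.ofReal.const_mul _
  rw [integral_add (integrable_I_mul_of_decay hg.cont hgd) hkint', hzero,
    integral_const_mul, integral_complex_ofReal, integral_poisson_kernel hq]
  push_cast
  ring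

theorem integrable_cauchy_kernel {H : ℂ → ℂ} (hH : ContinuousOn H rightHalf)
    (hd : PowerDecay (1 / 2) H rightHalf) {c : ℂ} (hc : c.re ≠ 0) :
    Integrable fun y : ℝ => H (I * y) * (I * y - c)⁻¹ := by
  rw [← integrableOn_univ]
  have hne : ∀ y : ℝ, I * (y : ℂ) - c ≠ 0 := fun y hy => by
    have := congrArg Complex.re hy
    simp at this
    exact hc this
  obtain ⟨C₁, hC₁, hd₁⟩ := hd
  refine integrable_of_norm_le_three_halves MeasurableSet.univ
    (C := C₁ * ((1 + ‖c‖) / |c.re| + 1)) ?_ fun y _ => ?_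
  · exact ((continuous_comp_I_mul hH).mul (Continuous.inv₀ (by fun_prop) hne)).continuousOn
  · have h1 := hd₁ (I * y) (by simp [rightHalf])
    have hn : ‖I * (y : ℂ)‖ = ‖y‖ := by simp
    have h2 : 1 + ‖y‖ ≤ ((1 + ‖c‖) / |c.re| + 1) * ‖I * (y : ℂ) - c‖ := by
      rcases lt_or_gt_of_ne hc with h | h
      · have := one_add_norm_le_mul_norm_sub (ζ := I * (y : ℂ)) h (by simp [rightHalf])
        rwa [hn] at this
      -- For a pole on the right, reflect in the origin: the imaginary axis is preserved and the
      -- pole moves to the left.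
      · have := one_add_norm_le_mul_norm_sub (ζ := -(I * (y : ℂ))) (q := -c)
          (by simpa using h) (by simp [rightHalf])
        rw [norm_neg, hn, ← neg_sub', norm_neg, norm_neg, Complex.neg_re, abs_neg] at this
        exact this
    rw [hn] at h1
    rw [norm_mul, norm_inv]
    have hpos' : 0 < ‖I * (y : ℂ) - c‖ := norm_pos_iff.2 (hne y)
    have hy0 : (0 : ℝ) < 1 + ‖y‖ := by positivity
    have h5 : (1 + ‖y‖) ^ (-(3 / 2) : ℝ) = (1 + ‖y‖) ^ (-(1 / 2) : ℝ) * (1 + ‖y‖)⁻¹ := by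
      rw [← Real.rpow_neg_one, ← Real.rpow_add hy0]
      norm_num
    have h6 : ‖I * (y : ℂ) - c‖⁻¹ ≤ ((1 + ‖c‖) / |c.re| + 1) * (1 + ‖y‖)⁻¹ := by
      rw [inv_eq_one_div, ← div_eq_mul_inv, div_le_div_iff₀ hpos' hy0]
      linarith
    rw [h5]
    calc _ ≤ (C₁ * (1 + ‖y‖) ^ (-(1 / 2) : ℝ)) * (((1 + ‖c‖) / |c.re| + 1) * (1 + ‖y‖)⁻¹) :=
          mul_le_mul h1 h6 (by positivity) (by positivity)
      _ = _ := by ring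
-- The weight on the exponents `u`
/-- The probability density `m(u) = 2 a cosh u / (π (4 sinh² u + a²))`. -/
def weight (a u : ℝ) : ℝ := 2 * a * Real.cosh u / (Real.pi * (4 * Real.sinh u ^ 2 + a ^ 2))

/-- `∫ log (1 + p e^{-u}) m(u) du`: the logarithm of the factor of `1 + a s + s²` that is
holomorphic in the right half-plane. -/
def logFactor (a : ℝ) (p : ℂ) : ℂ := ∫ u : ℝ, Complex.log (1 + p * Real.exp (-u)) * weight a u

section Weight

variable {a : ℝ}

theorem weight_denom_pos (ha : 0 < a) (u : ℝ) : 0 < Real.pi * (4 * Real.sinh u ^ 2 + a ^ 2) := by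
  have := Real.pi_pos
  positivity

theorem weight_nonneg (ha : 0 < a) (u : ℝ) : 0 ≤ weight a u :=
  div_nonneg (by have := Real.cosh_pos u; positivity) (weight_denom_pos ha u).le

theorem weight_neg (u : ℝ) : weight a (-u) = weight a u := by simp [weight]

theorem continuous_weight (ha : 0 < a) : Continuous (weight a) := by
  unfold weight
  exact Continuous.div (by fun_prop) (by fun_prop) fun u => (weight_denom_pos ha u).ne'

theorem weight_le (ha : 0 < a) : ∃ C, 0 ≤ C ∧ ∀ u, weight a u ≤ C * Real.exp (-|u|) := by
  have hc : 0 < min 4 (a ^ 2) := lt_min (by norm_num) (by positivity)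
  set c := min 4 (a ^ 2)
  refine ⟨4 * a / (Real.pi * c), by have := Real.pi_pos; positivity, fun u => ?_⟩
  have h1 : c * Real.cosh u ^ 2 ≤ 4 * Real.sinh u ^ 2 + a ^ 2 := by
    rw [Real.cosh_sq]
    nlinarith [min_le_left 4 (a ^ 2), min_le_right 4 (a ^ 2), sq_nonneg (Real.sinh u)]
  have h2 : Real.exp |u| ≤ 2 * Real.cosh u := by
    rw [← Real.cosh_abs, Real.cosh_eq]
    linarith [Real.exp_pos (-|u|)]
  have h3 := Real.cosh_pos u
  have hpi := Real.pi_pos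
  rw [weight, Real.exp_neg, ← div_eq_mul_inv, div_div, div_le_div_iff₀ (weight_denom_pos ha u)
    (by positivity)]
  have h4 : Real.exp |u| * Real.cosh u ≤ 2 * Real.cosh u ^ 2 := by nlinarith
  calc 2 * a * Real.cosh u * (Real.pi * c * Real.exp |u|)
      = 2 * a * Real.pi * c * (Real.exp |u| * Real.cosh u) := by ring
    _ ≤ 2 * a * Real.pi * c * (2 * Real.cosh u ^ 2) := by gcongr
    _ = 4 * a * Real.pi * (c * Real.cosh u ^ 2) := by ring
    _ ≤ 4 * a * Real.pi * (4 * Real.sinh u ^ 2 + a ^ 2) := by gcongr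
    _ = _ := by ring

theorem integrable_exp_neg_mul_abs {c : ℝ} (hc : 0 < c) :
    Integrable fun u : ℝ => Real.exp (-(c * |u|)) := by
  rw [← integrableOn_univ, ← Iic_union_Ioi (a := (0 : ℝ)), integrableOn_union]
  constructor
  · refine (integrableOn_exp_mul_Iic hc 0).congr_fun (fun x hx => ?_) measurableSet_Iic
    simp only
    rw [abs_of_nonpos hx]
    ring_nf
  · refine (integrableOn_exp_mul_Ioi (neg_lt_zero.2 hc) 0).congr_fun (fun x hx => ?_)
      measurableSet_Ioi
    simp only
    rw [abs_of_pos hx]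
    ring_nf

/-- `exp (|u| / 2)` is the growth in `u` of the square-root bound on `log (1 + p e^{-u})`; the
weight decays like `exp (-|u|)`. This product is the dominating function for `logFactor`. -/
theorem integrable_exp_half_mul_weight (ha : 0 < a) :
    Integrable fun u : ℝ => Real.exp (|u| / 2) * weight a u := by
  obtain ⟨C, hC, h⟩ := weight_le ha
  refine Integrable.mono' ((integrable_exp_neg_mul_abs (c := 1 / 2) (by norm_num)).const_mul C)
    ((Continuous.mul (by fun_prop) (continuous_weight ha)).aestronglyMeasurable)
    (ae_of_all _ fun u => ?_)
  rw [Real.norm_of_nonneg (mul_nonneg (Real.exp_pos _).le (weight_nonneg ha u))]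
  calc Real.exp (|u| / 2) * weight a u ≤ Real.exp (|u| / 2) * (C * Real.exp (-|u|)) :=
        mul_le_mul_of_nonneg_left (h u) (Real.exp_pos _).le
    _ = C * (Real.exp (|u| / 2) * Real.exp (-|u|)) := by ring
    _ = _ := by rw [← Real.exp_add]; ring_nf

theorem integrable_mul_weight_of_le (ha : 0 < a) {f : ℝ → ℂ} (hf : AEStronglyMeasurable f) {C : ℝ}
    (h : ∀ u, ‖f u‖ ≤ C * Real.exp (|u| / 2)) : Integrable fun u => f u * (weight a u : ℂ) := by
  refine Integrable.mono' ((integrable_exp_half_mul_weight ha).const_mul C)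
    (hf.mul ((Complex.continuous_ofReal.comp (continuous_weight ha)).aestronglyMeasurable))
    (ae_of_all _ fun u => ?_)
  rw [norm_mul, Complex.norm_real, Real.norm_of_nonneg (weight_nonneg ha u), ← mul_assoc]
  exact mul_le_mul_of_nonneg_right (h u) (weight_nonneg ha u)

theorem integrable_weight (ha : 0 < a) : Integrable (weight a) := by
  refine Integrable.mono' (integrable_exp_half_mul_weight ha)
    (continuous_weight ha).aestronglyMeasurable (ae_of_all _ fun u => ?_)
  rw [Real.norm_of_nonneg (weight_nonneg ha u)]
  have : 1 ≤ Real.exp (|u| / 2) := Real.one_le_exp (by positivity)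
  nlinarith [weight_nonneg ha u]

/-- The weight has the antiderivative `π⁻¹ arctan ((2 / a) sinh u)`, which runs from `-1/2` to
`1/2`. -/
theorem integral_weight (ha : 0 < a) : ∫ u, weight a u = 1 := by
  have hpi := Real.pi_pos
  have hd : ∀ u, HasDerivAt (fun u => Real.pi⁻¹ * Real.arctan (2 / a * Real.sinh u))
      (weight a u) u := fun u => by
    refine (((Real.hasDerivAt_sinh u).const_mul (2 / a)).arctan.const_mul Real.pi⁻¹).congr_deriv ?_
    unfold weight
    have := weight_denom_pos ha u
    have h2 : (0 : ℝ) < 1 + (2 / a * Real.sinh u) ^ 2 := by positivity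
    have h3 : (0 : ℝ) < 4 * Real.sinh u ^ 2 + a ^ 2 := by positivity
    field_simp
    ring
  have htop : Tendsto Real.sinh atTop atTop :=
    tendsto_atTop_mono' atTop ((eventually_ge_atTop 0).mono fun u hu => Real.self_le_sinh_iff.2 hu)
      tendsto_id
  have hbot : Tendsto Real.sinh atBot atBot := by
    have := (tendsto_neg_atTop_atBot.comp htop).comp tendsto_neg_atBot_atTop
    refine this.congr fun u => ?_
    simp
  have h2a : 0 < 2 / a := by positivity
  have key := integral_of_hasDerivAt_of_tendsto hd (integrable_weight ha)
    (((Real.tendsto_arctan_atBot.mono_right nhdsWithin_le_nhds).comp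
      (hbot.const_mul_atBot h2a)).const_mul Real.pi⁻¹)
    (((Real.tendsto_arctan_atTop.mono_right nhdsWithin_le_nhds).comp
      (htop.const_mul_atTop h2a)).const_mul Real.pi⁻¹)
  rw [key]
  field_simp
  ring

theorem integral_id_mul_weight : ∫ u : ℝ, (u : ℂ) * (weight a u : ℂ) = 0 := by
  have h := integral_neg_eq_self (fun u : ℝ => (u : ℂ) * (weight a u : ℂ)) volume
  simp only [weight_neg, Complex.ofReal_neg, neg_mul] at h
  rw [integral_neg] at h
  exact self_eq_neg.1 h.symm

end Weight

/-! ### The logarithm of the factor: holomorphy, growth, inversion -/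

theorem one_add_mem_slitPlane {q : ℂ} (hq : 0 ≤ q.re) : 1 + q ∈ Complex.slitPlane := by
  left
  simp only [Complex.add_re, Complex.one_re]
  linarith

theorem one_le_norm_one_add {q : ℂ} (hq : 0 ≤ q.re) : 1 ≤ ‖1 + q‖ := by
  have := Complex.re_le_norm (1 + q)
  simp only [Complex.add_re, Complex.one_re] at this
  linarith

/-- The square root dominates both the linear behaviour at 0 and the logarithmic growth at infinity.
This exponent 1/2 is the source of the decay rate 1/2 of the logarithms of the canonical functions.
-/
theorem norm_log_one_add_le_sqrt {q : ℂ} (hq : 0 ≤ q.re) :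
    ‖Complex.log (1 + q)‖ ≤ 5 * √‖q‖ := by
  have hn := norm_nonneg q
  have hs := Real.sq_sqrt hn
  have hs0 := Real.sqrt_nonneg ‖q‖
  rcases le_total ‖q‖ (1 / 2) with h | h
  · have := Complex.norm_log_one_add_half_le_self h
    have h1 : √‖q‖ ≤ 1 := by exact Real.sqrt_le_one.2 (by linarith)
    nlinarith
  · have h1 : 1 / 2 ≤ √‖q‖ := Real.le_sqrt_of_sq_le (by linarith)
    have hsum : ‖Complex.log (1 + q)‖ ≤ |(Complex.log (1 + q)).re| + |(Complex.log (1 + q)).im| :=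
      Complex.norm_le_abs_re_add_abs_im _
    rw [Complex.log_re, Complex.log_im] at hsum
    have h2 : |Complex.arg (1 + q)| ≤ Real.pi / 2 :=
      Complex.abs_arg_le_pi_div_two_iff.2 (by simp only [Complex.add_re, Complex.one_re]; linarith)
    have h3 : Real.log ‖1 + q‖ ≤ 2 * √‖q‖ := by
      have h4 : ‖1 + q‖ ≤ (1 + √‖q‖) ^ 2 := by
        refine (norm_add_le _ _).trans ?_
        rw [norm_one]
        nlinarith
      calc Real.log ‖1 + q‖ ≤ Real.log ((1 + √‖q‖) ^ 2) :=
            Real.log_le_log (by linarith [one_le_norm_one_add hq]) h4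
        _ = 2 * Real.log (1 + √‖q‖) := by rw [Real.log_pow]; norm_num
        _ ≤ 2 * √‖q‖ := by
            have := Real.log_le_sub_one_of_pos (x := 1 + √‖q‖) (by positivity)
            linarith
    rw [abs_of_nonneg (Real.log_nonneg (one_le_norm_one_add hq))] at hsum
    have hpi := Real.pi_lt_d2
    -- The argument is at most `π / 2 < 3 * 0.53`. The second alternative contradicts `‖q‖ ≥ 1 / 2`.
    have h5 : Real.pi / 2 ≤ 3 * √‖q‖ ∨ √‖q‖ < 0.53 := by
      rcases le_total 0.53 (√‖q‖) with h | h
      · left; linarith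
      · rcases h.lt_or_eq with h | h
        · right; exact h
        · left; linarith
    rcases h5 with h5 | h5
    · linarith
    · nlinarith

theorem re_mul_exp_nonneg {p : ℂ} (hp : p ∈ rightHalf) (u : ℝ) :
    0 ≤ (p * (Real.exp (-u) : ℂ)).re := by
  rw [Complex.re_mul_ofReal]
  exact mul_nonneg hp (Real.exp_pos _).le

theorem norm_log_kernel_le {p : ℂ} (hp : p ∈ rightHalf) (u : ℝ) :
    ‖Complex.log (1 + p * (Real.exp (-u) : ℂ))‖ ≤ 5 * √‖p‖ * Real.exp (|u| / 2) := by
  refine (norm_log_one_add_le_sqrt (re_mul_exp_nonneg hp u)).trans ?_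
  rw [mul_assoc, norm_mul, Real.sqrt_mul (norm_nonneg _), Complex.norm_real,
    Real.norm_of_nonneg (Real.exp_pos _).le, ← Real.exp_half]
  gcongr
  linarith [neg_abs_le u]

theorem continuous_log_kernel {p : ℂ} (hp : p ∈ rightHalf) :
    Continuous fun u : ℝ => Complex.log (1 + p * (Real.exp (-u) : ℂ)) :=
  Continuous.clog (by fun_prop) fun u => one_add_mem_slitPlane (re_mul_exp_nonneg hp u)

section Factor

variable {a : ℝ}

theorem integrable_log_kernel (ha : 0 < a) {p : ℂ} (hp : p ∈ rightHalf) :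
    Integrable fun u : ℝ => Complex.log (1 + p * (Real.exp (-u) : ℂ)) * (weight a u : ℂ) :=
  integrable_mul_weight_of_le ha (continuous_log_kernel hp).aestronglyMeasurable
    (norm_log_kernel_le hp)

theorem norm_logFactor_le (ha : 0 < a) : ∃ C, 0 ≤ C ∧ ∀ p ∈ rightHalf, ‖logFactor a p‖ ≤ C * √‖p‖ := by
  refine ⟨5 * ∫ u, Real.exp (|u| / 2) * weight a u, ?_, fun p hp => ?_⟩
  · exact mul_nonneg (by norm_num) (integral_nonneg fun u =>
      mul_nonneg (Real.exp_pos _).le (weight_nonneg ha u))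
  · rw [mul_right_comm, ← integral_const_mul]
    refine norm_integral_le_of_norm_le ((integrable_exp_half_mul_weight ha).const_mul _)
      (ae_of_all _ fun u => ?_)
    rw [norm_mul, Complex.norm_real, Real.norm_of_nonneg (weight_nonneg ha u), ← mul_assoc]
    exact mul_le_mul_of_nonneg_right (norm_log_kernel_le hp u) (weight_nonneg ha u)

theorem holoOn_logFactor (ha : 0 < a) : HoloOn (logFactor a) rightHalf := by
  constructor
  · intro p₀ hp₀
    refine continuousWithinAt_of_dominated
      (bound := fun u => 5 * √(‖p₀‖ + 1) * (Real.exp (|u| / 2) * weight a u)) ?_ ?_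
      ((integrable_exp_half_mul_weight ha).const_mul _) (ae_of_all _ fun u => ?_)
    · filter_upwards [self_mem_nhdsWithin] with p hp using
        (integrable_log_kernel ha hp).aestronglyMeasurable
    · filter_upwards [self_mem_nhdsWithin, nhdsWithin_le_nhds
        (continuous_norm.continuousAt.eventually_lt_const (lt_add_one ‖p₀‖))] with p hp hpn
      refine ae_of_all _ fun u => ?_
      rw [norm_mul, Complex.norm_real, Real.norm_of_nonneg (weight_nonneg ha u), ← mul_assoc]
      refine mul_le_mul_of_nonneg_right ((norm_log_kernel_le hp u).trans ?_) (weight_nonneg ha u)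
      gcongr
    · refine ContinuousWithinAt.mul (ContinuousWithinAt.clog (by fun_prop) ?_) (by fun_prop)
      exact one_add_mem_slitPlane (re_mul_exp_nonneg hp₀ u)
  · rw [interior_rightHalf]
    intro p₀ hp₀
    have hp₀' : 0 < p₀.re := hp₀
    have hs : {p : ℂ | p₀.re / 2 < p.re} ∈ 𝓝 p₀ :=
      (isOpen_lt continuous_const Complex.continuous_re).mem_nhds
        (show p₀.re / 2 < p₀.re by linarith)
    have hsub : ∀ p ∈ {p : ℂ | p₀.re / 2 < p.re}, p ∈ rightHalf := fun p hp => by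
      have : p₀.re / 2 < p.re := hp
      exact show (0 : ℝ) ≤ p.re by linarith
    refine (hasDerivAt_integral_of_dominated_loc_of_deriv_le (μ := volume)
      (F := fun (p : ℂ) (u : ℝ) => Complex.log (1 + p * (Real.exp (-u) : ℂ)) * (weight a u : ℂ))
      (F' := fun (p : ℂ) (u : ℝ) => (1 * (Real.exp (-u) : ℂ)) / (1 + p * (Real.exp (-u) : ℂ)) *
        (weight a u : ℂ)) (bound := fun u => 2 / p₀.re * weight a u) hs
      ?_ (integrable_log_kernel ha hp₀'.le) ?_ (ae_of_all _ fun u p hp => ?_)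
      ((integrable_weight ha).const_mul _) (ae_of_all _ fun u p hp => ?_)).2.differentiableAt.differentiableWithinAt
    · filter_upwards [hs] with p hp using (integrable_log_kernel ha (hsub p hp)).aestronglyMeasurable
    · refine (Continuous.mul (Continuous.div (by fun_prop) (by fun_prop) fun u => ?_)
        (Complex.continuous_ofReal.comp (continuous_weight ha))).aestronglyMeasurable
      exact Complex.slitPlane_ne_zero
        (one_add_mem_slitPlane (re_mul_exp_nonneg (p := p₀) hp₀'.le u))
    · rw [norm_mul, Complex.norm_real, Real.norm_of_nonneg (weight_nonneg ha u)]
      refine mul_le_mul_of_nonneg_right ?_ (weight_nonneg ha u)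
      have he := Real.exp_pos (-u)
      have hp' : p₀.re / 2 < p.re := hp
      rw [one_mul, norm_div, Complex.norm_real, Real.norm_of_nonneg he.le]
      have h1 : p₀.re / 2 * Real.exp (-u) ≤ ‖1 + p * (Real.exp (-u) : ℂ)‖ := by
        refine le_trans ?_ (Complex.re_le_norm _)
        rw [Complex.add_re, Complex.re_mul_ofReal, Complex.one_re]
        nlinarith
      rw [div_le_div_iff₀ (lt_of_lt_of_le (by positivity) h1) hp₀']
      linarith
    · refine HasDerivAt.mul_const (HasDerivAt.clog ?_ ?_) _
      · exact ((hasDerivAt_id p).mul_const _).const_add 1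
      · exact one_add_mem_slitPlane (re_mul_exp_nonneg (hsub p hp) u)

/-- `|1 + q| ≥ 1` when `Re q ≥ 0`, so the averaged logarithm has nonnegative real part; this gives
`|D| ≥ 1`. -/
theorem re_logFactor_nonneg (ha : 0 < a) {p : ℂ} (hp : p ∈ rightHalf) : 0 ≤ (logFactor a p).re := by
  have : (logFactor a p).re = ∫ u : ℝ, (Complex.log (1 + p * (Real.exp (-u) : ℂ)) *
      (weight a u : ℂ)).re := (integral_re (integrable_log_kernel ha hp)).symm
  rw [this]
  refine integral_nonneg fun u => ?_
  simp only [Pi.zero_apply]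
  rw [Complex.re_mul_ofReal, Complex.log_re]
  exact mul_nonneg (Real.log_nonneg (one_le_norm_one_add (re_mul_exp_nonneg hp u)))
    (weight_nonneg ha u)

theorem logFactor_conj {p : ℂ} (hp : p ∈ rightHalf) :
    logFactor a (starRingEnd ℂ p) = starRingEnd ℂ (logFactor a p) := by
  unfold logFactor
  rw [← integral_conj]
  congr 1
  ext u
  rw [map_mul, Complex.conj_ofReal, ← Complex.log_conj]
  · rw [map_add, map_mul, map_one, Complex.conj_ofReal]
  · exact Complex.slitPlane_arg_ne_pi (one_add_mem_slitPlane (re_mul_exp_nonneg hp u))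

theorem inv_mem_rightHalf {p : ℂ} (hp : p ∈ rightHalf) : p⁻¹ ∈ rightHalf := by
  change 0 ≤ (p⁻¹).re
  rw [Complex.inv_re]
  exact div_nonneg hp (Complex.normSq_nonneg _)

/-- No branch is crossed: one argument is at most `π / 2` in absolute value, the other strictly
less. -/
theorem log_one_add_eq {q : ℂ} (hq : q ∈ rightHalf) (hq0 : q ≠ 0) :
    Complex.log (1 + q) = Complex.log q + Complex.log (1 + q⁻¹) := by
  have h1 : 1 + q = q * (1 + q⁻¹) := by field_simp; ring
  have hinv := inv_mem_rightHalf hq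
  have h2 : (1 + q⁻¹) ∈ Complex.slitPlane := one_add_mem_slitPlane hinv
  rw [h1, Complex.log_mul hq0 (Complex.slitPlane_ne_zero h2)]
  have h3 : |Complex.arg q| ≤ Real.pi / 2 := Complex.abs_arg_le_pi_div_two_iff.2 hq
  have h4 : |Complex.arg (1 + q⁻¹)| < Real.pi / 2 := by
    rw [Complex.abs_arg_lt_pi_div_two_iff]
    left
    have : 0 ≤ (q⁻¹).re := hinv
    simp only [Complex.add_re, Complex.one_re]
    linarith
  rw [abs_le] at h3
  rw [abs_lt] at h4
  constructor <;> linarith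

/-- Write `log (1 + p e^{-u}) = log p - u + log (1 + p⁻¹ e^u)` and integrate: the weight has mass 1,
mean 0 and is even. The behaviour at infinity is thus reduced to that at 0. -/
theorem logFactor_eq_log_add (ha : 0 < a) {p : ℂ} (hp : p ∈ rightHalf) (hp0 : p ≠ 0) :
    logFactor a p = Complex.log p + logFactor a p⁻¹ := by
  have h1 : logFactor a p⁻¹ = ∫ u : ℝ, Complex.log (1 + p⁻¹ * (Real.exp u : ℂ)) *
      (weight a u : ℂ) := by
    rw [logFactor, ← integral_neg_eq_self]
    simp only [neg_neg, weight_neg]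
  have hint : Integrable fun u : ℝ => Complex.log (1 + p⁻¹ * (Real.exp u : ℂ)) *
      (weight a u : ℂ) := by
    have := (integrable_log_kernel ha (inv_mem_rightHalf hp)).comp_neg
    simpa only [neg_neg, weight_neg] using this
  have hlog : Integrable fun u : ℝ => Complex.log p * (weight a u : ℂ) :=
    (integrable_weight ha).ofReal.const_mul _
  have hid : Integrable fun u : ℝ => (u : ℂ) * (weight a u : ℂ) := by
    refine integrable_mul_weight_of_le ha (C := 2) (by fun_prop) fun u => ?_
    rw [Complex.norm_real, Real.norm_eq_abs]
    linarith [Real.add_one_le_exp (|u| / 2)]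
  have hpt : ∀ u : ℝ, Complex.log (1 + p * (Real.exp (-u) : ℂ)) * (weight a u : ℂ) =
      Complex.log p * (weight a u : ℂ) - (u : ℂ) * (weight a u : ℂ) +
        Complex.log (1 + p⁻¹ * (Real.exp u : ℂ)) * (weight a u : ℂ) := fun u => by
    have he : (Real.exp (-u) : ℂ) ≠ 0 := by exact_mod_cast (Real.exp_pos _).ne'
    rw [log_one_add_eq (re_mul_exp_nonneg hp u) (mul_ne_zero hp0 he),
      Complex.log_mul_ofReal _ (Real.exp_pos _) _ hp0, Real.log_exp, mul_inv, ← Complex.ofReal_inv,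
      ← Real.exp_neg, neg_neg]
    push_cast
    ring
  rw [h1, logFactor]
  simp_rw [hpt]
  have hsub : Integrable fun u : ℝ => Complex.log p * (weight a u : ℂ) -
      (u : ℂ) * (weight a u : ℂ) := hlog.sub hid
  rw [integral_add hsub hint, integral_sub hlog hid, integral_const_mul,
    integral_id_mul_weight, integral_complex_ofReal, integral_weight ha]
  simp

end Factor
-- Factorization of `1 + a s + s²` by Poisson's formula
theorem quadratic_ne_zero {a : ℝ} (ha : 0 < a) {ζ : ℂ} (hζ : ζ ∈ rightHalf) :
    1 + a * ζ + ζ ^ 2 ≠ 0 := by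
  intro h
  have h0 : 0 ≤ ζ.re := hζ
  have hre := congrArg Complex.re h
  have him := congrArg Complex.im h
  simp [pow_two] at hre him
  have h1 : ζ.im * (a + 2 * ζ.re) = 0 := by linarith
  rcases mul_eq_zero.1 h1 with h2 | h2
  · rw [h2] at hre
    nlinarith
  · linarith

theorem quadratic_norm_lower {a : ℝ} (ha : 0 < a) {ζ : ℂ} (hζ : 2 * a + 2 ≤ ‖ζ‖) :
    ‖ζ‖ ^ 2 / 2 ≤ ‖1 + a * ζ + ζ ^ 2‖ := by
  have h1 : ‖ζ ^ 2‖ ≤ ‖1 + a * ζ + ζ ^ 2‖ + ‖1 + a * ζ‖ := by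
    have := norm_sub_le (1 + a * ζ + ζ ^ 2) (1 + a * ζ)
    rwa [add_sub_cancel_left] at this
  have h2 : ‖1 + a * ζ‖ ≤ 1 + a * ‖ζ‖ := by
    refine (norm_add_le _ _).trans ?_
    rw [norm_one, norm_mul, Complex.norm_real, Real.norm_of_nonneg ha.le]
  rw [norm_pow] at h1
  nlinarith

section Poisson

variable {a : ℝ}

/-- The logarithmic derivative `H` of `1 + a ζ + ζ²` is holomorphic in the right half-plane and
decays, so Poisson's formula recovers `H s` from the values of `H` on the imaginary axis. As `H s`
is real, `Re H(iy)` alone suffices. -/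
theorem integral_re_logDeriv (ha : 0 < a) {s : ℝ} (hs : 0 < s) :
    ∫ y : ℝ, a * (1 + y ^ 2) / ((1 - y ^ 2) ^ 2 + a ^ 2 * y ^ 2) * (2 * s / (y ^ 2 + s ^ 2)) =
      2 * Real.pi * ((a + 2 * s) / (1 + a * s + s ^ 2)) := by
  set H : ℂ → ℂ := fun ζ => (a + 2 * ζ) / (1 + a * ζ + ζ ^ 2) with hH
  have hholo : HoloOn H rightHalf := HoloOn.of_differentiableAt fun z hz =>
    DifferentiableAt.div (by fun_prop) (by fun_prop) (quadratic_ne_zero ha hz)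
  have hdecay : PowerDecay (1 / 2) H rightHalf := by
    refine PowerDecay.of_large (by norm_num) isClosed_rightHalf hholo.cont (R := 2 * a + 2) (C := 6)
      (by linarith) fun z hz hR => ?_
    have hz1 : 1 ≤ ‖z‖ := by linarith
    have h1 := quadratic_norm_lower ha hR
    have h2 : ‖(a : ℂ) + 2 * z‖ ≤ 3 * ‖z‖ := by
      refine (norm_add_le _ _).trans ?_
      rw [Complex.norm_real, Real.norm_of_nonneg ha.le, norm_mul]
      norm_num
      linarith
    have h3 : ‖z‖⁻¹ ≤ ‖z‖ ^ (-(1 / 2) : ℝ) := by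
      rw [← Real.rpow_neg_one]
      exact Real.rpow_le_rpow_of_exponent_le hz1 (by norm_num)
    rw [hH, norm_div]
    calc ‖(a : ℂ) + 2 * z‖ / ‖1 + a * z + z ^ 2‖ ≤ (3 * ‖z‖) / (‖z‖ ^ 2 / 2) :=
          div_le_div₀ (by positivity) h2 (by positivity) h1
      _ = 6 * ‖z‖⁻¹ := by field_simp; norm_num
      _ ≤ _ := by linarith
  have hpos : 0 < ((s : ℂ)).re := by simpa using hs
  have hneg : (-(s : ℂ)).re < 0 := by simpa using hs
  have e1 := integral_cauchy_of_re_pos hholo hdecay hpos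
  have e2 := integral_cauchy_of_re_neg hholo hdecay hneg
  have hIy : ∀ y : ℝ, ((I * (y : ℂ)) ^ 2 - (s : ℂ) ^ 2) = -((y ^ 2 + s ^ 2 : ℝ) : ℂ) := fun y => by
    rw [mul_pow, Complex.I_sq]; push_cast; ring
  have hmi : ∀ y : ℝ, (I * (y : ℂ) - s) ≠ 0 := fun y hy => by
    have := congrArg Complex.re hy
    simp at this
    exact hs.ne' this
  have hpl : ∀ y : ℝ, (I * (y : ℂ) - -s) ≠ 0 := fun y hy => by
    have := congrArg Complex.re hy
    simp at this
    exact hs.ne' this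
  have hdiff : ∫ y : ℝ, H (I * y) * ((2 * s / (y ^ 2 + s ^ 2) : ℝ) : ℂ) =
      2 * Real.pi * H s := by
    -- The Poisson kernel is the difference of the Cauchy kernels with poles at `-s` and at `s`; the
    -- first integral vanishes, the second gives the value at `s`.
    have hpt : ∀ y : ℝ, H (I * y) * ((2 * s / (y ^ 2 + s ^ 2) : ℝ) : ℂ) =
        H (I * y) * (I * y - -s)⁻¹ - H (I * y) * (I * y - s)⁻¹ := fun y => by
      rw [← mul_sub, inv_sub_inv (hpl y) (hmi y)]
      congr 1
      have h3 : (I * (y : ℂ) - -s) * (I * y - s) = -((y ^ 2 + s ^ 2 : ℝ) : ℂ) := by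
        rw [← hIy]; ring
      rw [h3]
      push_cast
      rw [div_neg, ← neg_div]
      congr 1
      ring
    simp_rw [hpt]
    rw [integral_sub (integrable_cauchy_kernel hholo.cont hdecay hneg.ne)
      (integrable_cauchy_kernel hholo.cont hdecay hpos.ne'), e1, e2]
    ring
  have hHre : ∀ y : ℝ, (H (I * y) * ((2 * s / (y ^ 2 + s ^ 2) : ℝ) : ℂ)).re =
      a * (1 + y ^ 2) / ((1 - y ^ 2) ^ 2 + a ^ 2 * y ^ 2) * (2 * s / (y ^ 2 + s ^ 2)) := fun y => by
    rw [Complex.re_mul_ofReal]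
    congr 1
    have hb : (1 : ℂ) + a * (I * y) + (I * y) ^ 2 = ⟨1 - y ^ 2, a * y⟩ := by
      apply Complex.ext <;> simp [pow_two]
      ring
    have hn : ((a : ℂ) + 2 * (I * y)) = ⟨a, 2 * y⟩ := by
      apply Complex.ext <;> simp
    simp only [hH]
    rw [hb, hn, Complex.div_re, Complex.normSq_mk, ← add_div]
    congr 1 <;> ring
  have hHs : H s = (((a + 2 * s) / (1 + a * s + s ^ 2) : ℝ) : ℂ) := by
    simp only [hH]
    push_cast
    ring
  -- A divergent integral would have the value 0, but the right side of `hdiff` is positive.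
  have hI : Integrable fun y : ℝ => H (I * y) * ((2 * s / (y ^ 2 + s ^ 2) : ℝ) : ℂ) := by
    by_contra hcon
    rw [integral_undef hcon, hHs] at hdiff
    have h0 : (0 : ℝ) < 2 * Real.pi * ((a + 2 * s) / (1 + a * s + s ^ 2)) := by
      have := Real.pi_pos
      positivity
    have : ((0 : ℝ) : ℂ) = ((2 * Real.pi * ((a + 2 * s) / (1 + a * s + s ^ 2)) : ℝ) : ℂ) := by
      push_cast
      push_cast at hdiff
      exact hdiff
    exact h0.ne (by exact_mod_cast this)
  have hfin := congrArg Complex.re hdiff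
  have hre : (∫ y : ℝ, H (I * y) * ((2 * s / (y ^ 2 + s ^ 2) : ℝ) : ℂ)).re =
      ∫ y : ℝ, (H (I * y) * ((2 * s / (y ^ 2 + s ^ 2) : ℝ) : ℂ)).re := (integral_re hI).symm
  rw [hre] at hfin
  simp_rw [hHre] at hfin
  rw [hfin, hHs]
  norm_cast

/-- The substitution `y = e^u` in the Poisson integral over `y > 0`. It shows where the weight comes
from: `π m(u) = e^u Re H(i e^u)`, with `H` the logarithmic derivative above. -/
theorem integral_weight_mul_fraction (ha : 0 < a) {s : ℝ} (hs : 0 < s) :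
    ∫ u : ℝ, 2 * s * Real.exp (-u) ^ 2 / (1 + s ^ 2 * Real.exp (-u) ^ 2) * weight a u =
      (a + 2 * s) / (1 + a * s + s ^ 2) := by
  set G : ℝ → ℝ := fun y => a * (1 + y ^ 2) / ((1 - y ^ 2) ^ 2 + a ^ 2 * y ^ 2) *
    (2 * s / (y ^ 2 + s ^ 2)) with hG
  have h1 := integral_re_logDeriv ha hs
  have h2 : ∫ y : ℝ, G y = 2 * ∫ y in Ioi (0 : ℝ), G y := by
    rw [← integral_comp_abs]
    simp only [hG, sq_abs]
  have h3 : ∫ y in Ioi (0 : ℝ), G y = ∫ u : ℝ, Real.exp u * G (Real.exp u) := by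
    have := integral_image_eq_integral_abs_deriv_smul MeasurableSet.univ
      (fun x _ => (Real.hasDerivAt_exp x).hasDerivWithinAt) Real.exp_injective.injOn G
    rw [image_univ, Real.range_exp, setIntegral_univ] at this
    rw [this]
    simp only [abs_of_pos (Real.exp_pos _), smul_eq_mul]
  have h4 : ∀ u : ℝ, Real.exp u * G (Real.exp u) = Real.pi *
      (2 * s * Real.exp (-u) ^ 2 / (1 + s ^ 2 * Real.exp (-u) ^ 2) * weight a u) := fun u => by
    have he := Real.exp_pos u
    have hpi := Real.pi_pos
    have hE : Real.exp (-u) = (Real.exp u)⁻¹ := Real.exp_neg u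
    have hD : 0 < (1 - Real.exp u ^ 2) ^ 2 + a ^ 2 * Real.exp u ^ 2 := by positivity
    have hD2 : 4 * Real.sinh u ^ 2 + a ^ 2 =
        ((1 - Real.exp u ^ 2) ^ 2 + a ^ 2 * Real.exp u ^ 2) / Real.exp u ^ 2 := by
      rw [Real.sinh_eq, hE]
      field_simp
      ring
    have hch : Real.cosh u = (1 + Real.exp u ^ 2) / (2 * Real.exp u) := by
      rw [Real.cosh_eq, hE]
      field_simp
      ring
    simp only [hG, weight]
    rw [hD2, hch, hE]
    have : 0 < Real.exp u ^ 2 + s ^ 2 := by positivity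
    field_simp
  rw [h2, h3] at h1
  simp_rw [h4] at h1
  rw [integral_const_mul] at h1
  have hpi := Real.pi_pos
  have : 2 * Real.pi * (∫ u : ℝ, 2 * s * Real.exp (-u) ^ 2 / (1 + s ^ 2 * Real.exp (-u) ^ 2) *
      weight a u) = 2 * Real.pi * ((a + 2 * s) / (1 + a * s + s ^ 2)) := by linarith
  exact mul_left_cancel₀ (by positivity) this

theorem I_mul_ofReal_mem_rightHalf (s : ℝ) : I * (s : ℂ) ∈ rightHalf := by simp [rightHalf]

theorem neg_I_mul_ofReal_mem_rightHalf (s : ℝ) : -(I * (s : ℂ)) ∈ rightHalf := by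
  simp [rightHalf]

theorem log_kernel_add_neg (s u : ℝ) :
    Complex.log (1 + I * s * (Real.exp (-u) : ℂ)) + Complex.log (1 + -(I * s) * (Real.exp (-u) : ℂ)) =
      (Real.log (1 + s ^ 2 * Real.exp (-u) ^ 2) : ℂ) := by
  have h1 : 1 + -(I * (s : ℂ)) * (Real.exp (-u) : ℂ) =
      starRingEnd ℂ (1 + I * s * (Real.exp (-u) : ℂ)) := by
    rw [map_add, map_mul, map_mul, map_one, Complex.conj_ofReal, Complex.conj_ofReal,
      Complex.conj_I]
    ring
  have hmem := one_add_mem_slitPlane (re_mul_exp_nonneg (I_mul_ofReal_mem_rightHalf s) u)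
  rw [h1, Complex.log_conj _ (Complex.slitPlane_arg_ne_pi hmem), Complex.add_conj, Complex.log_re]
  congr 1
  have h2 : ‖1 + I * (s : ℂ) * (Real.exp (-u) : ℂ)‖ ^ 2 = 1 + s ^ 2 * Real.exp (-u) ^ 2 := by
    rw [Complex.sq_norm, mul_assoc, ← Complex.ofReal_mul, mul_comm I, ← Complex.ofReal_one,
      Complex.normSq_add_mul_I]
    ring
  rw [← h2, Real.log_pow]
  norm_num

theorem integrable_log_one_add_sq (ha : 0 < a) (s : ℝ) :
    Integrable fun u : ℝ => Real.log (1 + s ^ 2 * Real.exp (-u) ^ 2) * weight a u := by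
  have h := ((integrable_log_kernel ha (I_mul_ofReal_mem_rightHalf s)).add
    (integrable_log_kernel ha (neg_I_mul_ofReal_mem_rightHalf s))).re
  refine h.congr (ae_of_all _ fun u => ?_)
  simp only [Pi.add_apply]
  rw [← add_mul, log_kernel_add_neg, ← Complex.ofReal_mul]
  exact Complex.ofReal_re _

theorem logFactor_add_neg_eq_integral (ha : 0 < a) (s : ℝ) :
    logFactor a (I * s) + logFactor a (-(I * s)) =
      ((∫ u : ℝ, Real.log (1 + s ^ 2 * Real.exp (-u) ^ 2) * weight a u : ℝ) : ℂ) := by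
  rw [logFactor, logFactor, ← integral_add (integrable_log_kernel ha (I_mul_ofReal_mem_rightHalf s))
    (integrable_log_kernel ha (neg_I_mul_ofReal_mem_rightHalf s)), ← integral_complex_ofReal]
  congr 1
  ext u
  rw [← add_mul, log_kernel_add_neg, Complex.ofReal_mul]

theorem hasDerivAt_integral_log (ha : 0 < a) {s : ℝ} (hs : 0 < s) :
    HasDerivAt (fun s : ℝ => ∫ u : ℝ, Real.log (1 + s ^ 2 * Real.exp (-u) ^ 2) * weight a u)
      ((a + 2 * s) / (1 + a * s + s ^ 2)) s := by
  rw [← integral_weight_mul_fraction ha hs]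
  have hpos : ∀ x u : ℝ, 0 < 1 + x ^ 2 * Real.exp (-u) ^ 2 := fun x u => by positivity
  refine (hasDerivAt_integral_of_dominated_loc_of_deriv_le (μ := volume)
    (F := fun (x : ℝ) (u : ℝ) => Real.log (1 + x ^ 2 * Real.exp (-u) ^ 2) * weight a u)
    (F' := fun (x : ℝ) (u : ℝ) => 2 * x * Real.exp (-u) ^ 2 / (1 + x ^ 2 * Real.exp (-u) ^ 2) *
      -- The fraction is at most `2 / x`, and `x > s / 2`.
      weight a u) (bound := fun u => 4 / s * weight a u) (Ioi_mem_nhds (half_lt_self hs))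
    (Eventually.of_forall fun x => (integrable_log_one_add_sq ha x).aestronglyMeasurable)
    (integrable_log_one_add_sq ha s) ?_ (ae_of_all _ fun u x hx => ?_)
    ((integrable_weight ha).const_mul _) (ae_of_all _ fun u x hx => ?_)).2
  · exact ((Continuous.div (by fun_prop) (by fun_prop) fun u => (hpos s u).ne').mul
      (continuous_weight ha)).aestronglyMeasurable
  · have hx' : s / 2 < x := hx
    have hx0 : 0 < x := by linarith
    rw [norm_mul, Real.norm_of_nonneg (weight_nonneg ha u), Real.norm_of_nonneg (by positivity)]
    refine mul_le_mul_of_nonneg_right ?_ (weight_nonneg ha u)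
    rw [div_le_div_iff₀ (hpos x u) hs]
    have h1 : s * x ≤ 2 * x ^ 2 := by nlinarith
    have h2 := mul_le_mul_of_nonneg_right h1 (sq_nonneg (Real.exp (-u)))
    nlinarith
  · have h1 : HasDerivAt (fun x : ℝ => 1 + x ^ 2 * Real.exp (-u) ^ 2)
        (2 * x * Real.exp (-u) ^ 2) x := by
      have := ((hasDerivAt_pow 2 x).mul_const (Real.exp (-u) ^ 2)).const_add 1
      simpa using this
    exact (h1.log (hpos x u).ne').mul_const _

/-- The factorization `1 + a s + s² = D(is) D(-is)` in logarithmic form. -/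
theorem logFactor_add_neg (ha : 0 < a) {s : ℝ} (hs : 0 ≤ s) :
    logFactor a (I * s) + logFactor a (-(I * s)) = (Real.log (1 + a * s + s ^ 2) : ℂ) := by
  rw [logFactor_add_neg_eq_integral ha]
  congr 1
  set F : ℝ → ℝ := fun s => ∫ u : ℝ, Real.log (1 + s ^ 2 * Real.exp (-u) ^ 2) * weight a u with hF
  have hcont : Continuous F := by
    have h1 : Continuous fun s : ℝ => (logFactor a (I * s) + logFactor a (-(I * s))).re := by
      refine Complex.continuous_re.comp (Continuous.add ?_ ?_)
      · exact (holoOn_logFactor ha).cont.comp_continuous (by fun_prop) I_mul_ofReal_mem_rightHalf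
      · exact (holoOn_logFactor ha).cont.comp_continuous (by fun_prop)
          neg_I_mul_ofReal_mem_rightHalf
    refine h1.congr fun s => ?_
    rw [logFactor_add_neg_eq_integral ha, Complex.ofReal_re]
  rcases hs.eq_or_lt with rfl | hs
  · simp
  have hq : ∀ x : ℝ, 0 ≤ x → 0 < 1 + a * x + x ^ 2 := fun x hx => by positivity
  -- Both sides vanish at 0 and have the same derivative on `(0, s)`; continuity of `F` at 0, where
  -- the derivative formula is not available, comes from `logFactor`.
  obtain ⟨c, hc, hceq⟩ := exists_hasDerivAt_eq_slope (fun x => F x - Real.log (1 + a * x + x ^ 2))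
    (fun _ => 0) hs (hcont.continuousOn.sub (ContinuousOn.log (by fun_prop) fun x hx =>
      (hq x hx.1).ne')) (fun x hx => by
        have h1 := hasDerivAt_integral_log ha hx.1
        have h2 : HasDerivAt (fun x => 1 + a * x + x ^ 2) (a + 2 * x) x := by
          have := (((hasDerivAt_id x).const_mul a).const_add 1).add (hasDerivAt_pow 2 x)
          refine this.congr_deriv ?_
          norm_num
        have h3 := h1.sub (h2.log (hq x hx.1.le).ne')
        rwa [sub_self] at h3)
  have h0 : F 0 = 0 := by simp [hF]
  simp only [h0] at hceq
  rw [eq_comm, div_eq_zero_iff] at hceq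
  rcases hceq with h | h
  · simp at h
    linarith
  · linarith

end Poisson

/-! ### The factor `D` and its bounds -/

/-- The factor `D` of `1 + a s + s² = D(is) D(-is)` holomorphic in the right half-plane. -/
def factor (a : ℝ) (p : ℂ) : ℂ := Complex.exp (logFactor a p)

section FactorBounds

variable {a : ℝ}

theorem factor_ne_zero (p : ℂ) : factor a p ≠ 0 := Complex.exp_ne_zero _

theorem holoOn_factor (ha : 0 < a) : HoloOn (factor a) rightHalf :=
  ⟨(holoOn_logFactor ha).cont.cexp, (holoOn_logFactor ha).diff.cexp⟩

theorem HoloOn.inv {f : ℂ → ℂ} {s : Set ℂ} (hf : HoloOn f s) (h : ∀ z ∈ s, f z ≠ 0) :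
    HoloOn (fun z => (f z)⁻¹) s :=
  ⟨hf.cont.inv₀ h, hf.diff.inv fun z hz => h z (interior_subset hz)⟩

theorem holoOn_inv_factor (ha : 0 < a) : HoloOn (fun p => (factor a p)⁻¹) rightHalf :=
  (holoOn_factor ha).inv fun p _ => factor_ne_zero p

theorem factor_conj {p : ℂ} (hp : p ∈ rightHalf) :
    factor a (starRingEnd ℂ p) = starRingEnd ℂ (factor a p) := by
  rw [factor, factor, logFactor_conj hp, ← Complex.exp_conj]

theorem factor_mul_neg (ha : 0 < a) {s : ℝ} (hs : 0 ≤ s) :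
    factor a (I * s) * factor a (-(I * s)) = 1 + a * s + s ^ 2 := by
  rw [factor, factor, ← Complex.exp_add, logFactor_add_neg ha hs, ← Complex.ofReal_exp,
    Real.exp_log (by positivity)]
  push_cast
  ring

theorem one_le_norm_factor (ha : 0 < a) {p : ℂ} (hp : p ∈ rightHalf) : 1 ≤ ‖factor a p‖ := by
  rw [factor, Complex.norm_exp]
  exact Real.one_le_exp (re_logFactor_nonneg ha hp)

theorem factor_eq_mul (ha : 0 < a) {p : ℂ} (hp : p ∈ rightHalf) (hp0 : p ≠ 0) :
    factor a p = p * factor a p⁻¹ := by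
  rw [factor, logFactor_eq_log_add ha hp hp0, Complex.exp_add, Complex.exp_log hp0, factor]

/-- `D(p) = p D(1/p)` and `|D| ≥ 1`. -/
theorem norm_le_norm_factor (ha : 0 < a) {p : ℂ} (hp : p ∈ rightHalf) : ‖p‖ ≤ ‖factor a p‖ := by
  rcases eq_or_ne p 0 with rfl | hp0
  · simp
  rw [factor_eq_mul ha hp hp0, norm_mul]
  have := one_le_norm_factor ha (inv_mem_rightHalf hp)
  nlinarith [norm_nonneg p]

theorem norm_inv_factor_le (ha : 0 < a) {p : ℂ} (hp : p ∈ rightHalf) :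
    ‖(factor a p)⁻¹‖ ≤ 2 * (1 + ‖p‖)⁻¹ := by
  have h1 := one_le_norm_factor ha hp
  have h2 := norm_le_norm_factor ha hp
  rw [norm_inv, inv_eq_one_div, ← div_eq_mul_inv, div_le_div_iff₀ (by linarith) (by positivity)]
  linarith

theorem powerDecay_inv_factor (ha : 0 < a) :
    PowerDecay 1 (fun p => (factor a p)⁻¹) rightHalf :=
  ⟨2, by norm_num, fun p hp => by simpa [Real.rpow_neg_one] using norm_inv_factor_le ha hp⟩

theorem norm_exp_sub_one_le_mul_exp (x : ℂ) : ‖Complex.exp x - 1‖ ≤ ‖x‖ * Real.exp ‖x‖ := by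
  simpa using Complex.norm_exp_sub_sum_le_norm_mul_exp x 1

/-- Applied at `q = p⁻¹`, this is the rate `|p| ^ (-1/2)` at which `D(p) / p` tends to 1 at
infinity. -/
theorem norm_factor_sub_one_le (ha : 0 < a) :
    ∃ C, 0 ≤ C ∧ ∀ q ∈ rightHalf, ‖q‖ ≤ 1 →
      ‖factor a q - 1‖ ≤ C * √‖q‖ ∧ ‖(factor a q)⁻¹ - 1‖ ≤ C * √‖q‖ := by
  obtain ⟨C, hC, h⟩ := norm_logFactor_le ha
  refine ⟨C * Real.exp C, by positivity, fun q hq hq1 => ?_⟩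
  have h1 := h q hq
  have h2 : ‖logFactor a q‖ ≤ C := h1.trans
    (mul_le_of_le_one_right hC (Real.sqrt_le_one.2 hq1))
  have h3 : ‖logFactor a q‖ * Real.exp ‖logFactor a q‖ ≤ C * Real.exp C * √‖q‖ := by
    calc _ ≤ (C * √‖q‖) * Real.exp C :=
          mul_le_mul h1 (Real.exp_le_exp.2 h2) (Real.exp_pos _).le (by positivity)
      _ = _ := by ring
  refine ⟨(norm_exp_sub_one_le_mul_exp _).trans h3, ?_⟩
  rw [factor, ← Complex.exp_neg]
  refine (norm_exp_sub_one_le_mul_exp _).trans ?_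
  rwa [norm_neg]

end FactorBounds
-- The canonical function of a symbol that splits
/-- A logarithmic factorization of `G`: `ln G(s) = L(-iκs) + L(iκs)` with `L` holomorphic in the
right half-plane, continuous up to its boundary and decaying. -/
structure IsLogFactorization (G : ℝ → ℝ) (κ : ℝ) (L : ℂ → ℂ) : Prop where
  holo : HoloOn L rightHalf
  decay : PowerDecay (1 / 2) L rightHalf
  pos : ∀ s, 0 < G s
  log_eq : ∀ s : ℝ, (Real.log (G s) : ℂ) = L (-(I * (κ * s : ℝ))) + L (I * (κ * s : ℝ))

section LogFactorization

variable {G : ℝ → ℝ} {κ : ℝ} {L : ℂ → ℂ}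

theorem inv_sub_eq_mul_inv {κ : ℝ} (hκ : 0 < κ) (s : ℝ) (z : ℂ) :
    ((s : ℂ) - z)⁻¹ = -(I * κ) * (I * (-κ * s : ℝ) - -(I * κ) * z)⁻¹ ∧
      ((s : ℂ) - z)⁻¹ = I * κ * (I * (κ * s : ℝ) - I * κ * z)⁻¹ := by
  have hk : (κ : ℂ) ≠ 0 := by exact_mod_cast hκ.ne'
  have hIk : I * (κ : ℂ) ≠ 0 := mul_ne_zero Complex.I_ne_zero hk
  constructor
  · have : I * ((-κ * s : ℝ) : ℂ) - -(I * κ) * z = -(I * κ) * (s - z) := by push_cast; ring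
    rw [this, mul_inv, ← mul_assoc, mul_inv_cancel₀ (neg_ne_zero.2 hIk), one_mul]
  · have : I * ((κ * s : ℝ) : ℂ) - I * κ * z = I * κ * (s - z) := by push_cast; ring
    rw [this, mul_inv, ← mul_assoc, mul_inv_cancel₀ hIk, one_mul]

/-- The two halves of `ln G` become Cauchy kernels on the imaginary axis under `s ↦ -κ s` and `s ↦ κ
s`, with poles `-iκz` and `iκz` on opposite sides of it. -/
theorem IsLogFactorization.integrand_eq (h : IsLogFactorization G κ L) (hκ : 0 < κ) (z : ℂ) (s : ℝ) :
    (Real.log (G s) : ℂ) / ((s : ℂ) - z) =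
      -(I * κ) * (L (I * (-κ * s : ℝ)) * (I * (-κ * s : ℝ) - -(I * κ) * z)⁻¹) +
        I * κ * (L (I * (κ * s : ℝ)) * (I * (κ * s : ℝ) - I * κ * z)⁻¹) := by
  obtain ⟨h1, h2⟩ := inv_sub_eq_mul_inv hκ s z
  rw [div_eq_mul_inv, h.log_eq, add_mul]
  congr 1
  · rw [h1]
    have : -(I * ((κ * s : ℝ) : ℂ)) = I * (-κ * s : ℝ) := by push_cast; ring
    rw [this]
    ring
  · rw [h2]
    ring

theorem re_I_mul (κ : ℝ) (z : ℂ) : (I * κ * z).re = -(κ * z.im) := by simp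

theorem re_neg_I_mul (κ : ℝ) (z : ℂ) : (-(I * κ) * z).re = κ * z.im := by simp

theorem IsLogFactorization.integrable_parts (h : IsLogFactorization G κ L) (hκ : 0 < κ) {z : ℂ}
    (hz : z.im ≠ 0) :
    Integrable (fun s : ℝ => -(I * κ) * (L (I * (-κ * s : ℝ)) *
      (I * (-κ * s : ℝ) - -(I * κ) * z)⁻¹)) ∧
    Integrable (fun s : ℝ => I * κ * (L (I * (κ * s : ℝ)) * (I * (κ * s : ℝ) - I * κ * z)⁻¹)) := by
  constructor
  · refine Integrable.const_mul ?_ _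
    refine (integrable_cauchy_kernel h.holo.cont h.decay (c := -(I * κ) * z) ?_).comp_mul_left'
      (neg_ne_zero.2 hκ.ne')
    rw [re_neg_I_mul]
    exact mul_ne_zero hκ.ne' hz
  · refine Integrable.const_mul ?_ _
    refine (integrable_cauchy_kernel h.holo.cont h.decay (c := I * κ * z) ?_).comp_mul_left' hκ.ne'
    rw [re_I_mul]
    exact neg_ne_zero.2 (mul_ne_zero hκ.ne' hz)

theorem IsLogFactorization.integrable (h : IsLogFactorization G κ L) (hκ : 0 < κ) {z : ℂ}
    (hz : z.im ≠ 0) : Integrable fun s : ℝ => (Real.log (G s) : ℂ) / ((s : ℂ) - z) := by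
  simp_rw [h.integrand_eq hκ z]
  exact (h.integrable_parts hκ hz).1.add (h.integrable_parts hκ hz).2

theorem IsLogFactorization.integral_eq (h : IsLogFactorization G κ L) (hκ : 0 < κ) {z : ℂ}
    (hz : z.im ≠ 0) : ∫ s : ℝ, (Real.log (G s) : ℂ) / ((s : ℂ) - z) =
      -I * (∫ y : ℝ, L (I * y) * (I * y - -(I * κ) * z)⁻¹) +
        I * ∫ y : ℝ, L (I * y) * (I * y - I * κ * z)⁻¹ := by
  simp_rw [h.integrand_eq hκ z]
  rw [integral_add (h.integrable_parts hκ hz).1 (h.integrable_parts hκ hz).2, integral_const_mul,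
    integral_const_mul,
    Measure.integral_comp_mul_left (fun y : ℝ => L (I * y) * (I * y - -(I * κ) * z)⁻¹) (-κ),
    Measure.integral_comp_mul_left (fun y : ℝ => L (I * y) * (I * y - I * κ * z)⁻¹) κ, inv_neg,
    abs_neg, abs_of_pos (inv_pos.2 hκ), Complex.real_smul, Complex.real_smul]
  have hk : (κ : ℂ) ≠ 0 := by exact_mod_cast hκ.ne'
  push_cast
  congr 1 <;> field_simp

/-- For `Im z > 0` only `-iκz` lies in the right half-plane: Cauchy's formula evaluates that
integral and Cauchy's theorem kills the other. In the lower half-plane the roles are exchanged. -/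
theorem IsLogFactorization.canonical_upper (h : IsLogFactorization G κ L) (hκ : 0 < κ) {z : ℂ}
    (hz : 0 < z.im) : canonical G z = Complex.exp (L (-(I * κ) * z)) := by
  have h1 : 0 < (-(I * κ) * z).re := by rw [re_neg_I_mul]; positivity
  have h2 : (I * κ * z).re < 0 := by rw [re_I_mul]; exact neg_lt_zero.2 (by positivity)
  rw [canonical, h.integral_eq hκ hz.ne', integral_cauchy_of_re_pos h.holo h.decay h1,
    integral_cauchy_of_re_neg h.holo h.decay h2]
  congr 1
  have := Complex.I_ne_zero
  have hpi : (Real.pi : ℂ) ≠ 0 := by exact_mod_cast Real.pi_ne_zero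
  field_simp
  ring

theorem IsLogFactorization.canonical_lower (h : IsLogFactorization G κ L) (hκ : 0 < κ) {z : ℂ}
    (hz : z.im < 0) : canonical G z = Complex.exp (-L (I * κ * z)) := by
  have h1 : (-(I * κ) * z).re < 0 := by rw [re_neg_I_mul]; exact mul_neg_of_pos_of_neg hκ hz
  have h2 : 0 < (I * κ * z).re := by
    rw [re_I_mul]; exact neg_pos.2 (mul_neg_of_pos_of_neg hκ hz)
  rw [canonical, h.integral_eq hκ hz.ne, integral_cauchy_of_re_neg h.holo h.decay h1,
    integral_cauchy_of_re_pos h.holo h.decay h2]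
  congr 1
  have := Complex.I_ne_zero
  have hpi : (Real.pi : ℂ) ≠ 0 := by exact_mod_cast Real.pi_ne_zero
  field_simp
  ring

theorem tendsto_zero_of_powerDecay (hd : PowerDecay (1 / 2) L rightHalf) {f : ℝ → ℂ}
    (hf : ∀ s, f s ∈ rightHalf) (hlim : Tendsto (fun s => ‖f s‖) (cocompact ℝ) atTop) :
    Tendsto (fun s => L (f s)) (cocompact ℝ) (𝓝 0) := by
  obtain ⟨C, hC, hd⟩ := hd
  refine squeeze_zero_norm (fun s => hd (f s) (hf s)) ?_
  have := ((tendsto_rpow_neg_atTop (y := 1 / 2) (by norm_num)).comp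
    (tendsto_atTop_add_const_left _ 1 hlim)).const_mul C
  simpa using this

/-- Given the explicit formulas on both sides of the axis, the boundary values are exponentials of
`±L` on the imaginary axis, the jump is the splitting of `ln G`, and the limits at infinity are the
decay of `L`. -/
theorem IsLogFactorization.isFactorization (h : IsLogFactorization G κ L) (hκ : 0 < κ) :
    IsFactorization G (fun s => Complex.exp (L (-(I * (κ * s : ℝ)))))
      (fun s => Complex.exp (-L (I * (κ * s : ℝ)))) where
  integrable z hz := h.integrable hκ hz
  holomorphic := by
    have hint : ∀ w : ℂ, 0 < w.re → DifferentiableAt ℂ L w := fun w hw =>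
      h.holo.diff.differentiableAt (isOpen_interior.mem_nhds (by rw [interior_rightHalf]; exact hw))
    intro z hz
    refine DifferentiableAt.differentiableWithinAt ?_
    rcases lt_or_gt_of_ne (show z.im ≠ 0 from hz) with hz | hz
    · have hev : canonical G =ᶠ[𝓝 z] fun z => Complex.exp (-L (I * κ * z)) := by
        filter_upwards [(isOpen_lt Complex.continuous_im continuous_const).mem_nhds hz] with w hw
          using h.canonical_lower hκ hw
      refine DifferentiableAt.congr_of_eventuallyEq ?_ hev
      refine (DifferentiableAt.neg (DifferentiableAt.comp z (hint _ ?_) (by fun_prop))).cexp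
      rw [re_I_mul]
      exact neg_pos.2 (mul_neg_of_pos_of_neg hκ hz)
    · have hev : canonical G =ᶠ[𝓝 z] fun z => Complex.exp (L (-(I * κ) * z)) := by
        filter_upwards [(isOpen_lt continuous_const Complex.continuous_im).mem_nhds hz] with w hw
          using h.canonical_upper hκ hw
      refine DifferentiableAt.congr_of_eventuallyEq ?_ hev
      refine (DifferentiableAt.comp z (hint _ ?_) (by fun_prop)).cexp
      rw [re_neg_I_mul]
      exact mul_pos hκ hz
  upper s := by
    have hmem : -(I * κ) * (s : ℂ) ∈ rightHalf := by simp [rightHalf]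
    have h1 : Tendsto (fun z : ℂ => -(I * κ) * z) (𝓝[upperHalf] (s : ℂ))
        (𝓝[rightHalf] (-(I * κ) * (s : ℂ))) := by
      refine tendsto_nhdsWithin_iff.2 ⟨Tendsto.mono_left (Continuous.tendsto (by fun_prop) _)
        nhdsWithin_le_nhds, ?_⟩
      filter_upwards [self_mem_nhdsWithin] with z hz
      change 0 ≤ (-(I * κ) * z).re
      rw [re_neg_I_mul]
      exact (mul_pos hκ hz).le
    have h2 := ((h.holo.cont _ hmem).tendsto.comp h1).cexp
    have h3 : -(I * κ) * (s : ℂ) = -(I * ((κ * s : ℝ) : ℂ)) := by push_cast; ring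
    rw [h3] at h2
    refine h2.congr' ?_
    filter_upwards [self_mem_nhdsWithin] with z hz
    exact (h.canonical_upper hκ hz).symm
  lower s := by
    have hmem : I * κ * (s : ℂ) ∈ rightHalf := by simp [rightHalf]
    have h1 : Tendsto (fun z : ℂ => I * κ * z) (𝓝[lowerHalf] (s : ℂ))
        (𝓝[rightHalf] (I * κ * (s : ℂ))) := by
      refine tendsto_nhdsWithin_iff.2 ⟨Tendsto.mono_left (Continuous.tendsto (by fun_prop) _)
        nhdsWithin_le_nhds, ?_⟩
      filter_upwards [self_mem_nhdsWithin] with z hz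
      change 0 ≤ (I * κ * z).re
      rw [re_I_mul]
      exact (neg_pos.2 (mul_neg_of_pos_of_neg hκ hz)).le
    have h2 := ((h.holo.cont _ hmem).tendsto.comp h1).neg.cexp
    have h3 : I * κ * (s : ℂ) = I * ((κ * s : ℝ) : ℂ) := by push_cast; ring
    rw [h3] at h2
    refine h2.congr' ?_
    filter_upwards [self_mem_nhdsWithin] with z hz
    exact (h.canonical_lower hκ hz).symm
  jump s := by
    rw [← Real.exp_log (h.pos s), Complex.ofReal_exp, h.log_eq, ← Complex.exp_add]
    congr 1
    ring
  upper_infinity := by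
    have := tendsto_zero_of_powerDecay h.decay (f := fun s => -(I * (κ * s : ℝ)))
      (fun s => neg_I_mul_ofReal_mem_rightHalf _) ?_
    · simpa using this.cexp
    · simpa [abs_of_pos hκ] using (tendsto_norm_cocompact_atTop (E := ℝ)).const_mul_atTop hκ
  lower_infinity := by
    have := tendsto_zero_of_powerDecay h.decay (f := fun s => I * (κ * s : ℝ))
      (fun s => I_mul_ofReal_mem_rightHalf _) ?_
    · simpa using this.neg.cexp
    · simpa [abs_of_pos hκ] using (tendsto_norm_cocompact_atTop (E := ℝ)).const_mul_atTop hκ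

end LogFactorization

/-! ### Splitting the two symbols -/

section Symbols

theorem holoOn_log_one_add_mul {b : ℝ} (hb : 0 < b) :
    HoloOn (fun p : ℂ => Complex.log (1 + b * p)) rightHalf :=
  HoloOn.of_differentiableAt fun p hp => DifferentiableAt.clog (by fun_prop)
    (one_add_mem_slitPlane (by rw [Complex.re_ofReal_mul]; exact mul_nonneg hb.le hp))

theorem log_one_add_mul_add_neg (b s : ℝ) :
    Complex.log (1 + b * -(I * (s : ℂ))) + Complex.log (1 + b * (I * (s : ℂ))) =
      (Real.log (1 + b ^ 2 * s ^ 2) : ℂ) := by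
  have h := log_kernel_add_neg (b * s) 0
  simp only [neg_zero, Real.exp_zero, Complex.ofReal_one, mul_one, one_pow] at h
  rw [← mul_pow, ← h, add_comm]
  push_cast
  congr 3 <;> ring

theorem log_one_add_mul_eq {b : ℝ} (hb : 0 < b) {p : ℂ} (hp : p ∈ rightHalf) (hp0 : p ≠ 0) :
    Complex.log (1 + b * p) = Real.log b + Complex.log p + Complex.log (1 + (b * p)⁻¹) := by
  have hb0 : (b : ℂ) ≠ 0 := by exact_mod_cast hb.ne'
  rw [log_one_add_eq (show 0 ≤ (b * p).re by rw [Complex.re_ofReal_mul]; exact mul_nonneg hb.le hp)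
    (mul_ne_zero hb0 hp0), Complex.log_ofReal_mul hb hp0]

theorem norm_log_one_add_inv_le {b : ℝ} (hb : 0 < b) {p : ℂ} (hp : p ∈ rightHalf) :
    ‖Complex.log (1 + (b * p)⁻¹)‖ ≤ 5 * √b⁻¹ * ‖p‖ ^ (-(1 / 2) : ℝ) := by
  refine (norm_log_one_add_le_sqrt (inv_mem_rightHalf (p := b * p) ?_)).trans ?_
  · change 0 ≤ ((b : ℂ) * p).re
    rw [Complex.re_ofReal_mul]
    exact mul_nonneg hb.le hp
  · rw [norm_inv, norm_mul, Complex.norm_real, Real.norm_of_nonneg hb.le, mul_inv,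
      Real.sqrt_mul (inv_nonneg.2 hb.le), Real.sqrt_inv ‖p‖, Real.sqrt_eq_rpow ‖p‖,
      ← Real.rpow_neg (norm_nonneg p), mul_assoc]

theorem norm_logFactor_inv_le {a : ℝ} (ha : 0 < a) : ∃ C, 0 ≤ C ∧ ∀ p ∈ rightHalf,
    ‖logFactor a p⁻¹‖ ≤ C * ‖p‖ ^ (-(1 / 2) : ℝ) := by
  obtain ⟨C, hC, h⟩ := norm_logFactor_le ha
  refine ⟨C, hC, fun p hp => (h _ (inv_mem_rightHalf hp)).trans_eq ?_⟩
  rw [norm_inv, Real.sqrt_inv, Real.sqrt_eq_rpow, ← Real.rpow_neg (norm_nonneg p)]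

theorem logFactor_neg_add {a : ℝ} (ha : 0 < a) (s : ℝ) :
    logFactor a (-(I * (s : ℂ))) + logFactor a (I * s) =
      (Real.log (1 + a * |s| + s ^ 2) : ℂ) := by
  rcases le_total 0 s with hs | hs
  · rw [add_comm, logFactor_add_neg ha hs, abs_of_nonneg hs]
  · have := logFactor_add_neg ha (neg_nonneg.2 hs)
    rw [abs_of_nonpos hs, ← neg_sq s, ← this]
    push_cast
    simp only [mul_neg, neg_neg]

/-- The logarithm of the canonical solution in case B. -/
def logCanonicalB (a : ℝ) (p : ℂ) : ℂ := logFactor a p - Complex.log (1 + (1 : ℝ) * p)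

/-- The logarithm of the canonical solution in case A. -/
def logCanonicalA (a : ℝ) (p : ℂ) : ℂ :=
  logFactor a p - 1 / 2 * Complex.log (1 + a * p) - 1 / 2 * Complex.log (1 + (a⁻¹ : ℝ) * p)

variable {lam k : ℝ}

/-- At infinity `log D(p)` and `log (1 + p)` both behave like `log p`, which cancels and leaves
decay of order 1/2. -/
theorem isLogFactorization_symbolB (hlam : 0 < lam) (hk : 0 < k) :
    IsLogFactorization (symbolB lam k) (√k) (logCanonicalB (lam / √k)) := by
  have hκ : 0 < √k := Real.sqrt_pos.2 hk
  have ha : 0 < lam / √k := by positivity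
  have hsq : √k ^ 2 = k := Real.sq_sqrt hk.le
  have hcont : HoloOn (logCanonicalB (lam / √k)) rightHalf :=
    ⟨(holoOn_logFactor ha).cont.sub (holoOn_log_one_add_mul one_pos).cont,
      (holoOn_logFactor ha).diff.sub (holoOn_log_one_add_mul one_pos).diff⟩
  refine ⟨hcont, ?_, fun s => by unfold symbolB; positivity, fun s => ?_⟩
  · obtain ⟨C, hC, h⟩ := norm_logFactor_inv_le ha
    refine PowerDecay.of_large (by norm_num) isClosed_rightHalf hcont.cont (R := 1)
      (C := C + 5 * √(1 : ℝ)⁻¹) le_rfl fun p hp h1 => ?_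
    have hp0 : p ≠ 0 := norm_pos_iff.1 (by linarith)
    have heq : logCanonicalB (lam / √k) p =
        logFactor (lam / √k) p⁻¹ - Complex.log (1 + ((1 : ℝ) * p)⁻¹) := by
      rw [logCanonicalB, logFactor_eq_log_add ha hp hp0, log_one_add_mul_eq one_pos hp hp0,
        Real.log_one]
      push_cast
      ring
    rw [heq, add_mul]
    exact (norm_sub_le _ _).trans (add_le_add (h p hp) (norm_log_one_add_inv_le one_pos hp))
  · have h1 := logFactor_neg_add ha (√k * s)
    have h2 := log_one_add_mul_add_neg 1 (√k * s)
    have h3 : logCanonicalB (lam / √k) (-(I * ((√k * s : ℝ) : ℂ))) +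
        logCanonicalB (lam / √k) (I * ((√k * s : ℝ) : ℂ)) =
        ((Real.log (1 + lam / √k * |√k * s| + (√k * s) ^ 2) -
          Real.log (1 + 1 ^ 2 * (√k * s) ^ 2) : ℝ) : ℂ) := by
      push_cast at h1 h2 ⊢
      simp only [logCanonicalB]
      push_cast
      linear_combination h1 - h2
    rw [h3, symbolB, Real.log_div (by positivity) (by positivity), abs_mul, abs_of_pos hκ, mul_pow,
      hsq]
    congr 3
    · field_simp
    · ring_nf

/-- The two half-logarithms contribute `log p` in total, and their constants `log a / 2` and `log
a⁻¹ / 2` cancel. The slopes fit because `√k a = lam` and `√k a⁻¹ = k / lam`, which is `k̃`. -/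
theorem isLogFactorization_symbolA (hlam : 0 < lam) (hk : 0 < k) :
    IsLogFactorization (symbolA lam k) (√k) (logCanonicalA (lam / √k)) := by
  have hκ : 0 < √k := Real.sqrt_pos.2 hk
  have ha : 0 < lam / √k := by positivity
  have hsq : √k ^ 2 = k := Real.sq_sqrt hk.le
  have ha' : 0 < (lam / √k)⁻¹ := inv_pos.2 ha
  have hcont : HoloOn (logCanonicalA (lam / √k)) rightHalf :=
    ⟨((holoOn_logFactor ha).cont.sub (continuousOn_const.mul (holoOn_log_one_add_mul ha).cont)).sub
        (continuousOn_const.mul (holoOn_log_one_add_mul ha').cont),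
      ((holoOn_logFactor ha).diff.sub ((holoOn_log_one_add_mul ha).diff.const_mul _)).sub
        ((holoOn_log_one_add_mul ha').diff.const_mul _)⟩
  refine ⟨hcont, ?_, fun s => by unfold symbolA; positivity, fun s => ?_⟩
  · obtain ⟨C, hC, h⟩ := norm_logFactor_inv_le ha
    refine PowerDecay.of_large (by norm_num) isClosed_rightHalf hcont.cont (R := 1)
      (C := C + 5 * √(lam / √k)⁻¹ + 5 * √(lam / √k)⁻¹⁻¹) le_rfl fun p hp h1 => ?_
    have hp0 : p ≠ 0 := norm_pos_iff.1 (by linarith)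
    have heq : logCanonicalA (lam / √k) p =
        logFactor (lam / √k) p⁻¹ - 1 / 2 * Complex.log (1 + ((lam / √k : ℝ) * p)⁻¹) -
          1 / 2 * Complex.log (1 + (((lam / √k)⁻¹ : ℝ) * p)⁻¹) := by
      rw [logCanonicalA, logFactor_eq_log_add ha hp hp0, log_one_add_mul_eq ha hp hp0,
        log_one_add_mul_eq ha' hp hp0, Real.log_inv]
      push_cast
      ring
    have e1 := norm_log_one_add_inv_le ha hp
    have e2 := norm_log_one_add_inv_le ha' hp
    have e3 := h p hp
    rw [heq]
    refine (norm_sub_le _ _).trans ((add_le_add_left (norm_sub_le _ _) _).trans ?_)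
    rw [norm_mul, norm_mul]
    norm_num only [norm_div, norm_one, Complex.norm_ofNat]
    have p1 : 0 ≤ ‖Complex.log (1 + ((lam / √k : ℝ) * p)⁻¹)‖ := norm_nonneg _
    have p2 : 0 ≤ ‖Complex.log (1 + (((lam / √k)⁻¹ : ℝ) * p)⁻¹)‖ := norm_nonneg _
    norm_num only at e1 e2 e3 p1 p2 ⊢
    linarith
  · have h1 := logFactor_neg_add ha (√k * s)
    have h2 := log_one_add_mul_add_neg (lam / √k) (√k * s)
    have h2' := log_one_add_mul_add_neg (lam / √k)⁻¹ (√k * s)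
    have h3 : logCanonicalA (lam / √k) (-(I * ((√k * s : ℝ) : ℂ))) +
        logCanonicalA (lam / √k) (I * ((√k * s : ℝ) : ℂ)) =
        ((Real.log (1 + lam / √k * |√k * s| + (√k * s) ^ 2) -
          (Real.log (1 + (lam / √k) ^ 2 * (√k * s) ^ 2) / 2 +
          Real.log (1 + (lam / √k)⁻¹ ^ 2 * (√k * s) ^ 2) / 2) : ℝ) : ℂ) := by
      simp only [logCanonicalA]
      have e : ∀ A B C : ℝ, ((A - (B / 2 + C / 2) : ℝ) : ℂ) = A - (B / 2 + C / 2) :=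
        fun A B C => by push_cast; ring
      rw [e, ← h1, ← h2, ← h2']
      push_cast
      ring
    rw [h3, symbolA, Real.log_div (by positivity) (by positivity),
      Real.log_mul (by positivity) (by positivity), Real.log_sqrt (by positivity),
      Real.log_sqrt (by positivity), abs_mul, abs_of_pos hκ]
    have t1 : lam / √k * (√k * |s|) = lam * |s| := by field_simp
    have t2 : (√k * s) ^ 2 = k * s ^ 2 := by rw [mul_pow, hsq]
    have t3 : (lam / √k) ^ 2 * (√k * s) ^ 2 = lam ^ 2 * s ^ 2 := by field_simp
    have t4 : (lam / √k)⁻¹ ^ 2 * (√k * s) ^ 2 = (k / lam) ^ 2 * s ^ 2 := by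
      rw [t2, inv_pow, div_pow, hsq]
      field_simp
    rw [t1, t3, t4, t2]

end Symbols
-- Stieltjes transforms of densities of order `(1 + s)⁻¹`
/-- The Stieltjes transform `∫₀^∞ ω(s) / (s + η) ds`. -/
def stieltjes (ω : ℝ → ℂ) (η : ℂ) : ℂ := ∫ s in Ioi (0 : ℝ), ω s * ((s : ℂ) + η)⁻¹

section Stieltjes

variable {ω : ℝ → ℂ} {C : ℝ}

theorem sq_add_sq_le_norm_sq {s : ℝ} (hs : 0 ≤ s) {η : ℂ} (hη : η ∈ rightHalf) :
    s ^ 2 + ‖η‖ ^ 2 ≤ ‖(s : ℂ) + η‖ ^ 2 := by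
  have h : 0 ≤ η.re := hη
  rw [Complex.sq_norm, Complex.sq_norm, Complex.normSq_apply, Complex.normSq_apply]
  simp only [Complex.add_re, Complex.ofReal_re, Complex.add_im, Complex.ofReal_im, zero_add]
  nlinarith [mul_nonneg hs h]

theorem le_norm_add {s : ℝ} (hs : 0 ≤ s) {η : ℂ} (hη : η ∈ rightHalf) :
    s ≤ ‖(s : ℂ) + η‖ := by
  have := sq_add_sq_le_norm_sq hs hη
  exact le_of_sq_le_sq (by nlinarith [sq_nonneg ‖η‖]) (norm_nonneg _)

theorem norm_le_norm_add {s : ℝ} (hs : 0 ≤ s) {η : ℂ} (hη : η ∈ rightHalf) :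
    ‖η‖ ≤ ‖(s : ℂ) + η‖ := by
  have := sq_add_sq_le_norm_sq hs hη
  exact le_of_sq_le_sq (by nlinarith [sq_nonneg s]) (norm_nonneg _)

theorem add_ne_zero_of_pos {s : ℝ} (hs : 0 < s) {η : ℂ} (hη : η ∈ rightHalf) :
    (s : ℂ) + η ≠ 0 := norm_pos_iff.1 (hs.trans_le (le_norm_add hs.le hη))

theorem integrableOn_inv_mul_inv :
    IntegrableOn (fun s : ℝ => (1 + s)⁻¹ * (1 + s)⁻¹) (Ioi 0) := by
  have h : Integrable fun x : ℝ => (1 + ‖x‖) ^ (-2 : ℝ) := integrable_one_add_norm (by simp)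
  refine h.integrableOn.congr_fun (fun s hs => ?_) measurableSet_Ioi
  have hs' : 0 < s := hs
  simp only
  rw [Real.norm_of_nonneg hs'.le, ← Real.rpow_neg_one, ← Real.rpow_add (by positivity)]
  norm_num

/-- The transform itself may diverge at `η = 0`; the factor `η` makes the kernel `η / (s + η)`
bounded uniformly, so the product is continuous up to and including the origin. -/
theorem continuousOn_mul_stieltjes (hω : ContinuousOn ω (Ioi 0)) (hC : 0 ≤ C)
    (hb : ∀ s, 0 < s → ‖ω s‖ ≤ C * (1 + s)⁻¹) :
    ContinuousOn (fun η => η * stieltjes ω η) rightHalf := by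
  have heq : (fun η => η * stieltjes ω η) =
      fun η => ∫ s in Ioi (0 : ℝ), ω s * (η * ((s : ℂ) + η)⁻¹) := by
    ext η
    rw [stieltjes, ← integral_const_mul]
    congr 1
    ext s
    ring
  rw [heq]
  intro η₀ hη₀
  refine continuousWithinAt_of_dominated
    (bound := fun s => C * (2 + ‖η₀‖) * ((1 + s)⁻¹ * (1 + s)⁻¹)) ?_ ?_
    (integrableOn_inv_mul_inv.const_mul _) ?_
  · filter_upwards [self_mem_nhdsWithin] with η hη
    refine ContinuousOn.aestronglyMeasurable (hω.mul (continuousOn_const.mul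
      (ContinuousOn.inv₀ (by fun_prop) fun s hs => add_ne_zero_of_pos hs hη))) measurableSet_Ioi
  · filter_upwards [self_mem_nhdsWithin, nhdsWithin_le_nhds
      (continuous_norm.continuousAt.eventually_lt_const (lt_add_one ‖η₀‖))] with η hη hηn
    filter_upwards [ae_restrict_mem measurableSet_Ioi] with s hs
    have hs' : 0 < s := hs
    have h1 := le_norm_add hs'.le hη
    have h2 := norm_le_norm_add hs'.le hη
    have h3 : ‖η * ((s : ℂ) + η)⁻¹‖ ≤ (2 + ‖η₀‖) * (1 + s)⁻¹ := by
      rw [norm_mul, norm_inv, ← div_eq_mul_inv, ← div_eq_mul_inv,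
        div_le_div_iff₀ (by linarith) (by linarith)]
      nlinarith [norm_nonneg η, norm_nonneg η₀]
    rw [norm_mul]
    calc _ ≤ (C * (1 + s)⁻¹) * ((2 + ‖η₀‖) * (1 + s)⁻¹) :=
          mul_le_mul (hb s hs') h3 (norm_nonneg _) (by positivity)
      _ = _ := by ring
  · filter_upwards [ae_restrict_mem measurableSet_Ioi] with s hs
    exact continuousWithinAt_const.mul (continuousWithinAt_id.mul
      (ContinuousWithinAt.inv₀ (by fun_prop) (add_ne_zero_of_pos hs hη₀)))

theorem integrableOn_stieltjes (hω : ContinuousOn ω (Ioi 0)) (hC : 0 ≤ C)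
    (hb : ∀ s, 0 < s → ‖ω s‖ ≤ C * (1 + s)⁻¹) {η : ℂ} (hη : η ∈ rightHalf) (hη0 : η ≠ 0) :
    IntegrableOn (fun s : ℝ => ω s * ((s : ℂ) + η)⁻¹) (Ioi 0) := by
  have hpos : 0 < ‖η‖ := norm_pos_iff.2 hη0
  refine Integrable.mono' (integrableOn_inv_mul_inv.const_mul (C * (‖η‖⁻¹ + 1)))
    (ContinuousOn.aestronglyMeasurable (hω.mul (ContinuousOn.inv₀ (by fun_prop)
      fun s hs => add_ne_zero_of_pos hs hη)) measurableSet_Ioi) ?_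
  filter_upwards [ae_restrict_mem measurableSet_Ioi] with s hs
  have hs' : 0 < s := hs
  have h1 := le_norm_add hs'.le hη
  have h2 := norm_le_norm_add hs'.le hη
  have h3 : ‖((s : ℂ) + η)⁻¹‖ ≤ (‖η‖⁻¹ + 1) * (1 + s)⁻¹ := by
    rw [norm_inv, inv_eq_one_div, ← div_eq_mul_inv, div_le_div_iff₀ (by linarith) (by linarith)]
    have : 1 ≤ ‖η‖⁻¹ * ‖(s : ℂ) + η‖ := by rwa [inv_mul_eq_div, one_le_div hpos]
    linarith
  rw [norm_mul]
  calc _ ≤ (C * (1 + s)⁻¹) * ((‖η‖⁻¹ + 1) * (1 + s)⁻¹) :=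
        mul_le_mul (hb s hs') h3 (norm_nonneg _) (by positivity)
    _ = _ := by ring

theorem differentiableOn_stieltjes (hω : ContinuousOn ω (Ioi 0)) (hC : 0 ≤ C)
    (hb : ∀ s, 0 < s → ‖ω s‖ ≤ C * (1 + s)⁻¹) :
    DifferentiableOn ℂ (stieltjes ω) {η | 0 < η.re} := by
  intro η₀ hη₀
  have hη₀' : 0 < η₀.re := hη₀
  set U : Set ℂ := {η : ℂ | η₀.re / 2 < η.re} with hU
  have hs : U ∈ 𝓝 η₀ :=
    (isOpen_lt continuous_const Complex.continuous_re).mem_nhds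
      (show η₀.re / 2 < η₀.re by linarith)
  have hsub : ∀ η ∈ U, η ∈ rightHalf := fun η hη => by
    have : η₀.re / 2 < η.re := hη
    exact show (0 : ℝ) ≤ η.re by linarith
  have hne0 : ∀ η ∈ U, η ≠ 0 := fun η hη h0 => by
    have : η₀.re / 2 < η.re := hη
    rw [h0, Complex.zero_re] at this
    linarith
  set m := min 1 (η₀.re / 2) with hm
  have hm0 : 0 < m := lt_min one_pos (half_pos hη₀')
  have hlow : ∀ η ∈ U, ∀ s : ℝ, 0 < s → m * (1 + s) ≤ ‖(s : ℂ) + η‖ := fun η hη s hs => by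
    refine le_trans ?_ (Complex.re_le_norm _)
    have h1 : η₀.re / 2 < η.re := hη
    have h2 : m ≤ 1 := min_le_left _ _
    have h3 : m ≤ η₀.re / 2 := min_le_right _ _
    simp only [Complex.add_re, Complex.ofReal_re]
    nlinarith
  have hmem := mem_of_mem_nhds hs
  refine (hasDerivAt_integral_of_dominated_loc_of_deriv_le (μ := volume.restrict (Ioi 0))
    (F := fun (η : ℂ) (s : ℝ) => ω s * ((s : ℂ) + η)⁻¹)
    (F' := fun (η : ℂ) (s : ℝ) => ω s * (-1 / ((s : ℂ) + η) ^ 2))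
    (bound := fun s => C * m⁻¹ ^ 2 * ((1 + s)⁻¹ * (1 + s)⁻¹)) hs
    ?_ (integrableOn_stieltjes hω hC hb (hsub η₀ hmem) (hne0 η₀ hmem)) ?_ ?_
    (integrableOn_inv_mul_inv.const_mul _) ?_).2.differentiableAt.differentiableWithinAt
  · filter_upwards [hs] with η hη using
      (integrableOn_stieltjes hω hC hb (hsub η hη) (hne0 η hη)).aestronglyMeasurable
  · exact ContinuousOn.aestronglyMeasurable (hω.mul (ContinuousOn.div (by fun_prop) (by fun_prop)
      fun s hs => pow_ne_zero 2 (add_ne_zero_of_pos hs (hsub η₀ hmem)))) measurableSet_Ioi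
  · filter_upwards [ae_restrict_mem measurableSet_Ioi] with s hs η hη
    have hs' : 0 < s := hs
    have h1 := hlow η hη s hs'
    have h2 : ‖-1 / ((s : ℂ) + η) ^ 2‖ ≤ m⁻¹ ^ 2 * (1 + s)⁻¹ := by
      rw [norm_div, norm_neg, norm_one, norm_pow]
      have h3 : (m * (1 + s)) ^ 2 ≤ ‖(s : ℂ) + η‖ ^ 2 := pow_le_pow_left₀ (by positivity) h1 2
      calc 1 / ‖(s : ℂ) + η‖ ^ 2 ≤ 1 / (m * (1 + s)) ^ 2 :=
            one_div_le_one_div_of_le (by positivity) h3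
        _ = m⁻¹ ^ 2 * ((1 + s)⁻¹ * (1 + s)⁻¹) := by field_simp
        _ ≤ m⁻¹ ^ 2 * (1 + s)⁻¹ := by
          refine mul_le_mul_of_nonneg_left ?_ (by positivity)
          exact mul_le_of_le_one_left (by positivity) (inv_le_one_of_one_le₀ (by linarith))
    rw [norm_mul]
    calc _ ≤ (C * (1 + s)⁻¹) * (m⁻¹ ^ 2 * (1 + s)⁻¹) :=
          mul_le_mul (hb s hs') h2 (norm_nonneg _) (by positivity)
      _ = _ := by ring
  · filter_upwards [ae_restrict_mem measurableSet_Ioi] with s hs η hη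
    exact (((hasDerivAt_id η).const_add (s : ℂ)).inv
      (add_ne_zero_of_pos hs (hsub η hη))).const_mul _

/-- Both `s` and `‖η‖` are at most `‖s + η‖`, so `‖s + η‖` dominates `√((1 + s) ‖η‖)` up to a
constant. Half a power goes to `η`, and the other half makes the integral in `s` converge. -/
theorem norm_stieltjes_le (hC : 0 ≤ C)
    (hb : ∀ s, 0 < s → ‖ω s‖ ≤ C * (1 + s)⁻¹) :
    ∃ C', 0 ≤ C' ∧ ∀ η ∈ rightHalf, 1 ≤ ‖η‖ →
      ‖stieltjes ω η‖ ≤ C' * ‖η‖ ^ (-(1 / 2) : ℝ) := by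
  have hI : IntegrableOn (fun s : ℝ => (1 + ‖s‖) ^ (-(3 / 2) : ℝ)) (Ioi 0) :=
    integrable_rpow_three_halves.integrableOn
  refine ⟨C * √2 * ∫ s in Ioi (0 : ℝ), (1 + ‖s‖) ^ (-(3 / 2) : ℝ),
    mul_nonneg (by positivity) (integral_nonneg fun s => by positivity), fun η hη h1 => ?_⟩
  rw [mul_right_comm, ← integral_const_mul]
  refine norm_integral_le_of_norm_le (hI.const_mul _) ?_
  filter_upwards [ae_restrict_mem measurableSet_Ioi] with s hs
  have hs' : 0 < s := hs
  have hη0 : 0 < ‖η‖ := by linarith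
  have g1 := le_norm_add hs'.le hη
  have g2 := norm_le_norm_add hs'.le hη
  have h3 : (1 + s) * ‖η‖ ≤ 2 * ‖(s : ℂ) + η‖ ^ 2 := by nlinarith
  have h4 : ‖((s : ℂ) + η)⁻¹‖ ≤ √2 * ((1 + s) ^ (-(1 / 2) : ℝ) * ‖η‖ ^ (-(1 / 2) : ℝ)) := by
    have h5 : √((1 + s) * ‖η‖) ≤ √2 * ‖(s : ℂ) + η‖ := by
      refine (Real.sqrt_le_sqrt h3).trans_eq ?_
      rw [Real.sqrt_mul (by norm_num), Real.sqrt_sq (norm_nonneg _)]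
    rw [← Real.mul_rpow (by positivity) (by positivity), Real.rpow_neg (by positivity),
      ← Real.sqrt_eq_rpow, norm_inv, inv_eq_one_div, ← div_eq_mul_inv,
      div_le_div_iff₀ (by linarith) (by positivity)]
    linarith
  have h6 : (1 + s) ^ (-(3 / 2) : ℝ) = (1 + s)⁻¹ * (1 + s) ^ (-(1 / 2) : ℝ) := by
    rw [← Real.rpow_neg_one, ← Real.rpow_add (by positivity)]
    norm_num
  rw [norm_mul, Real.norm_of_nonneg hs'.le, h6]
  calc _ ≤ (C * (1 + s)⁻¹) * (√2 * ((1 + s) ^ (-(1 / 2) : ℝ) * ‖η‖ ^ (-(1 / 2) : ℝ))) :=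
        mul_le_mul (hb s hs') h4 (norm_nonneg _) (by positivity)
    _ = _ := by ring

theorem stieltjes_conj (ω : ℝ → ℂ) (η : ℂ) :
    stieltjes (fun s => starRingEnd ℂ (ω s)) (starRingEnd ℂ η) = starRingEnd ℂ (stieltjes ω η) := by
  unfold stieltjes
  rw [← integral_conj]
  congr 1
  ext s
  simp

end Stieltjes

/-! ### The transform `K` of the derivative of the solution -/

/-- The transform of the derivative of the solution, as a function of `p = -i √k z`. -/
def derivTransform (a T : ℝ) (p : ℂ) : ℂ :=
  -(T : ℂ) + T * (factor a p)⁻¹ *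
    (p + a / Real.pi * (p * stieltjes (fun r => (factor a r)⁻¹) p))

section DerivTransform

variable {a : ℝ}

theorem ofReal_mem_rightHalf {r : ℝ} (hr : 0 ≤ r) : (r : ℂ) ∈ rightHalf := by
  simpa [rightHalf] using hr

theorem continuousOn_inv_factor_ofReal (ha : 0 < a) :
    ContinuousOn (fun r : ℝ => (factor a r)⁻¹) (Ioi 0) :=
  (holoOn_inv_factor ha).cont.comp (by fun_prop) fun _ hr => ofReal_mem_rightHalf (le_of_lt hr)

theorem norm_inv_factor_ofReal_le (ha : 0 < a) (r : ℝ) (hr : 0 < r) :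
    ‖(factor a r)⁻¹‖ ≤ 2 * (1 + r)⁻¹ := by
  simpa [abs_of_pos hr] using norm_inv_factor_le ha (ofReal_mem_rightHalf hr.le)

theorem continuousOn_inv_factor_I_mul (ha : 0 < a) :
    ContinuousOn (fun r : ℝ => (factor a (I * r))⁻¹) (Ioi 0) :=
  (holoOn_inv_factor ha).cont.comp (by fun_prop) fun _ _ => I_mul_ofReal_mem_rightHalf _

theorem norm_inv_factor_I_mul_le (ha : 0 < a) (r : ℝ) (hr : 0 < r) :
    ‖(factor a (I * r))⁻¹‖ ≤ 2 * (1 + r)⁻¹ := by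
  simpa [abs_of_pos hr] using norm_inv_factor_le ha (I_mul_ofReal_mem_rightHalf r)

theorem holoOn_derivTransform (ha : 0 < a) (T : ℝ) : HoloOn (derivTransform a T) rightHalf := by
  have hE := holoOn_inv_factor ha
  have hc := continuousOn_mul_stieltjes (continuousOn_inv_factor_ofReal ha) (by norm_num)
    (norm_inv_factor_ofReal_le ha)
  have hd := differentiableOn_stieltjes (continuousOn_inv_factor_ofReal ha) (by norm_num)
    (norm_inv_factor_ofReal_le ha)
  refine ⟨continuousOn_const.add ((continuousOn_const.mul hE.cont).mul
    (continuousOn_id.add (continuousOn_const.mul hc))), ?_⟩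
  have hE' := hE.diff
  rw [interior_rightHalf] at hE' ⊢
  exact (((hE'.const_mul _).mul (differentiableOn_id.add
    ((differentiableOn_id.mul hd).const_mul _))).const_add _)

theorem powerDecay_derivTransform (ha : 0 < a) (T : ℝ) :
    PowerDecay (1 / 2) (derivTransform a T) rightHalf := by
  obtain ⟨C₁, hC₁, h1⟩ := norm_factor_sub_one_le ha
  obtain ⟨C₂, hC₂, h2⟩ := norm_stieltjes_le (by norm_num) (norm_inv_factor_ofReal_le ha)
  refine PowerDecay.of_large (by norm_num) isClosed_rightHalf (holoOn_derivTransform ha T).cont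
    (R := 1) (C := |T| * C₁ + |T| * (a / Real.pi * C₂)) le_rfl fun p hp hp1 => ?_
  have hp0 : p ≠ 0 := norm_pos_iff.1 (by linarith)
  have hinv := inv_mem_rightHalf hp
  have e1 : p * (factor a p)⁻¹ = (factor a p⁻¹)⁻¹ := by
    rw [factor_eq_mul ha hp hp0, mul_inv, ← mul_assoc, mul_inv_cancel₀ hp0, one_mul]
  -- `p / D(p) = 1 / D(1/p)` tends to 1, so the term `T p / D(p)` cancels `-T` at infinity.
  have e2 : derivTransform a T p = T * ((factor a p⁻¹)⁻¹ - 1) + T * ((factor a p⁻¹)⁻¹ *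
      (a / Real.pi * stieltjes (fun r => (factor a r)⁻¹) p)) := by
    rw [derivTransform, ← e1]
    ring
  have n1 : ‖(factor a p⁻¹)⁻¹ - 1‖ ≤ C₁ * ‖p‖ ^ (-(1 / 2) : ℝ) := by
    have := (h1 p⁻¹ hinv (by rw [norm_inv]; exact inv_le_one_of_one_le₀ hp1)).2
    rwa [norm_inv, Real.sqrt_inv, Real.sqrt_eq_rpow, ← Real.rpow_neg (norm_nonneg p)] at this
  have n2 : ‖(factor a p⁻¹)⁻¹‖ ≤ 1 := by
    rw [norm_inv]
    exact inv_le_one_of_one_le₀ (one_le_norm_factor ha hinv)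
  have n3 : ‖(a : ℂ) / Real.pi * stieltjes (fun r => (factor a r)⁻¹) p‖ ≤
      a / Real.pi * C₂ * ‖p‖ ^ (-(1 / 2) : ℝ) := by
    rw [norm_mul, norm_div, Complex.norm_real, Complex.norm_real, Real.norm_of_nonneg ha.le,
      Real.norm_of_nonneg Real.pi_pos.le, mul_assoc]
    exact mul_le_mul_of_nonneg_left (h2 p hp hp1) (by have := Real.pi_pos; positivity)
  rw [e2]
  refine (norm_add_le _ _).trans ?_
  rw [norm_mul, norm_mul _ ((factor a p⁻¹)⁻¹ * _), norm_mul, Complex.norm_real, Real.norm_eq_abs,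
    add_mul]
  refine add_le_add ?_ ?_
  · rw [mul_assoc]
    exact mul_le_mul_of_nonneg_left n1 (abs_nonneg _)
  · rw [mul_assoc]
    refine mul_le_mul_of_nonneg_left ?_ (abs_nonneg _)
    calc _ ≤ 1 * (a / Real.pi * C₂ * ‖p‖ ^ (-(1 / 2) : ℝ)) :=
          mul_le_mul n2 n3 (norm_nonneg _) zero_le_one
      _ = _ := one_mul _

theorem derivTransform_conj (T : ℝ) {p : ℂ} (hp : p ∈ rightHalf) :
    derivTransform a T (starRingEnd ℂ p) = starRingEnd ℂ (derivTransform a T p) := by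
  have h1 : stieltjes (fun r => (factor a r)⁻¹) (starRingEnd ℂ p) =
      starRingEnd ℂ (stieltjes (fun r => (factor a r)⁻¹) p) := by
    rw [← stieltjes_conj]
    refine setIntegral_congr_fun measurableSet_Ioi fun r hr => ?_
    simp only
    rw [map_inv₀, ← factor_conj (ofReal_mem_rightHalf (le_of_lt hr)), Complex.conj_ofReal]
  simp only [derivTransform, map_add, map_mul, map_neg, map_inv₀, map_div₀, Complex.conj_ofReal, h1,
    factor_conj hp]

/-- `1 / D` is holomorphic in the first quadrant, so only the pole `-q` has to stay away. The
hypotheses are stated for the kernel so as to cover both `Re q > 0` and `q = i y` with `y > 0`. -/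
theorem stieltjes_rotate (ha : 0 < a) {q : ℂ}
    (hq : PowerDecay 1 (fun ζ => (ζ + q)⁻¹) quadrant) (hq0 : ∀ ζ ∈ quadrant, ζ + q ≠ 0) :
    stieltjes (fun r => (factor a r)⁻¹) q =
      I * ∫ s in Ioi (0 : ℝ), (factor a (I * s))⁻¹ * (I * s + q)⁻¹ := by
  have hE := (holoOn_inv_factor ha).mono quadrant_subset_rightHalf
  have hinv : HoloOn (fun ζ : ℂ => (ζ + q)⁻¹) quadrant :=
    HoloOn.of_differentiableAt fun z hz => DifferentiableAt.inv (by fun_prop) (hq0 z hz)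
  exact integral_ray_rotate (g := fun ζ => (factor a ζ)⁻¹ * (ζ + q)⁻¹) (hE.mul hinv)
    ((((powerDecay_inv_factor ha).mono_set quadrant_subset_rightHalf).mul hq).mono (by norm_num))

theorem add_ne_zero_of_re_pos {q ζ : ℂ} (hq : 0 < q.re) (hζ : ζ ∈ rightHalf) : ζ + q ≠ 0 := by
  intro h
  have h1 := congrArg Complex.re h
  have h2 : 0 ≤ ζ.re := hζ
  simp only [Complex.add_re, Complex.zero_re] at h1
  linarith

theorem powerDecay_inv_add {q : ℂ} (hq : 0 < q.re) :
    PowerDecay 1 (fun ζ => (ζ + q)⁻¹) rightHalf := by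
  simpa using powerDecay_inv_sub (q := -q) (by simpa using hq)

theorem one_add_norm_le_of_pos {y : ℝ} (hy : 0 < y) {ζ : ℂ} (hζ : ζ ∈ quadrant) :
    1 + ‖ζ‖ ≤ (y⁻¹ + 1) * ‖ζ + I * y‖ := by
  have h := sq_add_sq_le_norm_sq hy.le (neg_I_mul_mem_rightHalf hζ)
  have h1 : ‖(y : ℂ) + -I * ζ‖ = ‖ζ + I * y‖ := by
    have : (y : ℂ) + -I * ζ = -I * (ζ + I * y) := by
      linear_combination (y : ℂ) * Complex.I_sq
    rw [this, norm_mul]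
    simp
  have h2 : ‖-I * ζ‖ = ‖ζ‖ := by simp
  rw [h1, h2] at h
  have h3 : y ≤ ‖ζ + I * y‖ := le_of_sq_le_sq (by nlinarith [sq_nonneg ‖ζ‖]) (norm_nonneg _)
  have h4 : ‖ζ‖ ≤ ‖ζ + I * y‖ := le_of_sq_le_sq (by nlinarith) (norm_nonneg _)
  have h5 : 1 ≤ y⁻¹ * ‖ζ + I * y‖ := by rwa [inv_mul_eq_div, one_le_div hy]
  linarith

theorem add_I_mul_ne_zero {y : ℝ} (hy : 0 < y) {ζ : ℂ} (hζ : ζ ∈ quadrant) : ζ + I * y ≠ 0 := by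
  intro h
  have := one_add_norm_le_of_pos hy hζ
  rw [h, norm_zero, mul_zero] at this
  linarith [norm_nonneg ζ]

/-- Rotating the ray along with the argument expresses `K` on the positive imaginary axis by a
Stieltjes transform that makes sense in the whole right half-plane; this is what allows the
continuation past the axis. -/
theorem stieltjes_I_mul (ha : 0 < a) {y : ℝ} (hy : 0 < y) :
    stieltjes (fun r => (factor a r)⁻¹) (I * y) =
      stieltjes (fun s => (factor a (I * s))⁻¹) y := by
  rw [stieltjes_rotate ha ?_ fun ζ hζ => add_I_mul_ne_zero hy hζ, ← integral_const_mul]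
  · refine integral_congr_ae (ae_of_all _ fun s => ?_)
    simp only
    rw [← mul_add, mul_inv, mul_left_comm, ← mul_assoc I, mul_inv_cancel₀ Complex.I_ne_zero, one_mul]
  · refine ⟨y⁻¹ + 1, by positivity, fun ζ hζ => ?_⟩
    have h1 := one_add_norm_le_of_pos hy hζ
    have h2 : 0 < ‖ζ + I * y‖ := norm_pos_iff.2 (add_I_mul_ne_zero hy hζ)
    rw [norm_inv, Real.rpow_neg_one, inv_eq_one_div, ← div_eq_mul_inv,
      div_le_div_iff₀ h2 (by positivity)]
    linarith

end DerivTransform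

/-! ### Reduction of formulas (A) and (B) to `K` -/

section Transforms

/-- The arguments `π / 2` and `arg (1 + w)` add up to at most `π`, so the principal branch is
respected. For `-I` the sum must exceed `-π`, which needs the strict bound. -/
theorem csqrt_I_mul {w : ℂ} (hw : 0 ≤ w.re) :
    csqrt (I * (1 + w)) = Complex.exp (Real.pi / 4 * I) * Complex.exp (1 / 2 * Complex.log (1 + w)) := by
  have hmem := one_add_mem_slitPlane hw
  have hne := Complex.slitPlane_ne_zero hmem
  have harg : |Complex.arg (1 + w)| ≤ Real.pi / 2 :=
    Complex.abs_arg_le_pi_div_two_iff.2 (by simp only [Complex.add_re, Complex.one_re]; linarith)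
  rw [abs_le] at harg
  have hpi := Real.pi_pos
  rw [csqrt, Complex.cpow_def_of_ne_zero (mul_ne_zero Complex.I_ne_zero hne), Complex.log_mul
    Complex.I_ne_zero hne, Complex.log_I, ← Complex.exp_add]
  · congr 1
    ring
  · rw [Complex.arg_I]
    constructor <;> linarith

theorem csqrt_neg_I_mul {w : ℂ} (hw : 0 ≤ w.re) :
    csqrt (-I * (1 + w)) =
      Complex.exp (-(Real.pi / 4 * I)) * Complex.exp (1 / 2 * Complex.log (1 + w)) := by
  have hmem := one_add_mem_slitPlane hw
  have hne := Complex.slitPlane_ne_zero hmem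
  have hI : -I ≠ 0 := neg_ne_zero.2 Complex.I_ne_zero
  have harg : |Complex.arg (1 + w)| < Real.pi / 2 :=
    Complex.abs_arg_lt_pi_div_two_iff.2
      (Or.inl (by simp only [Complex.add_re, Complex.one_re]; linarith))
  rw [abs_lt] at harg
  have hpi := Real.pi_pos
  rw [csqrt, Complex.cpow_def_of_ne_zero (mul_ne_zero hI hne), Complex.log_mul hI hne,
    Complex.log_neg_I, ← Complex.exp_add]
  · congr 1
    ring
  · rw [Complex.arg_neg_I]
    constructor <;> linarith

theorem exp_pi_div_four_mul_self :
    Complex.exp (Real.pi / 4 * I) * Complex.exp (Real.pi / 4 * I) = I := by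
  rw [← Complex.exp_add]
  have : (Real.pi : ℂ) / 4 * I + Real.pi / 4 * I = Real.pi / 2 * I := by ring
  rw [this, Complex.exp_pi_div_two_mul_I]

variable {lam k : ℝ}

theorem denomB_eq (hlam : 0 < lam) (hk : 0 < k) {z : ℂ} (hz : z ∈ upperHalf) :
    denomB lam k z = factor (lam / √k) (-(I * √k) * z) := by
  have hκ : 0 < √k := Real.sqrt_pos.2 hk
  have hz' : 0 < z.im := hz
  set q := -(I * √k) * z with hq
  have hqr : 0 ≤ q.re := by rw [hq, re_neg_I_mul]; positivity
  have hne := Complex.slitPlane_ne_zero (one_add_mem_slitPlane hqr)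
  have h1 : 1 - I * √k * z = 1 + q := by rw [hq]; ring
  rw [denomB, (isLogFactorization_symbolB hlam hk).canonical_upper hκ hz', h1, logCanonicalB,
    Complex.ofReal_one, one_mul, Complex.exp_sub, Complex.exp_log hne, div_mul_cancel₀ _ hne, factor]

theorem exp_half_log_mul (w : ℂ) (b : ℂ) :
    Complex.exp (b - 1 / 2 * w) * Complex.exp (1 / 2 * w) = Complex.exp b := by
  rw [← Complex.exp_add]
  congr 1
  ring

/-- `lam z + i` and `k̃ z + i` are `i` times `1 + a p` and `1 + a⁻¹ p`. Their roots cancel those in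
`X`, and the two phases `e^{iπ/4}` multiply to `I`. -/
theorem denomA_eq (hlam : 0 < lam) (hk : 0 < k) {z : ℂ} (hz : z ∈ upperHalf) :
    denomA lam k z = I * factor (lam / √k) (-(I * √k) * z) := by
  have hκ : 0 < √k := Real.sqrt_pos.2 hk
  have hκ' : (√k : ℂ) ≠ 0 := by exact_mod_cast hκ.ne'
  have hlam' : (lam : ℂ) ≠ 0 := by exact_mod_cast hlam.ne'
  have hsq : (√k : ℂ) ^ 2 = k := by exact_mod_cast Real.sq_sqrt hk.le
  have hz' : 0 < z.im := hz
  set q := -(I * √k) * z with hq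
  have hqr : 0 ≤ q.re := by rw [hq, re_neg_I_mul]; positivity
  have h1 : (lam : ℂ) * z + I = I * (1 + ((lam / √k : ℝ) : ℂ) * q) := by
    rw [hq]
    push_cast
    field_simp
    linear_combination ((lam : ℂ) * z) * Complex.I_sq
  have h2 : ((k / lam : ℝ) : ℂ) * z + I = I * (1 + (((lam / √k)⁻¹ : ℝ) : ℂ) * q) := by
    rw [hq]
    push_cast
    field_simp
    rw [← hsq]
    linear_combination ((√k : ℂ) ^ 2 * z) * Complex.I_sq
  have r1 : 0 ≤ (((lam / √k : ℝ) : ℂ) * q).re := by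
    rw [Complex.re_ofReal_mul]; positivity
  have r2 : 0 ≤ ((((lam / √k)⁻¹ : ℝ) : ℂ) * q).re := by
    rw [Complex.re_ofReal_mul]; positivity
  rw [denomA, (isLogFactorization_symbolA hlam hk).canonical_upper hκ hz', h1, h2, csqrt_I_mul r1,
    csqrt_I_mul r2, ← hq, logCanonicalA, factor]
  set A := Complex.log (1 + ((lam / √k : ℝ) : ℂ) * q)
  set B := Complex.log (1 + (((lam / √k)⁻¹ : ℝ) : ℂ) * q)
  set ℓ := logFactor (lam / √k) q
  have e1 := exp_half_log_mul B (ℓ - 1 / 2 * A)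
  have e2 := exp_half_log_mul A ℓ
  have e3 := exp_pi_div_four_mul_self
  calc _ = (Complex.exp (Real.pi / 4 * I) * Complex.exp (Real.pi / 4 * I)) *
        ((Complex.exp (ℓ - 1 / 2 * A - 1 / 2 * B) * Complex.exp (1 / 2 * B)) *
          Complex.exp (1 / 2 * A)) := by ring
    _ = _ := by rw [e1, e2, e3]

/-- `X⁻(s) = (1 + i√k s) / D(i√k s)`, so the linear factor drops out. -/
theorem integrandB_eq (hk : 0 < k) (z : ℂ) (s : ℝ) :
    integrandB k (fun s => Complex.exp (-logCanonicalB (lam / √k) (I * (√k * s : ℝ)))) z s =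
      (√k : ℂ) * (I * ((factor (lam / √k) (I * (√k * s : ℝ)))⁻¹ *
        (I * (√k * s : ℝ) + -(I * √k) * z)⁻¹)) := by
  have hκ : 0 < √k := Real.sqrt_pos.2 hk
  have hinv := (inv_sub_eq_mul_inv hκ s z).2
  have hmem := I_mul_ofReal_mem_rightHalf (√k * s)
  have hne := Complex.slitPlane_ne_zero (one_add_mem_slitPlane hmem)
  have h1 : 1 + I * √k * s = 1 + I * ((√k * s : ℝ) : ℂ) := by push_cast; ring
  have h2 : I * ((√k * s : ℝ) : ℂ) - I * √k * z = I * ((√k * s : ℝ) : ℂ) + -(I * √k) * z := by ring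
  rw [integrandB, h1, div_eq_mul_inv, mul_inv, hinv, h2, logCanonicalB, Complex.ofReal_one, one_mul,
    neg_sub, Complex.exp_sub, Complex.exp_log hne, factor, div_eq_mul_inv]
  calc _ = ((1 + I * ((√k * s : ℝ) : ℂ)) * (1 + I * ((√k * s : ℝ) : ℂ))⁻¹) * (√k * (I *
        ((Complex.exp (logFactor (lam / √k) (I * ((√k * s : ℝ) : ℂ))))⁻¹ *
        (I * ((√k * s : ℝ) : ℂ) + -(I * √k) * z)⁻¹))) := by ring
    _ = _ := by rw [mul_inv_cancel₀ hne, one_mul]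

/-- As in case B, except that the two phases `e^{-iπ/4}` in the denominator leave an extra factor
`I`, which compensates the one in `denomA_eq`. -/
theorem integrandA_eq (hlam : 0 < lam) (hk : 0 < k) (z : ℂ) (s : ℝ) :
    integrandA lam k (fun s => Complex.exp (-logCanonicalA (lam / √k) (I * (√k * s : ℝ)))) z s =
      I * ((√k : ℂ) * (I * ((factor (lam / √k) (I * (√k * s : ℝ)))⁻¹ *
        (I * (√k * s : ℝ) + -(I * √k) * z)⁻¹))) := by
  have hκ : 0 < √k := Real.sqrt_pos.2 hk
  have hκ' : (√k : ℂ) ≠ 0 := by exact_mod_cast hκ.ne'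
  have hlam' : (lam : ℂ) ≠ 0 := by exact_mod_cast hlam.ne'
  have hsq : (√k : ℂ) ^ 2 = k := by exact_mod_cast Real.sq_sqrt hk.le
  have hinv := (inv_sub_eq_mul_inv hκ s z).2
  set q := I * ((√k * s : ℝ) : ℂ) with hq
  have hqr : 0 ≤ q.re := I_mul_ofReal_mem_rightHalf (√k * s)
  have h1 : (lam : ℂ) * s - I = -I * (1 + ((lam / √k : ℝ) : ℂ) * q) := by
    rw [hq]
    push_cast
    field_simp
    linear_combination ((lam : ℂ) * s) * Complex.I_sq
  have h2 : ((k / lam : ℝ) : ℂ) * s - I = -I * (1 + (((lam / √k)⁻¹ : ℝ) : ℂ) * q) := by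
    rw [hq]
    push_cast
    field_simp
    rw [← hsq]
    linear_combination ((√k : ℂ) ^ 2 * s) * Complex.I_sq
  have r1 : 0 ≤ (((lam / √k : ℝ) : ℂ) * q).re := by
    rw [Complex.re_ofReal_mul]; positivity
  have r2 : 0 ≤ ((((lam / √k)⁻¹ : ℝ) : ℂ) * q).re := by
    rw [Complex.re_ofReal_mul]; positivity
  have h3 : q - I * √k * z = q + -(I * √k) * z := by ring
  rw [integrandA, h1, h2, csqrt_neg_I_mul r1, csqrt_neg_I_mul r2, div_eq_mul_inv, mul_inv, hinv, h3,
    logCanonicalA, factor]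
  set A := Complex.log (1 + ((lam / √k : ℝ) : ℂ) * q)
  set B := Complex.log (1 + (((lam / √k)⁻¹ : ℝ) : ℂ) * q)
  set ℓ := logFactor (lam / √k) q
  have key : Complex.exp (-(ℓ - 1 / 2 * A - 1 / 2 * B)) *
      (Complex.exp (-(Real.pi / 4 * I)) * Complex.exp (1 / 2 * A) *
        (Complex.exp (-(Real.pi / 4 * I)) * Complex.exp (1 / 2 * B)))⁻¹ =
      I * (Complex.exp ℓ)⁻¹ := by
    have hI : I * (Complex.exp ℓ)⁻¹ =
        Complex.exp (Real.pi / 4 * I) * Complex.exp (Real.pi / 4 * I) * (Complex.exp ℓ)⁻¹ := by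
      rw [exp_pi_div_four_mul_self]
    rw [hI]
    simp only [← Complex.exp_add, ← Complex.exp_neg]
    congr 1
    ring
  rw [← mul_assoc, key]
  ring

theorem integrableOn_rotated (hlam : 0 < lam) (hk : 0 < k) {q : ℂ} (hq : 0 < q.re) :
    IntegrableOn (fun s : ℝ => (√k : ℂ) * (I * ((factor (lam / √k) (I * (√k * s : ℝ)))⁻¹ *
        (I * (√k * s : ℝ) + q)⁻¹))) (Ioi 0) := by
  have hκ : 0 < √k := Real.sqrt_pos.2 hk
  have ha : 0 < lam / √k := by positivity
  have hE := (holoOn_inv_factor ha).cont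
  have hinv : ContinuousOn (fun ζ : ℂ => (ζ + q)⁻¹) rightHalf :=
    ContinuousOn.inv₀ (by fun_prop) fun ζ hζ => add_ne_zero_of_re_pos hq hζ
  have h := integrableOn_I_mul_of_decay ((hE.mul hinv).mono quadrant_subset_rightHalf)
    ((((powerDecay_inv_factor ha).mul (powerDecay_inv_add hq)).mono
      (by norm_num)).mono_set quadrant_subset_rightHalf)
  have h2 := (integrableOn_Ioi_comp_mul_left_iff _ 0 hκ).2 (by rwa [mul_zero])
  exact (h2.const_mul I).const_mul _

/-- Scaling by `√k` and turning the imaginary ray back onto the real one produces the Stieltjes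
transform that occurs in `derivTransform`. -/
theorem integral_rotated (hlam : 0 < lam) (hk : 0 < k) {q : ℂ} (hq : 0 < q.re) :
    ∫ s in Ioi (0 : ℝ), (√k : ℂ) * (I * ((factor (lam / √k) (I * (√k * s : ℝ)))⁻¹ *
        (I * (√k * s : ℝ) + q)⁻¹)) =
      stieltjes (fun r => (factor (lam / √k) r)⁻¹) q := by
  have hκ : 0 < √k := Real.sqrt_pos.2 hk
  have hκ' : (√k : ℂ) ≠ 0 := by exact_mod_cast hκ.ne'
  have ha : 0 < lam / √k := by positivity
  rw [integral_const_mul, integral_const_mul, stieltjes_rotate ha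
    ((powerDecay_inv_add hq).mono_set quadrant_subset_rightHalf)
    fun ζ hζ => add_ne_zero_of_re_pos hq (quadrant_subset_rightHalf hζ),
    integral_comp_mul_left_Ioi (fun s : ℝ => (factor (lam / √k) (I * s))⁻¹ * (I * s + q)⁻¹) 0 hκ,
    mul_zero, Complex.real_smul, mul_left_comm I, ← mul_assoc]
  push_cast
  rw [mul_inv_cancel₀ hκ', one_mul]

theorem transformB_eq (hlam : 0 < lam) (hk : 0 < k) (T : ℝ) {z : ℂ} (hz : z ∈ upperHalf) :
    transformB lam k T (fun s => Complex.exp (-logCanonicalB (lam / √k) (I * (√k * s : ℝ)))) z =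
      derivTransform (lam / √k) T (-(I * √k) * z) := by
  have hκ : 0 < √k := Real.sqrt_pos.2 hk
  have hκ' : (√k : ℂ) ≠ 0 := by exact_mod_cast hκ.ne'
  have hz' : 0 < z.im := hz
  have hq : 0 < (-(I * √k) * z).re := by rw [re_neg_I_mul]; positivity
  have hpi : (Real.pi : ℂ) ≠ 0 := by exact_mod_cast Real.pi_ne_zero
  have hD : factor (lam / √k) (-(I * √k) * z) ≠ 0 := factor_ne_zero _
  rw [transformB, denomB_eq hlam hk hz]
  simp_rw [integrandB_eq hk]
  rw [integral_rotated hlam hk hq, derivTransform]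
  push_cast
  field_simp
  ring

theorem transformA_eq (hlam : 0 < lam) (hk : 0 < k) (T : ℝ) {z : ℂ} (hz : z ∈ upperHalf) :
    transformA lam k T (fun s => Complex.exp (-logCanonicalA (lam / √k) (I * (√k * s : ℝ)))) z =
      derivTransform (lam / √k) T (-(I * √k) * z) := by
  have hκ : 0 < √k := Real.sqrt_pos.2 hk
  have hκ' : (√k : ℂ) ≠ 0 := by exact_mod_cast hκ.ne'
  have hz' : 0 < z.im := hz
  have hq : 0 < (-(I * √k) * z).re := by rw [re_neg_I_mul]; positivity
  have hpi : (Real.pi : ℂ) ≠ 0 := by exact_mod_cast Real.pi_ne_zero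
  have hI := Complex.I_ne_zero
  have hD : factor (lam / √k) (-(I * √k) * z) ≠ 0 := factor_ne_zero _
  rw [transformA, denomA_eq hlam hk hz]
  simp_rw [integrandA_eq hlam hk]
  rw [integral_const_mul, integral_rotated hlam hk hq, derivTransform]
  push_cast
  generalize stieltjes (fun r => (factor (lam / √k) r)⁻¹) (-(I * √k) * z) = S
  generalize factor (lam / √k) (-(I * √k) * z) = D at hD ⊢
  field_simp
  linear_combination (T * Real.pi * z * √k + T * lam * z * S) * Complex.I_sq

end Transforms
-- Continuation of `K` to the cut and Carleman's relation
/-- The continuation of `η ↦ derivTransform a T (iη)` from the positive axis to the first quadrant. -/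
def rotatedTransform (a T : ℝ) (η : ℂ) : ℂ :=
  -(T : ℂ) + T * (I * factor a (-I * η) * (1 + a * η + η ^ 2)⁻¹) *
    (η + a / Real.pi * (η * stieltjes (fun s => (factor a (I * s))⁻¹) η))

/-- The density `w` in `φ(x) = ∫₀^∞ w(r) e^{-rx} dr`. -/
def density (a T r : ℝ) : ℝ := (rotatedTransform a T (I * r)).im / (Real.pi * r)

section RotatedTransform

variable {a : ℝ}

theorem holoOn_rotatedTransform (ha : 0 < a) (T : ℝ) : HoloOn (rotatedTransform a T) quadrant := by
  have hF := (holoOn_factor ha).comp_neg_I_mul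
  have hq : HoloOn (fun η : ℂ => (1 + a * η + η ^ 2)⁻¹) quadrant :=
    HoloOn.of_differentiableAt fun z hz => DifferentiableAt.inv (by fun_prop)
      (quadratic_ne_zero ha (quadrant_subset_rightHalf hz))
  have hc := (continuousOn_mul_stieltjes (continuousOn_inv_factor_I_mul ha) (by norm_num)
    (norm_inv_factor_I_mul_le ha)).mono quadrant_subset_rightHalf
  have hd := (differentiableOn_stieltjes (continuousOn_inv_factor_I_mul ha) (by norm_num)
    (norm_inv_factor_I_mul_le ha)).mono (s := interior quadrant) fun z hz => by
      rw [interior_quadrant] at hz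
      exact hz.1
  exact ⟨continuousOn_const.add ((continuousOn_const.mul ((continuousOn_const.mul hF.cont).mul
    hq.cont)).mul (continuousOn_id.add (continuousOn_const.mul hc))),
    (((((hF.diff.const_mul _).mul hq.diff).const_mul _).mul (differentiableOn_id.add
    ((differentiableOn_id.mul hd).const_mul _))).const_add _)⟩

/-- The counterpart of `p / D(p) → 1` for the continued factor: by the inversion symmetry the
product equals `η² D((-iη)⁻¹) / (1 + a η + η²)`. -/
theorem norm_rotated_factor_sub_one_le (ha : 0 < a) : ∃ C, 0 ≤ C ∧ ∀ η ∈ quadrant,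
    2 * a + 2 ≤ ‖η‖ → ‖I * factor a (-I * η) * (1 + a * η + η ^ 2)⁻¹ * η - 1‖ ≤
      C * ‖η‖ ^ (-(1 / 2) : ℝ) := by
  obtain ⟨C, hC, h⟩ := norm_factor_sub_one_le ha
  refine ⟨2 * C + 2 * (1 + a), by positivity, fun η hη hR => ?_⟩
  have hη1 : 1 ≤ ‖η‖ := by linarith
  have hη0 : η ≠ 0 := norm_pos_iff.1 (by linarith)
  have hmem := neg_I_mul_mem_rightHalf hη
  have hne : -I * η ≠ 0 := mul_ne_zero (neg_ne_zero.2 Complex.I_ne_zero) hη0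
  have hQ := quadratic_ne_zero ha (quadrant_subset_rightHalf hη)
  have hnorm : ‖(-I * η)⁻¹‖ = ‖η‖⁻¹ := by rw [norm_inv, norm_mul]; simp
  have h1 := (h _ (inv_mem_rightHalf hmem) (by rw [hnorm]; exact inv_le_one_of_one_le₀ hη1)).1
  rw [hnorm, Real.sqrt_inv, Real.sqrt_eq_rpow, ← Real.rpow_neg (norm_nonneg η)] at h1
  have heq : I * factor a (-I * η) * (1 + a * η + η ^ 2)⁻¹ * η - 1 =
      (η ^ 2 * (factor a (-I * η)⁻¹ - 1) - (1 + a * η)) * (1 + a * η + η ^ 2)⁻¹ := by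
    rw [factor_eq_mul ha hmem hne, eq_mul_inv_iff_mul_eq₀ hQ, sub_mul, one_mul]
    have : I * (-I * η * factor a (-I * η)⁻¹) * (1 + a * η + η ^ 2)⁻¹ * η * (1 + a * η + η ^ 2) =
        I * (-I * η * factor a (-I * η)⁻¹) * η *
          ((1 + a * η + η ^ 2)⁻¹ * (1 + a * η + η ^ 2)) := by ring
    rw [this, inv_mul_cancel₀ hQ]
    linear_combination (-(η ^ 2 * factor a (-I * η)⁻¹)) * Complex.I_sq
  have h2 := quadratic_norm_lower ha hR
  have h3 : ‖η ^ 2 * (factor a (-I * η)⁻¹ - 1) - (1 + a * η)‖ ≤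
      ‖η‖ ^ 2 * (C * ‖η‖ ^ (-(1 / 2) : ℝ)) + (1 + a) * ‖η‖ := by
    refine (norm_sub_le _ _).trans (add_le_add ?_ ?_)
    · rw [norm_mul, norm_pow]
      exact mul_le_mul_of_nonneg_left h1 (by positivity)
    · refine (norm_add_le _ _).trans ?_
      rw [norm_one, norm_mul, Complex.norm_real, Real.norm_of_nonneg ha.le]
      linarith
  have h4 : ‖η‖⁻¹ ≤ ‖η‖ ^ (-(1 / 2) : ℝ) := by
    rw [← Real.rpow_neg_one]
    exact Real.rpow_le_rpow_of_exponent_le hη1 (by norm_num)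
  rw [heq, norm_mul, norm_inv, ← div_eq_mul_inv]
  have hpos : 0 < ‖η‖ := by linarith
  calc _ ≤ (‖η‖ ^ 2 * (C * ‖η‖ ^ (-(1 / 2) : ℝ)) + (1 + a) * ‖η‖) / (‖η‖ ^ 2 / 2) :=
        div_le_div₀ (by positivity) h3 (by positivity) h2
    _ = 2 * C * ‖η‖ ^ (-(1 / 2) : ℝ) + 2 * (1 + a) * ‖η‖⁻¹ := by field_simp
    _ ≤ 2 * C * ‖η‖ ^ (-(1 / 2) : ℝ) + 2 * (1 + a) * ‖η‖ ^ (-(1 / 2) : ℝ) := by gcongr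
    _ = _ := by ring

theorem powerDecay_rotatedTransform (ha : 0 < a) (T : ℝ) :
    PowerDecay (1 / 2) (rotatedTransform a T) quadrant := by
  obtain ⟨C₁, hC₁, h1⟩ := norm_rotated_factor_sub_one_le ha
  obtain ⟨C₂, hC₂, h2⟩ := norm_stieltjes_le (by norm_num) (norm_inv_factor_I_mul_le ha)
  refine PowerDecay.of_large (by norm_num) isClosed_quadrant (holoOn_rotatedTransform ha T).cont
    (R := 2 * a + 2) (C := |T| * C₁ + |T| * ((C₁ + 1) * (a / Real.pi * C₂))) (by linarith)
    fun η hη hR => ?_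
  have hη1 : 1 ≤ ‖η‖ := by linarith
  have hpi := Real.pi_pos
  set A := I * factor a (-I * η) * (1 + a * η + η ^ 2)⁻¹ * η with hA
  set S := stieltjes (fun s => (factor a (I * s))⁻¹) η with hS
  have e : rotatedTransform a T η = T * (A - 1) + T * (A * (a / Real.pi * S)) := by
    rw [rotatedTransform, ← hS, hA]
    ring
  have n1 := h1 η hη hR
  have hle : ‖η‖ ^ (-(1 / 2) : ℝ) ≤ 1 := Real.rpow_le_one_of_one_le_of_nonpos hη1 (by norm_num)
  have n2 : ‖A‖ ≤ C₁ + 1 := by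
    have : ‖A‖ ≤ ‖A - 1‖ + 1 := by simpa using norm_add_le (A - 1) 1
    nlinarith
  have n3 : ‖(a : ℂ) / Real.pi * S‖ ≤ a / Real.pi * C₂ * ‖η‖ ^ (-(1 / 2) : ℝ) := by
    rw [norm_mul, norm_div, Complex.norm_real, Complex.norm_real, Real.norm_of_nonneg ha.le,
      Real.norm_of_nonneg hpi.le, mul_assoc]
    exact mul_le_mul_of_nonneg_left (h2 η (quadrant_subset_rightHalf hη) hη1) (by positivity)
  rw [e]
  refine (norm_add_le _ _).trans ?_
  rw [norm_mul, norm_mul _ (A * _), norm_mul A, Complex.norm_real, Real.norm_eq_abs, add_mul]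
  refine add_le_add ?_ ?_
  · rw [mul_assoc]
    exact mul_le_mul_of_nonneg_left n1 (abs_nonneg _)
  · rw [mul_assoc]
    refine mul_le_mul_of_nonneg_left ?_ (abs_nonneg _)
    rw [mul_assoc]
    exact mul_le_mul n2 n3 (norm_nonneg _) (by positivity)

/-- On the positive axis `D(iy) D(-iy) = 1 + a y + y²` exchanges `1 / D(iy)` for its continued form.
-/
theorem rotatedTransform_ofReal (ha : 0 < a) (T : ℝ) {y : ℝ} (hy : 0 < y) :
    rotatedTransform a T y = derivTransform a T (I * y) := by
  have h := factor_mul_neg ha hy.le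
  have hQ : (1 : ℂ) + a * y + y ^ 2 ≠ 0 :=
    quadratic_ne_zero ha (ofReal_mem_rightHalf hy.le)
  have h0 := factor_ne_zero (a := a) (I * y)
  have e : factor a (-I * y) * (1 + a * y + (y : ℂ) ^ 2)⁻¹ = (factor a (I * y))⁻¹ := by
    rw [mul_inv_eq_iff_eq_mul₀ hQ, eq_inv_mul_iff_mul_eq₀ h0, ← h, neg_mul]
  rw [rotatedTransform, derivTransform, stieltjes_I_mul ha hy, mul_assoc I, e]
  ring

theorem derivTransform_neg_I_mul (ha : 0 < a) (T : ℝ) {y : ℝ} (hy : 0 < y) :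
    derivTransform a T (I * (-y : ℝ)) = starRingEnd ℂ (rotatedTransform a T y) := by
  rw [rotatedTransform_ofReal ha T hy, ← derivTransform_conj T (I_mul_ofReal_mem_rightHalf y)]
  congr 1
  simp

theorem integral_eq_add_conj {f g : ℝ → ℂ} (hf : Integrable f)
    (h : ∀ y, 0 < y → f (-y) = starRingEnd ℂ (g y)) :
    ∫ y, f y = (∫ y in Ioi 0, f y) + starRingEnd ℂ (∫ y in Ioi 0, g y) := by
  rw [integral_eq_add_neg hf, ← integral_conj]
  congr 1
  exact setIntegral_congr_fun measurableSet_Ioi fun y hy => h y hy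

/-- `-iη + p` has positive real part throughout the first quadrant, so the ray `η > 0` turns onto `η
= i s`, the upper side of the cut. -/
theorem integral_rotatedTransform_mul (ha : 0 < a) (T : ℝ) {p : ℂ} (hp : 0 < p.re) :
    ∫ y in Ioi (0 : ℝ), rotatedTransform a T y * (I * y - p)⁻¹ =
      -I * stieltjes (fun s => rotatedTransform a T (I * s)) p := by
  have hinv : HoloOn (fun ζ : ℂ => (ζ + p)⁻¹) rightHalf :=
    HoloOn.of_differentiableAt fun z hz => DifferentiableAt.inv (by fun_prop)
      (add_ne_zero_of_re_pos hp hz)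
  have h := integral_ray_rotate ((holoOn_rotatedTransform ha T).mul hinv.comp_neg_I_mul)
    (((powerDecay_rotatedTransform ha T).mul (powerDecay_inv_add hp).comp_neg_I_mul).mono
      (by norm_num))
  have e1 : ∀ y : ℝ, (I * (y : ℂ) - p)⁻¹ = -(-I * y + p)⁻¹ := fun y => by
    rw [← inv_neg]
    congr 1
    ring
  simp_rw [e1, mul_neg]
  rw [integral_neg, h, stieltjes, neg_mul]
  congr 2
  refine integral_congr_ae (ae_of_all _ fun s => ?_)
  simp only
  congr 2
  linear_combination (-(s : ℂ)) * Complex.I_sq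

theorem integrable_stieltjes_rotated (ha : 0 < a) (T : ℝ) {p : ℂ} (hp : 0 < p.re) :
    IntegrableOn (fun s : ℝ => rotatedTransform a T (I * s) * ((s : ℂ) + p)⁻¹) (Ioi 0) := by
  have hinv : HoloOn (fun ζ : ℂ => (ζ + p)⁻¹) rightHalf :=
    HoloOn.of_differentiableAt fun z hz => DifferentiableAt.inv (by fun_prop)
      (add_ne_zero_of_re_pos hp hz)
  have h := integrableOn_I_mul_of_decay
    ((holoOn_rotatedTransform ha T).mul hinv.comp_neg_I_mul).cont
    (((powerDecay_rotatedTransform ha T).mul (powerDecay_inv_add hp).comp_neg_I_mul).mono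
      (by norm_num))
  refine h.congr_fun (fun s _ => ?_) measurableSet_Ioi
  simp only
  congr 2
  linear_combination (-(s : ℂ)) * Complex.I_sq

/-- In Cauchy's formula on the imaginary axis the upper half of the contour is turned onto the cut;
the lower half is its mirror image and carries the conjugate values. Only the difference, `2i Im`,
survives. -/
theorem derivTransform_eq_stieltjes (ha : 0 < a) (T : ℝ) {p : ℂ} (hp : 0 < p.re) :
    derivTransform a T p = -((Real.pi : ℂ)⁻¹ *
      stieltjes (fun s => ((rotatedTransform a T (I * s)).im : ℂ)) p) := by
  have hK := holoOn_derivTransform ha T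
  have hd := powerDecay_derivTransform ha T
  have h1 := integral_cauchy_of_re_pos hK hd hp
  have hpc : 0 < (starRingEnd ℂ p).re := by simpa using hp
  rw [integral_eq_add_conj (integrable_cauchy_kernel hK.cont hd hp.ne')
    (g := fun y => rotatedTransform a T y * (I * y - starRingEnd ℂ p)⁻¹)] at h1
  · have h2 : ∫ y in Ioi (0 : ℝ), derivTransform a T (I * y) * (I * y - p)⁻¹ =
        ∫ y in Ioi (0 : ℝ), rotatedTransform a T y * (I * y - p)⁻¹ :=
      setIntegral_congr_fun measurableSet_Ioi fun y hy => by
        rw [rotatedTransform_ofReal ha T hy]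
    rw [h2, integral_rotatedTransform_mul ha T hp, integral_rotatedTransform_mul ha T hpc, map_mul,
      map_neg, Complex.conj_I, neg_neg, ← stieltjes_conj, Complex.conj_conj] at h1
    have h3 : stieltjes (fun s => rotatedTransform a T (I * s)) p -
        stieltjes (fun s => starRingEnd ℂ (rotatedTransform a T (I * s))) p =
        2 * I * stieltjes (fun s => ((rotatedTransform a T (I * s)).im : ℂ)) p := by
      have hint := integrable_stieltjes_rotated ha T hp
      have hint' : IntegrableOn (fun s : ℝ => starRingEnd ℂ (rotatedTransform a T (I * s)) *
          ((s : ℂ) + p)⁻¹) (Ioi 0) := by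
        have := (integrable_stieltjes_rotated ha T hpc)
        have := (Complex.conjCLE : ℂ →L[ℝ] ℂ).integrable_comp this
        refine this.congr (ae_of_all _ fun s => ?_)
        simp
      unfold stieltjes
      rw [← integral_sub hint hint', ← integral_const_mul]
      congr 1
      ext s
      rw [← sub_mul, Complex.sub_conj]
      push_cast
      ring
    have hpi : (Real.pi : ℂ) ≠ 0 := by exact_mod_cast Real.pi_ne_zero
    have h4 : 2 * Real.pi * derivTransform a T p =
        -(2 * stieltjes (fun s => ((rotatedTransform a T (I * s)).im : ℂ)) p) := by
      linear_combination h1 + I * h3 +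
        2 * stieltjes (fun s => ((rotatedTransform a T (I * s)).im : ℂ)) p * Complex.I_sq
    field_simp
    linear_combination h4 / 2
  · intro y hy
    rw [derivTransform_neg_I_mul ha T hy, map_mul, map_inv₀]
    congr 2
    simp

theorem factor_ofReal_im {r : ℝ} (hr : 0 ≤ r) : (factor a r).im = 0 := by
  rw [← Complex.conj_eq_iff_im, ← factor_conj (ofReal_mem_rightHalf hr), Complex.conj_ofReal]

/-- A jump relation obtained from Cauchy's formula for `1 / D` at the real point `r`: the positive
half of the axis contributes `-I S(ir)`, the negative half its conjugate, so the total `2 Im S(ir)`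
equals `-2π / D(r)`. -/
theorem im_stieltjes_I_mul (ha : 0 < a) {r : ℝ} (hr : 0 < r) :
    (stieltjes (fun s => (factor a (I * s))⁻¹) (I * r)).im = -Real.pi * ((factor a r).re)⁻¹ := by
  have hE := holoOn_inv_factor ha
  have hd := (powerDecay_inv_factor ha).mono (β := 1 / 2) (by norm_num)
  have hr' : 0 < ((r : ℂ)).re := by simpa using hr
  have h1 := integral_cauchy_of_re_pos hE hd hr'
  have hs : ∫ y in Ioi (0 : ℝ), (factor a (I * y))⁻¹ * (I * y - r)⁻¹ =
      -I * stieltjes (fun s => (factor a (I * s))⁻¹) (I * r) := by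
    rw [stieltjes, ← integral_const_mul]
    refine integral_congr_ae (ae_of_all _ fun s => ?_)
    simp only
    have : I * (s : ℂ) - r = I * (s + I * r) := by linear_combination (-(r : ℂ)) * Complex.I_sq
    rw [this, mul_inv, Complex.inv_I]
    ring
  rw [integral_eq_add_conj (integrable_cauchy_kernel hE.cont hd hr'.ne')
    (g := fun y => (factor a (I * y))⁻¹ * (I * y - r)⁻¹), hs] at h1
  · have h2 := congrArg Complex.re h1
    have hf : factor a r = ((factor a r).re : ℂ) :=
      Complex.ext (by simp) (by simp [factor_ofReal_im hr.le])
    rw [hf, ← Complex.ofReal_inv] at h2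
    simp at h2
    linarith
  · intro y hy
    have : I * ((-y : ℝ) : ℂ) = starRingEnd ℂ (I * y) := by simp
    rw [this, factor_conj (I_mul_ofReal_mem_rightHalf y)]
    simp only [map_mul, map_inv₀, map_sub, Complex.conj_ofReal]

/-- The Carleman relation on the cut. -/
theorem one_sub_sq_mul_im (ha : 0 < a) (T : ℝ) {r : ℝ} (hr : 0 < r) :
    (1 - r ^ 2) * (rotatedTransform a T (I * r)).im =
      -(a * r * (rotatedTransform a T (I * r)).re) := by
  have hQ : (1 : ℂ) + a * (I * r) + (I * r) ^ 2 ≠ 0 :=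
    quadratic_ne_zero ha (I_mul_ofReal_mem_rightHalf r)
  have hS := im_stieltjes_I_mul ha hr
  set S := stieltjes (fun s => (factor a (I * s))⁻¹) (I * r) with hSdef
  have hf : factor a r = ((factor a r).re : ℂ) :=
    Complex.ext (by simp) (by simp [factor_ofReal_im hr.le])
  have hf0 : (factor a r).re ≠ 0 := fun h => by
    rw [h] at hf
    exact factor_ne_zero (a := a) (r : ℂ) (by simpa using hf)
  set d := (factor a r).re with hd
  have hII : -I * (I * (r : ℂ)) = r := by linear_combination (-(r : ℂ)) * Complex.I_sq
  -- With the quadratic multiplied out, everything except `S` on the right is real, so only `Im S`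
  -- enters the imaginary part.
  have key : (1 + a * (I * r) + (I * r) ^ 2) * (rotatedTransform a T (I * r) + T) =
      -(T * r * d * (1 + a / Real.pi * S)) := by
    rw [rotatedTransform, hII, hf, ← hSdef]
    have : (1 + (a : ℂ) * (I * r) + (I * r) ^ 2) * (-(T : ℂ) + T * (I * d *
        (1 + a * (I * r) + (I * r) ^ 2)⁻¹) * (I * r + a / Real.pi * (I * r * S)) + T) =
        ((1 + (a : ℂ) * (I * r) + (I * r) ^ 2) * (1 + a * (I * r) + (I * r) ^ 2)⁻¹) *
          (T * (I * d) * (I * r + a / Real.pi * (I * r * S))) := by ring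
    rw [this, mul_inv_cancel₀ hQ]
    linear_combination (T * d * (r + a / Real.pi * (r * S))) * Complex.I_sq
  have him := congrArg Complex.im key
  have hpi := Real.pi_ne_zero
  have e1 : (1 : ℂ) + a * (I * r) + (I * r) ^ 2 = ⟨1 - r ^ 2, a * r⟩ := by
    apply Complex.ext <;> simp [pow_two]
    ring
  have e2 : -((T : ℂ) * r * d * (1 + a / Real.pi * S)) =
      ((-(T * r * d) : ℝ) : ℂ) * (1 + ((a / Real.pi : ℝ) : ℂ) * S) := by push_cast; ring
  rw [e1, e2, Complex.im_ofReal_mul, Complex.add_im, Complex.im_ofReal_mul, hS, Complex.mul_im,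
    Complex.one_im, Complex.add_im, Complex.add_re, Complex.ofReal_re, Complex.ofReal_im] at him
  -- The factor `a / π` in `K` is the one for which this term equals `a r T` and cancels the
  -- contribution of the added constant `T` on the left.
  have h3 : -(T * r * d) * (0 + a / Real.pi * (-Real.pi * d⁻¹)) = T * r * a := by
    field_simp
    ring
  rw [h3] at him
  simp only at him
  linarith

/-- Dividing Carleman's relation by `1 - r²` gains a factor `r` near 0 and `1 / r` at infinity over
the general decay of order 1/2. Near `r = 1`, where the division fails, the general bound is enough.
-/
theorem abs_im_rotatedTransform_le (ha : 0 < a) (T : ℝ) : ∃ C, 0 ≤ C ∧ ∀ r : ℝ, 0 < r →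
    |(rotatedTransform a T (I * r)).im| ≤ C * r * (1 + r) ^ (-(5 / 2) : ℝ) := by
  obtain ⟨M, hM, h⟩ := powerDecay_rotatedTransform ha T
  refine ⟨(3 * a + 18) * M, by positivity, fun r hr => ?_⟩
  have hk := h (I * r) ⟨by simp, by simpa using hr.le⟩
  have hn : ‖I * (r : ℂ)‖ = r := by simp [abs_of_pos hr]
  rw [hn] at hk
  have hre := (Complex.abs_re_le_norm (rotatedTransform a T (I * r))).trans hk
  have him := (Complex.abs_im_le_norm (rotatedTransform a T (I * r))).trans hk
  have hrel := congrArg abs (one_sub_sq_mul_im ha T hr)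
  rw [abs_mul, abs_neg, abs_mul, abs_of_pos (mul_pos ha hr)] at hrel
  set B := M * (1 + r) ^ (-(1 / 2) : ℝ) with hB
  have hB0 : 0 ≤ B := by positivity
  set m := |(rotatedTransform a T (I * r)).im| with hm
  have hm0 : 0 ≤ m := abs_nonneg _
  have h1 : |1 - r ^ 2| * m ≤ a * r * B := hrel.trans_le (mul_le_mul_of_nonneg_left hre (by positivity))
  have h2 : m * (1 + r) ^ 2 ≤ (3 * a + 18) * r * B := by
    have harB : 0 ≤ a * r * B := by positivity
    have hrB : 0 ≤ r * B := by positivity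
    rcases le_total r (1 / 2) with h' | h'
    · rw [abs_of_nonneg (by nlinarith)] at h1
      have : (1 + r) ^ 2 ≤ 3 * (1 - r ^ 2) := by nlinarith
      nlinarith [mul_le_mul_of_nonneg_left this hm0]
    · rcases le_total r 2 with h'' | h''
      · have : (1 + r) ^ 2 ≤ 18 * r := by nlinarith
        nlinarith [mul_le_mul him this (by positivity) hB0]
      · rw [abs_of_nonpos (by nlinarith)] at h1
        have : (1 + r) ^ 2 ≤ 3 * (r ^ 2 - 1) := by nlinarith
        nlinarith [mul_le_mul_of_nonneg_left this hm0]
  have h3 : (1 + r) ^ (-(5 / 2) : ℝ) = (1 + r) ^ (-(1 / 2) : ℝ) * ((1 + r) ^ 2)⁻¹ := by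
    rw [← Real.rpow_natCast, ← Real.rpow_neg (by positivity), ← Real.rpow_add (by positivity)]
    norm_num
  rw [h3]
  have h4 : (3 * a + 18) * M * r * ((1 + r) ^ (-(1 / 2) : ℝ) * ((1 + r) ^ 2)⁻¹) =
      (3 * a + 18) * r * B * ((1 + r) ^ 2)⁻¹ := by rw [hB]; ring
  rw [h4, ← div_eq_mul_inv, le_div_iff₀ (by positivity)]
  exact h2

end RotatedTransform

/-! ### The density `w` and the Stieltjes representation of `K` -/

section Density

variable {a : ℝ}

theorem abs_density_le (ha : 0 < a) (T : ℝ) : ∃ C, 0 ≤ C ∧ ∀ r : ℝ, 0 < r →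
    |density a T r| ≤ C * (1 + r) ^ (-(5 / 2) : ℝ) := by
  obtain ⟨C, hC, h⟩ := abs_im_rotatedTransform_le ha T
  have hpi := Real.pi_pos
  refine ⟨C * Real.pi⁻¹, by positivity, fun r hr => ?_⟩
  rw [density, abs_div, abs_of_pos (mul_pos hpi hr), div_le_iff₀ (mul_pos hpi hr)]
  refine (h r hr).trans_eq ?_
  field_simp

theorem im_rotatedTransform (T : ℝ) {r : ℝ} (hr : 0 < r) :
    (rotatedTransform a T (I * r)).im = Real.pi * (r * density a T r) := by
  have hpi := Real.pi_pos
  rw [density]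
  field_simp

theorem continuousOn_density (ha : 0 < a) (T : ℝ) : ContinuousOn (density a T) (Ioi 0) := by
  have h := (continuousOn_comp_I_mul (holoOn_rotatedTransform ha T).cont).mono Ioi_subset_Ici_self
  exact (Complex.continuous_im.comp_continuousOn h).div (by fun_prop)
    fun r hr => (mul_pos Real.pi_pos hr).ne'

/-- The decay `(1 + r) ^ (-5/2)` leaves room for powers below 3/2: the power 1 makes `φ'` bounded
and the powers above 1 make it Hölder continuous. -/
theorem integrableOn_rpow_mul_density (ha : 0 < a) (T : ℝ) {β : ℝ} (hβ : 0 ≤ β) (hβ' : β < 3 / 2) :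
    IntegrableOn (fun r => r ^ β * density a T r) (Ioi 0) := by
  obtain ⟨C, hC, h⟩ := abs_density_le ha T
  have hint : Integrable fun x : ℝ => (1 + ‖x‖) ^ (-(5 / 2 - β) : ℝ) :=
    integrable_one_add_norm (by simp; linarith)
  refine Integrable.mono' (hint.const_mul C).integrableOn (ContinuousOn.aestronglyMeasurable
    ((ContinuousOn.rpow_const (by fun_prop) fun _ _ => Or.inr hβ).mul (continuousOn_density ha T))
    measurableSet_Ioi) ?_
  filter_upwards [ae_restrict_mem measurableSet_Ioi] with r hr
  have hr' : 0 < r := hr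
  have h1 : r ^ β ≤ (1 + r) ^ β := Real.rpow_le_rpow hr'.le (by linarith) hβ
  have h2 : (1 + r) ^ (-(5 / 2 - β) : ℝ) = (1 + r) ^ β * (1 + r) ^ (-(5 / 2) : ℝ) := by
    rw [← Real.rpow_add (by positivity)]
    congr 1
    ring
  rw [norm_mul, Real.norm_of_nonneg (by positivity), Real.norm_eq_abs, Real.norm_of_nonneg hr'.le, h2]
  calc _ ≤ (1 + r) ^ β * (C * (1 + r) ^ (-(5 / 2) : ℝ)) :=
        mul_le_mul h1 (h r hr') (abs_nonneg _) (by positivity)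
    _ = _ := by ring

theorem integrableOn_density (ha : 0 < a) (T : ℝ) : IntegrableOn (density a T) (Ioi 0) := by
  simpa using integrableOn_rpow_mul_density ha T (β := 0) le_rfl (by norm_num)

theorem integrableOn_mul_density (ha : 0 < a) (T : ℝ) :
    IntegrableOn (fun r => r * density a T r) (Ioi 0) := by
  simpa using integrableOn_rpow_mul_density ha T (β := 1) (by norm_num) (by norm_num)

theorem closure_re_pos : rightHalf ⊆ closure {p : ℂ | 0 < p.re} := by
  rw [Complex.closure_setOfPred_lt_re]
  exact fun p hp => hp

theorem norm_ofReal_mul_inv_le {r : ℝ} (hr : 0 < r) {p : ℂ} (hp : p ∈ rightHalf) (c : ℝ) :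
    ‖((r * c : ℝ) : ℂ) * ((r : ℂ) + p)⁻¹‖ ≤ |c| := by
  have h1 := le_norm_add hr.le hp
  rw [norm_mul, Complex.norm_real, norm_inv, norm_mul, Real.norm_of_nonneg hr.le, Real.norm_eq_abs,
    ← div_eq_mul_inv, div_le_iff₀ (hr.trans_le h1)]
  nlinarith [abs_nonneg c]

theorem continuousOn_stieltjes_density (ha : 0 < a) (T : ℝ) :
    ContinuousOn (stieltjes fun r => ((r * density a T r : ℝ) : ℂ)) rightHalf := by
  intro p₀ hp₀
  have hm : ContinuousOn (fun r : ℝ => ((r * density a T r : ℝ) : ℂ)) (Ioi 0) :=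
    Complex.continuous_ofReal.comp_continuousOn (continuousOn_id.mul (continuousOn_density ha T))
  refine continuousWithinAt_of_dominated (bound := fun r => |density a T r|) ?_ ?_
    (integrableOn_density ha T).abs ?_
  · filter_upwards [self_mem_nhdsWithin] with p hp
    exact ContinuousOn.aestronglyMeasurable (hm.mul (ContinuousOn.inv₀ (by fun_prop)
      fun s hs => add_ne_zero_of_pos hs hp)) measurableSet_Ioi
  · filter_upwards [self_mem_nhdsWithin] with p hp
    filter_upwards [ae_restrict_mem measurableSet_Ioi] with r hr
    exact norm_ofReal_mul_inv_le hr hp _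
  · filter_upwards [ae_restrict_mem measurableSet_Ioi] with r hr
    exact continuousWithinAt_const.mul
      (ContinuousWithinAt.inv₀ (by fun_prop) (add_ne_zero_of_pos hr hp₀))

/-- Since `|r / (r + p)| ≤ 1` and `w` is integrable, both sides are continuous on the closed
half-plane, so the representation persists on the imaginary axis and at `p = 0`. -/
theorem derivTransform_eq (ha : 0 < a) (T : ℝ) {p : ℂ} (hp : p ∈ rightHalf) :
    derivTransform a T p = -stieltjes (fun r => ((r * density a T r : ℝ) : ℂ)) p := by
  refine Set.EqOn.of_subset_closure (s := {p : ℂ | 0 < p.re}) (t := rightHalf)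
    (g := fun p => -stieltjes (fun r => ((r * density a T r : ℝ) : ℂ)) p) (fun p hp => ?_)
    (holoOn_derivTransform ha T).cont (continuousOn_stieltjes_density ha T).neg
    (fun p hp => show (0 : ℝ) ≤ p.re from le_of_lt hp) closure_re_pos hp
  rw [derivTransform_eq_stieltjes ha T hp]
  unfold stieltjes
  rw [← integral_const_mul]
  congr 1
  refine setIntegral_congr_fun measurableSet_Ioi fun r hr => ?_
  simp only
  rw [im_rotatedTransform T hr]
  have hpi : (Real.pi : ℂ) ≠ 0 := by exact_mod_cast Real.pi_ne_zero
  push_cast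
  field_simp

/-- The representation at `p = 0`, where `K(0) = -T`. This is the condition `φ(0) = T`. -/
theorem integral_density (ha : 0 < a) (T : ℝ) : ∫ r in Ioi (0 : ℝ), density a T r = T := by
  have h := derivTransform_eq ha T (p := 0) (by simp [rightHalf])
  have h1 : derivTransform a T 0 = -(T : ℂ) := by simp [derivTransform]
  have h2 : stieltjes (fun r => ((r * density a T r : ℝ) : ℂ)) 0 =
      ((∫ r in Ioi (0 : ℝ), density a T r : ℝ) : ℂ) := by
    rw [stieltjes, ← integral_complex_ofReal]
    refine setIntegral_congr_fun measurableSet_Ioi fun r hr => ?_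
    have hr' : (r : ℂ) ≠ 0 := by exact_mod_cast (ne_of_gt hr)
    push_cast
    rw [add_zero]
    field_simp
  rw [h1, h2] at h
  exact_mod_cast (neg_inj.1 h).symm

/-- Integrability of `r w(r)` upgrades the earlier decay of order 1/2 to order 1, which covers
`O(|z|^{-(1-ε)})` for every `ε` at once. -/
theorem norm_derivTransform_le (ha : 0 < a) (T : ℝ) : ∃ C, 0 ≤ C ∧ ∀ p ∈ rightHalf, p ≠ 0 →
    ‖derivTransform a T p‖ ≤ C * ‖p‖⁻¹ := by
  refine ⟨∫ r in Ioi (0 : ℝ), |r * density a T r|, integral_nonneg fun r => abs_nonneg _,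
    fun p hp hp0 => ?_⟩
  have hpos : 0 < ‖p‖ := norm_pos_iff.2 hp0
  rw [derivTransform_eq ha T hp, norm_neg, ← integral_mul_const]
  refine norm_integral_le_of_norm_le ((integrableOn_mul_density ha T).abs.mul_const _) ?_
  filter_upwards [ae_restrict_mem measurableSet_Ioi] with r hr
  rw [norm_mul, Complex.norm_real, norm_inv, Real.norm_eq_abs]
  refine mul_le_mul_of_nonneg_left ?_ (abs_nonneg _)
  exact inv_anti₀ hpos (norm_le_norm_add (le_of_lt hr) hp)

end Density

/-! ### Laplace integrals: smoothness, Hölder bounds, Fubini -/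

/-- The Laplace transform `x ↦ ∫₀^∞ v(r) e^{-rx} dr`. -/
def laplace (v : ℝ → ℝ) (x : ℝ) : ℝ := ∫ r in Ioi (0 : ℝ), v r * Real.exp (-(r * x))

section Laplace

variable {v : ℝ → ℝ}

theorem exp_neg_mul_le_one {r x : ℝ} (hr : 0 ≤ r) (hx : 0 ≤ x) : Real.exp (-(r * x)) ≤ 1 :=
  Real.exp_le_one_iff.2 (neg_nonpos.2 (mul_nonneg hr hx))

theorem aestronglyMeasurable_exp_neg_mul (x : ℝ) (μ : Measure ℝ) :
    AEStronglyMeasurable (fun r : ℝ => Real.exp (-(r * x))) μ :=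
  (by fun_prop : Continuous fun r : ℝ => Real.exp (-(r * x))).aestronglyMeasurable

theorem integrableOn_mul_exp (hv : IntegrableOn v (Ioi 0)) {x : ℝ} (hx : 0 ≤ x) :
    IntegrableOn (fun r => v r * Real.exp (-(r * x))) (Ioi 0) := by
  refine Integrable.mul_bdd (c := 1) hv (aestronglyMeasurable_exp_neg_mul x _)
    ((ae_restrict_mem measurableSet_Ioi).mono fun r hr => ?_)
  rw [Real.norm_of_nonneg (Real.exp_pos _).le]
  exact exp_neg_mul_le_one (le_of_lt hr) hx

theorem mul_exp_neg_mul_le {r x : ℝ} (hx : 0 < x) : r * Real.exp (-(r * x)) ≤ x⁻¹ := by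
  have h := Real.add_one_le_exp (r * x)
  rw [Real.exp_neg, ← div_eq_mul_inv, div_le_iff₀ (Real.exp_pos _), inv_mul_eq_div, le_div_iff₀ hx]
  linarith

theorem hasDerivAt_laplace (hv : IntegrableOn v (Ioi 0)) {x : ℝ} (hx : 0 < x) :
    HasDerivAt (laplace v) (-laplace (fun r => r * v r) x) x := by
  have hm := hv.aestronglyMeasurable
  have h := (hasDerivAt_integral_of_dominated_loc_of_deriv_le (μ := volume.restrict (Ioi (0 : ℝ)))
    (F := fun x r => v r * Real.exp (-(r * x)))
    (F' := fun x r => -(r * v r * Real.exp (-(r * x)))) (s := Ioi (x / 2)) (x₀ := x)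
    (bound := fun r => |v r| * (x / 2)⁻¹) (Ioi_mem_nhds (by linarith))
    (Eventually.of_forall fun y => hm.mul (aestronglyMeasurable_exp_neg_mul y _))
    (integrableOn_mul_exp hv hx.le)
    ((continuous_id.aestronglyMeasurable.mul hm).mul (aestronglyMeasurable_exp_neg_mul x _)).neg
    ((ae_restrict_mem measurableSet_Ioi).mono fun r hr y hy => ?_) (hv.abs.mul_const _)
    (ae_of_all _ fun r y _ => ?_)).2
  · rwa [integral_neg] at h
  · have hr' : 0 < r := hr
    have hy' : x / 2 < y := hy
    have h1 : r * Real.exp (-(r * y)) ≤ (x / 2)⁻¹ := by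
      refine le_trans ?_ (mul_exp_neg_mul_le (r := r) (half_pos hx))
      gcongr
    rw [norm_neg, norm_mul, norm_mul, Real.norm_of_nonneg (Real.exp_pos _).le,
      Real.norm_of_nonneg hr'.le, Real.norm_eq_abs]
    calc _ = |v r| * (r * Real.exp (-(r * y))) := by ring
      _ ≤ _ := by gcongr
  · have h1 : HasDerivAt (fun y : ℝ => -(r * y)) (-r) y := by
      simpa using hasDerivAt_mul_const (-r) (x := y) |>.congr_of_eventuallyEq
        (Eventually.of_forall fun y => show -(r * y) = y * -r by ring)
    exact (h1.exp.const_mul (v r)).congr_deriv (by ring)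

/-- `1 - e^{-t} ≤ min (t, 1) ≤ t ^ μ` for `0 < μ ≤ 1`, with `t = r (y - x)`. -/
theorem abs_exp_sub_exp_le {μ r a x y : ℝ} (hμ : 0 < μ) (hμ' : μ ≤ 1) (hr : 0 < r) (hx : a ≤ x)
    (hxy : x ≤ y) : |Real.exp (-(r * x)) - Real.exp (-(r * y))| ≤
      Real.exp (-(r * a)) * (r ^ μ * (y - x) ^ μ) := by
  have hd : 0 ≤ r * (y - x) := mul_nonneg hr.le (by linarith)
  have h1 : Real.exp (-(r * x)) - Real.exp (-(r * y)) =
      Real.exp (-(r * x)) * (1 - Real.exp (-(r * (y - x)))) := by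
    rw [mul_sub, mul_one, ← Real.exp_add]
    ring_nf
  have h2 : Real.exp (-(r * (y - x))) ≤ 1 := Real.exp_le_one_iff.2 (by linarith)
  have h3 : 1 - Real.exp (-(r * (y - x))) ≤ (r * (y - x)) ^ μ := by
    rcases le_total (r * (y - x)) 1 with h | h
    · calc _ ≤ r * (y - x) := by linarith [Real.add_one_le_exp (-(r * (y - x)))]
        _ = (r * (y - x)) ^ (1 : ℝ) := (Real.rpow_one _).symm
        _ ≤ _ := Real.rpow_le_rpow_of_exponent_ge' hd h hμ.le hμ'
    · exact le_trans (by linarith [Real.exp_pos (-(r * (y - x)))]) (Real.one_le_rpow h hμ.le)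
  rw [h1, abs_mul, abs_of_pos (Real.exp_pos _), abs_of_nonneg (by linarith),
    ← Real.mul_rpow hr.le (by linarith)]
  gcongr

theorem abs_laplace_sub_le {μ a : ℝ} (hμ : 0 < μ) (hμ' : μ ≤ 1)
    (h0 : ∀ x, a ≤ x → IntegrableOn (fun r => v r * Real.exp (-(r * x))) (Ioi 0))
    (h1 : IntegrableOn (fun r => r ^ μ * (v r * Real.exp (-(r * a)))) (Ioi 0)) :
    ∃ C, 0 ≤ C ∧ ∀ x ∈ Ici a, ∀ y ∈ Ici a,
      |laplace v x - laplace v y| ≤ C * |x - y| ^ μ := by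
  refine ⟨∫ r in Ioi (0 : ℝ), |r ^ μ * (v r * Real.exp (-(r * a)))|,
    integral_nonneg fun r => abs_nonneg _, ?_⟩
  have key : ∀ x, a ≤ x → ∀ y, x ≤ y → |laplace v x - laplace v y| ≤
      (∫ r in Ioi (0 : ℝ), |r ^ μ * (v r * Real.exp (-(r * a)))|) * |x - y| ^ μ := by
    intro x hx y hy
    rw [laplace, laplace, ← integral_sub (h0 x hx) (h0 y (hx.trans hy)), ← integral_mul_const, ← Real.norm_eq_abs]
    refine norm_integral_le_of_norm_le (h1.abs.mul_const _)
      ((ae_restrict_mem measurableSet_Ioi).mono fun r hr => ?_)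
    have hr' : 0 < r := hr
    have h2 := abs_exp_sub_exp_le hμ hμ' hr' hx hy
    rw [← mul_sub, norm_mul, Real.norm_eq_abs, Real.norm_eq_abs, abs_mul, abs_mul,
      abs_of_pos (Real.exp_pos _), abs_of_nonneg (Real.rpow_nonneg hr'.le _),
      abs_sub_comm x y, abs_of_nonneg (sub_nonneg.2 hy)]
    calc _ ≤ |v r| * (Real.exp (-(r * a)) * (r ^ μ * (y - x) ^ μ)) := by gcongr
      _ = _ := by ring
  intro x hx y hy
  rcases le_total x y with h | h
  · exact key x hx y h
  · rw [abs_sub_comm, abs_sub_comm x y]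
    exact key y hy x h

theorem holderClassOn_of_abs_sub_le {f : ℝ → ℝ} {s : Set ℝ} {C μ : ℝ} (hC : 0 ≤ C) (hμ : 0 < μ)
    (hμ' : μ ≤ 1) (h : ∀ x ∈ s, ∀ y ∈ s, |f x - f y| ≤ C * |x - y| ^ μ) : HolderClassOn f s := by
  refine ⟨C.toNNReal, μ.toNNReal, by simpa, by simpa, fun x hx y hy => ?_⟩
  have h1 := h x hx y hy
  rw [edist_dist, edist_dist, Real.dist_eq, Real.dist_eq]
  rw [Real.coe_toNNReal μ hμ.le, ENNReal.ofReal_rpow_of_nonneg (abs_nonneg _) hμ.le]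
  calc ENNReal.ofReal |f x - f y| ≤ ENNReal.ofReal (C * |x - y| ^ μ) :=
        ENNReal.ofReal_le_ofReal h1
    _ = _ := by
        rw [ENNReal.ofReal_mul hC]
        rfl

theorem holderClassOn_const_mul_laplace {μ a κ : ℝ} (c : ℝ) (hκ : 0 < κ) (hμ : 0 < μ) (hμ' : μ ≤ 1)
    (h0 : ∀ x, a / κ ≤ x → IntegrableOn (fun r => v r * Real.exp (-(r * x))) (Ioi 0))
    (h1 : IntegrableOn (fun r => r ^ μ * (v r * Real.exp (-(r * (a / κ))))) (Ioi 0)) :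
    HolderClassOn (fun x => c * laplace v (x / κ)) (Ici a) := by
  obtain ⟨C, hC, h⟩ := abs_laplace_sub_le hμ hμ' h0 h1
  refine holderClassOn_of_abs_sub_le (C := |c| * C * (κ⁻¹) ^ μ) (by positivity) hμ hμ'
    fun x hx y hy => ?_
  have h2 := h (x / κ) (div_le_div_of_nonneg_right hx hκ.le) (y / κ)
    (div_le_div_of_nonneg_right hy hκ.le)
  rw [← sub_div, div_eq_inv_mul (x - y), abs_mul, abs_of_pos (inv_pos.2 hκ),
    Real.mul_rpow (by positivity) (abs_nonneg _)] at h2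
  rw [← mul_sub, abs_mul]
  calc _ ≤ |c| * (C * (κ⁻¹ ^ μ * |x - y| ^ μ)) := by gcongr
    _ = _ := by ring

theorem HolderClassOn.continuousOn {f : ℝ → ℝ} {s : Set ℝ} (h : HolderClassOn f s) :
    ContinuousOn f s := by
  obtain ⟨C, μ, hμ, -, h⟩ := h
  exact h.continuousOn hμ

theorem tendsto_laplace_atTop (hv : IntegrableOn v (Ioi 0)) : Tendsto (laplace v) atTop (𝓝 0) := by
  have h := tendsto_integral_filter_of_dominated_convergence (μ := volume.restrict (Ioi (0 : ℝ)))
    (F := fun x r => v r * Real.exp (-(r * x))) (f := fun _ => 0) (l := atTop) (fun r => |v r|)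
    (Eventually.of_forall fun y => hv.aestronglyMeasurable.mul
      (aestronglyMeasurable_exp_neg_mul y _)) ?_ hv.abs
    ((ae_restrict_mem measurableSet_Ioi).mono fun r hr => ?_)
  · rw [integral_zero] at h
    exact h
  · filter_upwards [eventually_ge_atTop 0] with x hx
    refine (ae_restrict_mem measurableSet_Ioi).mono fun r hr => ?_
    rw [norm_mul, Real.norm_of_nonneg (Real.exp_pos _).le]
    exact mul_le_of_le_one_right (norm_nonneg _) (exp_neg_mul_le_one (le_of_lt hr) hx)
  · have h1 : Tendsto (fun x : ℝ => -(r * x)) atTop atBot :=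
      tendsto_neg_atTop_atBot.comp (tendsto_id.const_mul_atTop hr)
    simpa using (Real.tendsto_exp_atBot.comp h1).const_mul (v r)

/-- `∫ e^{-rt} dt = 1 / r` absorbs the factor `r`, leaving `|v|`. This licenses the interchanges of
integrals below. -/
theorem integrable_prod_mul_exp (hv : IntegrableOn v (Ioi 0))
    (hv' : IntegrableOn (fun r => r * v r) (Ioi 0)) :
    Integrable (fun z : ℝ × ℝ => z.2 * v z.2 * Real.exp (-(z.2 * z.1)))
      ((volume.restrict (Ioi 0)).prod (volume.restrict (Ioi 0))) := by
  have hm : AEStronglyMeasurable (fun z : ℝ × ℝ => z.2 * v z.2 * Real.exp (-(z.2 * z.1)))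
      ((volume.restrict (Ioi 0)).prod (volume.restrict (Ioi 0))) :=
    hv'.aestronglyMeasurable.comp_snd.mul
      (by fun_prop : Continuous fun z : ℝ × ℝ => Real.exp (-(z.2 * z.1))).aestronglyMeasurable
  rw [integrable_prod_iff' hm]
  constructor
  · refine (ae_restrict_mem measurableSet_Ioi).mono fun r hr => ?_
    have h := (integrableOn_exp_mul_Ioi (neg_lt_zero.2 hr) 0).const_mul (r * v r)
    simpa only [neg_mul] using h
  · refine Integrable.congr hv.abs ((ae_restrict_mem measurableSet_Ioi).mono fun r hr => ?_)
    have hr' : 0 < r := hr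
    have h := integral_exp_mul_Ioi (neg_lt_zero.2 hr') 0
    simp only [norm_mul, Real.norm_of_nonneg (Real.exp_pos _).le, Real.norm_of_nonneg hr'.le,
      integral_const_mul]
    simp only [neg_mul, mul_zero, Real.exp_zero] at h
    rw [h, Real.norm_eq_abs]
    field_simp

theorem integrableOn_laplace (hv : IntegrableOn v (Ioi 0))
    (hv' : IntegrableOn (fun r => r * v r) (Ioi 0)) :
    IntegrableOn (laplace fun r => r * v r) (Ioi 0) :=
  (integrable_prod_mul_exp hv hv').integral_prod_left

/-- Fubini. The case `Re p = 0` matters: it identifies `K` on the imaginary axis with a Fourier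
integral. -/
theorem integral_laplace_mul_exp (hv : IntegrableOn v (Ioi 0))
    (hv' : IntegrableOn (fun r => r * v r) (Ioi 0)) {p : ℂ} (hp : 0 ≤ p.re) :
    ∫ t in Ioi (0 : ℝ), (laplace (fun r => r * v r) t : ℂ) * Complex.exp (-(p * t)) =
      stieltjes (fun r => ((r * v r : ℝ) : ℂ)) p := by
  have hint : Integrable (Function.uncurry fun t r : ℝ =>
      ((r * v r * Real.exp (-(r * t)) : ℝ) : ℂ) * Complex.exp (-(p * t)))
      ((volume.restrict (Ioi 0)).prod (volume.restrict (Ioi 0))) := by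
    refine Integrable.mul_bdd (c := 1) (integrable_prod_mul_exp hv hv').ofReal
      (by fun_prop : Continuous fun z : ℝ × ℝ => Complex.exp (-(p * z.1))).aestronglyMeasurable ?_
    rw [Measure.prod_restrict]
    refine (ae_restrict_mem (measurableSet_Ioi.prod measurableSet_Ioi)).mono fun z hz => ?_
    rw [Complex.norm_exp]
    refine Real.exp_le_one_iff.2 ?_
    simpa using mul_nonneg hp (le_of_lt hz.1)
  have h1 : ∀ t : ℝ, (laplace (fun r => r * v r) t : ℂ) * Complex.exp (-(p * t)) =
      ∫ r in Ioi (0 : ℝ), ((r * v r * Real.exp (-(r * t)) : ℝ) : ℂ) * Complex.exp (-(p * t)) := by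
    intro t
    rw [integral_mul_const, laplace, ← integral_complex_ofReal]
  simp_rw [h1]
  rw [integral_integral_swap hint, stieltjes]
  refine setIntegral_congr_fun measurableSet_Ioi fun r hr => ?_
  have hr' : 0 < r := hr
  have hre : (-((r : ℂ) + p)).re < 0 := by simp; linarith
  have h2 : ∀ t : ℝ, ((r * v r * Real.exp (-(r * t)) : ℝ) : ℂ) * Complex.exp (-(p * t)) =
      ((r * v r : ℝ) : ℂ) * Complex.exp (-((r : ℂ) + p) * t) := by
    intro t
    push_cast
    rw [mul_assoc, ← Complex.exp_add]
    ring_nf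
  simp_rw [h2]
  rw [integral_const_mul, integral_exp_mul_complex_Ioi hre]
  rw [Complex.ofReal_zero, mul_zero, Complex.exp_zero, neg_div_neg_eq, one_div]

end Laplace

/-! ### Principal values and odd regularizations of `1 / u` -/

section PrincipalValue

variable {f : ℝ → ℝ} {x : ℝ}

/-- An odd bounded measurable function `k` with `|u k(u)| ≤ 1`: a regularization of `u ↦ 1 / u`. -/
structure IsCauchyRegularization (k : ℝ → ℝ) : Prop where
  measurable : Measurable k
  odd : ∀ u, k (-u) = -k u
  bounded : ∃ B, ∀ u, |k u| ≤ B
  abs_mul_le : ∀ u, |u * k u| ≤ 1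

theorem IsCauchyRegularization.integrableOn_mul {k : ℝ → ℝ} (hk : IsCauchyRegularization k)
    (hf : IntegrableOn f (Ioi 0)) (x : ℝ) : IntegrableOn (fun t => f t * k (t - x)) (Ioi 0) := by
  obtain ⟨B, hB⟩ := hk.bounded
  exact Integrable.mul_bdd (c := B) hf
    (hk.measurable.comp (measurable_id.sub_const x)).aestronglyMeasurable
    (ae_of_all _ fun t => hB _)

/-- `δ ≤ x` keeps the ball inside the half-line, so an odd function is integrated over a symmetric
interval. -/
theorem IsCauchyRegularization.integral_indicator_eq_zero {k : ℝ → ℝ}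
    (hk : IsCauchyRegularization k) {δ : ℝ} (hδ : δ ≤ x) :
    ∫ t in Ioi (0 : ℝ), (Metric.ball x δ).indicator (fun t => k (t - x)) t = 0 := by
  have hsub : Metric.ball x δ ⊆ Ioi 0 := fun t ht => by
    rw [Metric.mem_ball, Real.dist_eq, abs_lt] at ht
    exact mem_Ioi.2 (by linarith)
  rw [setIntegral_indicator measurableSet_ball, inter_eq_right.2 hsub,
    ← integral_indicator measurableSet_ball]
  set g : ℝ → ℝ := (Metric.ball 0 δ).indicator k with hg
  have h1 : ∀ t, (Metric.ball x δ).indicator (fun t => k (t - x)) t = g (t - x) := fun t => by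
    simp only [hg, indicator, Metric.mem_ball, Real.dist_eq, sub_zero]
  have h2 : ∀ u, g (-u) = -g u := fun u => by
    simp only [hg, indicator, Metric.mem_ball, Real.dist_eq, sub_zero, abs_neg, hk.odd]
    split_ifs <;> simp
  simp_rw [h1]
  rw [integral_sub_right_eq_self g x]
  have h3 := integral_neg_eq_self g volume
  simp_rw [h2] at h3
  rw [integral_neg] at h3
  linarith

/-- The principal value integrand `f(t) / (t - x)` with its singularity removed near `x`. -/
def desingularized (f : ℝ → ℝ) (x δ t : ℝ) : ℝ :=
  (f t - (Metric.ball x δ).indicator (fun _ => f x) t) / (t - x)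

theorem integrableOn_desingularized (hf : IntegrableOn f (Ioi 0)) {δ M : ℝ} (hδ : 0 < δ)
    (hM : ∀ t, |t - x| < δ → |f t - f x| ≤ M * |t - x|) :
    IntegrableOn (desingularized f x δ) (Ioi 0) := by
  have hb : IntegrableOn ((Metric.ball x δ).indicator fun _ => |M|) (Ioi 0) := by
    refine IntegrableOn.integrable_indicator ?_ measurableSet_ball |>.integrableOn
    exact integrableOn_const measure_ball_lt_top.ne
  refine Integrable.mono' (hb.add (hf.abs.mul_const δ⁻¹)) ?_ (ae_of_all _ fun t => ?_)
  · exact (hf.aestronglyMeasurable.sub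
      (measurable_const.indicator measurableSet_ball).aestronglyMeasurable).div₀
      (measurable_id.sub_const x).aestronglyMeasurable
  · rw [desingularized, Real.norm_eq_abs, abs_div]
    simp only [Pi.add_apply]
    by_cases h : t ∈ Metric.ball x δ
    · have h' : |t - x| < δ := by rwa [Metric.mem_ball, Real.dist_eq] at h
      rw [indicator_of_mem h, indicator_of_mem h]
      have h1 : |f t - f x| / |t - x| ≤ |M| :=
        div_le_of_le_mul₀ (abs_nonneg _) (abs_nonneg _)
          ((hM t h').trans (mul_le_mul_of_nonneg_right (le_abs_self M) (abs_nonneg _)))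
      have h2 : 0 ≤ |f t| * δ⁻¹ := by positivity
      linarith
    · have h' : δ ≤ |t - x| := by rwa [Metric.mem_ball, Real.dist_eq, not_lt] at h
      rw [indicator_of_notMem h, indicator_of_notMem h, sub_zero, zero_add, div_eq_mul_inv]
      gcongr

/-- Subtracting the constant `f x` on a symmetric ball costs nothing against an odd kernel, and
afterwards the kernel enters only through the bounded product `u k(u)`. -/
theorem IsCauchyRegularization.integral_mul_eq {k : ℝ → ℝ} (hk : IsCauchyRegularization k)
    (hf : IntegrableOn f (Ioi 0)) {δ M : ℝ} (hδ : 0 < δ) (hδx : δ ≤ x)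
    (hM : ∀ t, |t - x| < δ → |f t - f x| ≤ M * |t - x|) :
    ∫ t in Ioi (0 : ℝ), f t * k (t - x) =
      ∫ t in Ioi (0 : ℝ), desingularized f x δ t * ((t - x) * k (t - x)) := by
  have hk0 : k 0 = 0 := by
    have := hk.odd 0
    rw [neg_zero] at this
    linarith
  have hg := integrableOn_desingularized hf hδ hM
  have hm : Measurable fun t => k (t - x) := hk.measurable.comp (measurable_id.sub_const x)
  have h1 : IntegrableOn (fun t => desingularized f x δ t * ((t - x) * k (t - x))) (Ioi 0) :=
    Integrable.mul_bdd (c := 1) hg ((measurable_id.sub_const x).mul hm).aestronglyMeasurable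
      (ae_of_all _ fun t => hk.abs_mul_le _)
  have h2 : ∀ t, f t * k (t - x) - desingularized f x δ t * ((t - x) * k (t - x)) =
      f x * (Metric.ball x δ).indicator (fun t => k (t - x)) t := fun t => by
    have h3 : desingularized f x δ t * ((t - x) * k (t - x)) =
        (f t - (Metric.ball x δ).indicator (fun _ => f x) t) * k (t - x) := by
      rcases eq_or_ne (t - x) 0 with h | h
      · rw [h, hk0]
        ring
      · rw [desingularized, ← mul_assoc, div_mul_cancel₀ _ h]
    rw [h3]
    by_cases h : t ∈ Metric.ball x δ
    · rw [indicator_of_mem h, indicator_of_mem h]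
      ring
    · rw [indicator_of_notMem h, indicator_of_notMem h]
      ring
  rw [← sub_eq_zero, ← integral_sub (hk.integrableOn_mul hf x) h1]
  simp_rw [h2]
  rw [integral_const_mul, hk.integral_indicator_eq_zero hδx, mul_zero]

/-- Dominated convergence with `|u k(u)| ≤ 1`. The limit does not depend on the regularization, so
truncation and the Poisson-type kernel give the same value. -/
theorem tendsto_integral_cauchyRegularization {k : ℝ → ℝ → ℝ}
    (hk : ∀ ε, 0 < ε → IsCauchyRegularization (k ε))
    (hlim : ∀ u, u ≠ 0 → Tendsto (fun ε => u * k ε u) (𝓝[>] 0) (𝓝 1))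
    (hf : IntegrableOn f (Ioi 0)) {δ M : ℝ} (hδ : 0 < δ) (hδx : δ ≤ x)
    (hM : ∀ t, |t - x| < δ → |f t - f x| ≤ M * |t - x|) :
    Tendsto (fun ε => ∫ t in Ioi (0 : ℝ), f t * k ε (t - x)) (𝓝[>] 0)
      (𝓝 (∫ t in Ioi (0 : ℝ), desingularized f x δ t)) := by
  have hg := integrableOn_desingularized hf hδ hM
  have h := tendsto_integral_filter_of_dominated_convergence (μ := volume.restrict (Ioi (0 : ℝ)))
    (F := fun ε t => desingularized f x δ t * ((t - x) * k ε (t - x)))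
    (f := desingularized f x δ) (l := 𝓝[>] 0) (fun t => |desingularized f x δ t|) ?_ ?_ hg.abs ?_
  · refine h.congr' ?_
    filter_upwards [self_mem_nhdsWithin] with ε hε
    exact ((hk ε hε).integral_mul_eq hf hδ hδx hM).symm
  · filter_upwards [self_mem_nhdsWithin] with ε hε
    exact hg.aestronglyMeasurable.mul ((measurable_id.sub_const x).mul
      ((hk ε hε).measurable.comp (measurable_id.sub_const x))).aestronglyMeasurable
  · filter_upwards [self_mem_nhdsWithin] with ε hε
    refine ae_of_all _ fun t => ?_
    rw [norm_mul, Real.norm_eq_abs, Real.norm_eq_abs]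
    exact mul_le_of_le_one_right (abs_nonneg _) ((hk ε hε).abs_mul_le _)
  · have hne : ∀ᵐ t : ℝ, t ≠ x := Measure.ae_ne volume x
    refine (ae_restrict_of_ae hne).mono fun t ht => ?_
    simpa using (hlim _ (sub_ne_zero.2 ht)).const_mul (desingularized f x δ t)

/-- The truncation of `u ↦ 1 / u` to `ε < |u|`. -/
def truncatedInv (ε u : ℝ) : ℝ := {u : ℝ | ε < |u|}.indicator (fun u => u⁻¹) u

theorem measurableSet_lt_abs (ε : ℝ) : MeasurableSet {u : ℝ | ε < |u|} :=
  (isOpen_lt continuous_const continuous_abs).measurableSet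

theorem isCauchyRegularization_truncatedInv {ε : ℝ} (hε : 0 < ε) :
    IsCauchyRegularization (truncatedInv ε) where
  measurable := measurable_inv.indicator (measurableSet_lt_abs ε)
  odd u := by
    simp only [truncatedInv, indicator, mem_ofPred_eq, abs_neg, inv_neg]
    split_ifs <;> simp
  bounded := by
    refine ⟨ε⁻¹, fun u => ?_⟩
    simp only [truncatedInv, indicator, mem_ofPred_eq]
    split_ifs with h
    · rw [abs_inv]
      exact inv_anti₀ hε h.le
    · rw [abs_zero]
      positivity
  abs_mul_le u := by
    simp only [truncatedInv, indicator, mem_ofPred_eq]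
    split_ifs with h
    · rw [mul_inv_cancel₀ (abs_pos.1 (hε.trans h)), abs_one]
    · simp

theorem tendsto_mul_truncatedInv {u : ℝ} (hu : u ≠ 0) :
    Tendsto (fun ε => u * truncatedInv ε u) (𝓝[>] 0) (𝓝 1) := by
  refine tendsto_const_nhds.congr' ?_
  filter_upwards [Ioo_mem_nhdsGT (abs_pos.2 hu)] with ε hε
  rw [truncatedInv, indicator_of_mem (show u ∈ {u : ℝ | ε < |u|} from hε.2), mul_inv_cancel₀ hu]

theorem isCauchyRegularization_poisson {ε : ℝ} (hε : 0 < ε) :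
    IsCauchyRegularization fun u => u / (u ^ 2 + ε ^ 2) where
  measurable := by fun_prop
  odd u := by rw [neg_sq, neg_div]
  bounded := by
    refine ⟨ε⁻¹, fun u => ?_⟩
    have hpos : 0 < u ^ 2 + ε ^ 2 := by positivity
    rw [abs_div, abs_of_pos hpos, div_le_iff₀ hpos, inv_mul_eq_div, le_div_iff₀ hε,
      ← sq_abs u]
    nlinarith [sq_nonneg (|u| - ε), abs_nonneg u]
  abs_mul_le u := by
    have hpos : 0 < u ^ 2 + ε ^ 2 := by positivity
    rw [← mul_div_assoc, abs_div, abs_of_pos hpos, div_le_one hpos, ← sq, abs_of_nonneg (sq_nonneg u)]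
    nlinarith

theorem tendsto_mul_poisson {u : ℝ} (hu : u ≠ 0) :
    Tendsto (fun ε : ℝ => u * (u / (u ^ 2 + ε ^ 2))) (𝓝[>] 0) (𝓝 1) := by
  have hc : ContinuousAt (fun ε : ℝ => u * (u / (u ^ 2 + ε ^ 2))) 0 := by
    refine ContinuousAt.mul continuousAt_const (ContinuousAt.div continuousAt_const ?_ ?_)
    · fun_prop
    · simpa using hu
  have h := hc.tendsto.mono_left (nhdsWithin_le_nhds (s := Ioi 0))
  have e : u * (u / (u ^ 2 + 0 ^ 2)) = 1 := by field_simp; simp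
  rwa [e] at h

theorem hasPrincipalValue_of_tendsto (hf : IntegrableOn f (Ioi 0)) (hx : 0 < x)
    (hd : DifferentiableAt ℝ f x) {v : ℝ}
    (h : Tendsto (fun ε => ∫ t in Ioi (0 : ℝ), f t * ((t - x) / ((t - x) ^ 2 + ε ^ 2)))
      (𝓝[>] 0) (𝓝 v)) : HasPrincipalValue f x v := by
  obtain ⟨M, hM⟩ := hd.isBigO_sub.bound
  obtain ⟨δ₀, hδ₀, hball⟩ := Metric.eventually_nhds_iff.1 hM
  -- The radius must respect both the Lipschitz estimate at `x` and the endpoint 0.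
  have hδ : 0 < min δ₀ x := lt_min hδ₀ hx
  have hM' : ∀ t, |t - x| < min δ₀ x → |f t - f x| ≤ M * |t - x| := fun t ht =>
    hball (lt_of_lt_of_le ht (min_le_left _ _))
  have h1 := tendsto_integral_cauchyRegularization (k := fun ε u => u / (u ^ 2 + ε ^ 2))
    (fun ε hε => isCauchyRegularization_poisson hε) (fun u hu => tendsto_mul_poisson hu)
    hf hδ (min_le_right _ _) hM'
  have h2 := tendsto_integral_cauchyRegularization (k := truncatedInv)
    (fun ε hε => isCauchyRegularization_truncatedInv hε) (fun u hu => tendsto_mul_truncatedInv hu)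
    hf hδ (min_le_right _ _) hM'
  have hmeas : ∀ ε, MeasurableSet {t : ℝ | ε < |t - x|} := fun ε =>
    (isOpen_lt continuous_const (continuous_id.sub continuous_const).abs).measurableSet
  have hset : ∀ ε, {t : ℝ | 0 < t ∧ ε < |t - x|} = Ioi 0 ∩ {t | ε < |t - x|} := fun ε => rfl
  have hfun : ∀ ε t, f t * truncatedInv ε (t - x) =
      {t : ℝ | ε < |t - x|}.indicator (fun t => f t / (t - x)) t := fun ε t => by
    simp only [truncatedInv, indicator, mem_ofPred_eq]
    split_ifs <;> simp [div_eq_mul_inv]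
  constructor
  · intro ε hε
    have h3 := (isCauchyRegularization_truncatedInv hε).integrableOn_mul hf x
    simp_rw [hfun] at h3
    rw [hset, inter_comm, IntegrableOn, ← Measure.restrict_restrict (hmeas ε)]
    exact (integrable_indicator_iff (hmeas ε)).1 h3
  · rw [← tendsto_nhds_unique h1 h]
    simp_rw [hfun] at h2
    refine h2.congr fun ε => ?_
    rw [setIntegral_indicator (hmeas ε), hset]

end PrincipalValue

/-! ### The Hilbert transform of `φ'` and the inverse Fourier integral -/

section Inversion

variable {a : ℝ}

theorem norm_rotatedTransform_le (ha : 0 < a) (T : ℝ) :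
    ∃ C, 0 ≤ C ∧ ∀ η ∈ quadrant, ‖rotatedTransform a T η‖ ≤ C := by
  obtain ⟨C, hC, h⟩ := powerDecay_rotatedTransform ha T
  refine ⟨C, hC, fun η hη => (h η hη).trans (mul_le_of_le_one_right hC ?_)⟩
  exact Real.rpow_le_one_of_one_le_of_nonpos (by linarith [norm_nonneg η]) (by norm_num)

theorem ofReal_mem_quadrant {s : ℝ} (hs : 0 ≤ s) : (s : ℂ) ∈ quadrant := ⟨by simpa, by simp⟩

theorem I_mul_ofReal_mem_quadrant {r : ℝ} (hr : 0 ≤ r) : I * (r : ℂ) ∈ quadrant :=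
  ⟨by simp, by simpa⟩

/-- Jordan's lemma with rate `Re ξ`. Real `ξ` is included; absolute convergence on the real ray is
not available there, hence the limit of truncated integrals. -/
theorem tendsto_integral_rotatedTransform (ha : 0 < a) (T : ℝ) {ξ : ℂ} (hre : 0 < ξ.re)
    (him : 0 ≤ ξ.im) :
    Tendsto (fun L : ℝ => ∫ s in (0 : ℝ)..L, rotatedTransform a T s * Complex.exp (I * ξ * s)) atTop
      (𝓝 (I * ∫ y in Ioi (0 : ℝ), rotatedTransform a T (I * y) * Complex.exp (-(ξ * y)))) := by
  obtain ⟨C, hC, h⟩ := powerDecay_rotatedTransform ha T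
  have hexp : HoloOn (fun z : ℂ => Complex.exp (I * ξ * z)) quadrant :=
    HoloOn.of_differentiableAt fun z _ => by fun_prop
  have key := tendsto_integral_of_exp_decay ((holoOn_rotatedTransform ha T).mul hexp) hre hC
    fun z hz => ?_
  · have e : ∀ y : ℝ, Complex.exp (I * ξ * (I * y)) = Complex.exp (-(ξ * y)) := fun y => by
      congr 1
      linear_combination ξ * y * Complex.I_sq
    simpa only [e] using key
  · have hz1 : 0 ≤ z.re := hz.1
    rw [norm_mul, Complex.norm_exp]
    refine mul_le_mul (h z hz) (Real.exp_le_exp.2 ?_) (Real.exp_pos _).le (by positivity)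
    have : (I * ξ * z).re = -(ξ.re * z.im + ξ.im * z.re) := by simp; ring
    rw [this]
    nlinarith [mul_nonneg him hz1]

theorem integrableOn_rotatedTransform_mul_exp (ha : 0 < a) (T : ℝ) {ξ : ℂ} (him : 0 < ξ.im) :
    IntegrableOn (fun s : ℝ => rotatedTransform a T s * Complex.exp (I * ξ * s)) (Ioi 0) := by
  obtain ⟨C, hC, h⟩ := norm_rotatedTransform_le ha T
  have he : IntegrableOn (fun s : ℝ => Complex.exp (I * ξ * s)) (Ioi 0) :=
    integrableOn_exp_mul_complex_Ioi (by simpa using him) 0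
  refine Integrable.bdd_mul (c := C) he ?_
    ((ae_restrict_mem measurableSet_Ioi).mono fun s hs => h _ (ofReal_mem_quadrant (le_of_lt hs)))
  exact (((holoOn_rotatedTransform ha T).cont.comp (Complex.continuous_ofReal.continuousOn)
    fun s hs => ofReal_mem_quadrant (le_of_lt hs))).aestronglyMeasurable measurableSet_Ioi

theorem inv_sub_eq_integral_exp {ξ : ℂ} (him : 0 < ξ.im) (τ : ℝ) :
    ((τ : ℂ) - ξ)⁻¹ = I * ∫ s in Ioi (0 : ℝ), Complex.exp (I * (ξ - τ) * s) := by
  have hre : (I * (ξ - τ)).re < 0 := by simpa using him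
  have hne : ξ - τ ≠ 0 := fun h => by rw [h] at hre; simp at hre
  have hne' : (τ : ℂ) - ξ ≠ 0 := fun h => hne (by linear_combination -h)
  rw [integral_exp_mul_complex_Ioi hre, Complex.ofReal_zero, mul_zero, Complex.exp_zero]
  field_simp
  ring

/-- Write `1 / (τ - ξ) = i ∫ e^{i(ξ - τ)s} ds` and interchange: the inner integral is the Laplace
transform of `g` at `i s`, that is `-K(is)`. The ray in `s` is then turned onto the cut. -/
theorem integral_laplace_mul_inv_sub (ha : 0 < a) (T : ℝ) {ξ : ℂ} (hre : 0 < ξ.re)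
    (him : 0 < ξ.im) :
    ∫ τ in Ioi (0 : ℝ), (laplace (fun r => r * density a T r) τ : ℂ) * ((τ : ℂ) - ξ)⁻¹ =
      ∫ r in Ioi (0 : ℝ), rotatedTransform a T (I * r) * Complex.exp (-(ξ * r)) := by
  have hw := integrableOn_density ha T
  have hw' := integrableOn_mul_density ha T
  have hg := integrableOn_laplace hw hw'
  set g := laplace fun r => r * density a T r with hgdef
  have he : IntegrableOn (fun s : ℝ => Complex.exp (I * ξ * s)) (Ioi 0) :=
    integrableOn_exp_mul_complex_Ioi (by simpa using him) 0
  have hint : Integrable (Function.uncurry fun τ s : ℝ =>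
      (g τ : ℂ) * Complex.exp (I * ξ * s) * Complex.exp (-(I * s * τ)))
      ((volume.restrict (Ioi 0)).prod (volume.restrict (Ioi 0))) := by
    refine Integrable.mul_bdd (c := 1) (Integrable.mul_prod hg.ofReal he)
      (by fun_prop : Continuous fun z : ℝ × ℝ =>
        Complex.exp (-(I * z.2 * z.1))).aestronglyMeasurable (ae_of_all _ fun z => ?_)
    rw [Complex.norm_exp]
    simp
  have h1 : ∀ τ : ℝ, (g τ : ℂ) * ((τ : ℂ) - ξ)⁻¹ = I * ∫ s in Ioi (0 : ℝ),
      (g τ : ℂ) * Complex.exp (I * ξ * s) * Complex.exp (-(I * s * τ)) := fun τ => by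
    rw [inv_sub_eq_integral_exp him, mul_left_comm, ← integral_const_mul]
    congr 2
    ext s
    rw [mul_assoc (g τ : ℂ), ← Complex.exp_add]
    ring_nf
  have h2 : ∀ s ∈ Ioi (0 : ℝ), (∫ τ in Ioi (0 : ℝ),
      (g τ : ℂ) * Complex.exp (I * ξ * s) * Complex.exp (-(I * s * τ))) =
      -(rotatedTransform a T s * Complex.exp (I * ξ * s)) := fun s hs => by
    have h3 := integral_laplace_mul_exp hw hw' (p := I * s) (by simp)
    rw [rotatedTransform_ofReal ha T hs, derivTransform_eq ha T (I_mul_ofReal_mem_rightHalf s),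
      ← h3, neg_mul, neg_neg, ← integral_mul_const]
    congr 1
    ext τ
    ring
  have h4 := tendsto_nhds_unique (tendsto_integral_rotatedTransform ha T hre him.le)
    (intervalIntegral_tendsto_integral_Ioi 0 (integrableOn_rotatedTransform_mul_exp ha T him)
      tendsto_id)
  simp_rw [h1]
  rw [integral_const_mul, integral_integral_swap hint, setIntegral_congr_fun measurableSet_Ioi h2,
    integral_neg, ← h4, mul_neg, ← mul_assoc, Complex.I_mul_I]
  ring

theorem integrableOn_rotatedTransform_I_mul_exp (ha : 0 < a) (T : ℝ) {ξ : ℂ} (hre : 0 < ξ.re) :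
    IntegrableOn (fun r : ℝ => rotatedTransform a T (I * r) * Complex.exp (-(ξ * r))) (Ioi 0) := by
  obtain ⟨C, hC, h⟩ := norm_rotatedTransform_le ha T
  have he : IntegrableOn (fun s : ℝ => Complex.exp (-ξ * s)) (Ioi 0) :=
    integrableOn_exp_mul_complex_Ioi (by simpa using hre) 0
  simp only [neg_mul] at he
  refine Integrable.bdd_mul (c := C) he ?_ ((ae_restrict_mem measurableSet_Ioi).mono
    fun s hs => h _ (I_mul_ofReal_mem_quadrant (le_of_lt hs)))
  exact ((continuousOn_comp_I_mul (holoOn_rotatedTransform ha T).cont).mono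
    Ioi_subset_Ici_self).aestronglyMeasurable measurableSet_Ioi

theorem re_rotatedTransform_mul_exp (T x r : ℝ) :
    (rotatedTransform a T (I * r) * Complex.exp (-(x * r))).re =
      (rotatedTransform a T (I * r)).re * Real.exp (-(r * x)) := by
  have e : Complex.exp (-((x : ℂ) * r)) = ((Real.exp (-(r * x)) : ℝ) : ℂ) := by
    push_cast
    ring_nf
  rw [e, Complex.re_mul_ofReal]

theorem im_rotatedTransform_mul_exp (T x r : ℝ) :
    (rotatedTransform a T (I * r) * Complex.exp (-(x * r))).im =
      (rotatedTransform a T (I * r)).im * Real.exp (-(r * x)) := by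
  have e : Complex.exp (-((x : ℂ) * r)) = ((Real.exp (-(r * x)) : ℝ) : ℂ) := by
    push_cast
    ring_nf
  rw [e, Complex.im_mul_ofReal]

theorem integrableOn_re_rotatedTransform_mul_exp (ha : 0 < a) (T : ℝ) {x : ℝ} (hx : 0 < x) :
    IntegrableOn (fun r : ℝ => (rotatedTransform a T (I * r)).re * Real.exp (-(r * x)))
      (Ioi 0) := by
  have h := (integrableOn_rotatedTransform_I_mul_exp ha T (ξ := x) (by simpa using hx)).re
  simp only [RCLike.re_eq_complex_re, re_rotatedTransform_mul_exp] at h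
  exact h

theorem re_integral_rotatedTransform (ha : 0 < a) (T : ℝ) {x : ℝ} (hx : 0 < x) :
    (∫ r in Ioi (0 : ℝ), rotatedTransform a T (I * r) * Complex.exp (-(x * r))).re =
      laplace (fun r => (rotatedTransform a T (I * r)).re) x := by
  have h := integrableOn_rotatedTransform_I_mul_exp ha T (ξ := x) (by simpa using hx)
  have h1 := integral_re h
  simp only [RCLike.re_eq_complex_re, re_rotatedTransform_mul_exp] at h1
  exact h1.symm

theorem im_integral_rotatedTransform (ha : 0 < a) (T : ℝ) {x : ℝ} (hx : 0 < x) :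
    (∫ r in Ioi (0 : ℝ), rotatedTransform a T (I * r) * Complex.exp (-(x * r))).im =
      Real.pi * laplace (fun r => r * density a T r) x := by
  have h := integrableOn_rotatedTransform_I_mul_exp ha T (ξ := x) (by simpa using hx)
  have h1 := integral_im h
  simp only [RCLike.im_eq_complex_im, im_rotatedTransform_mul_exp] at h1
  rw [← h1, laplace, ← integral_const_mul]
  refine setIntegral_congr_fun measurableSet_Ioi fun r hr => ?_
  simp only [im_rotatedTransform T hr]
  ring

/-- Put `ξ = x + iε` in the preceding identity: the real part of `1 / (τ - ξ)` is the odd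
Poisson-type kernel, and the right side converges as `ε → 0`. -/
theorem tendsto_integral_laplace_poisson (ha : 0 < a) (T : ℝ) {x : ℝ} (hx : 0 < x) :
    Tendsto (fun ε => ∫ τ in Ioi (0 : ℝ), laplace (fun r => r * density a T r) τ *
        ((τ - x) / ((τ - x) ^ 2 + ε ^ 2))) (𝓝[>] 0)
      (𝓝 (laplace (fun r => (rotatedTransform a T (I * r)).re) x)) := by
  obtain ⟨C, hC, hb⟩ := norm_rotatedTransform_le ha T
  have hg := integrableOn_laplace (integrableOn_density ha T) (integrableOn_mul_density ha T)
  set g := laplace fun r => r * density a T r with hgdef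
  have hlim : Tendsto (fun ε : ℝ => ∫ r in Ioi (0 : ℝ),
      rotatedTransform a T (I * r) * Complex.exp (-((x + ε * I) * r))) (𝓝[>] 0)
      (𝓝 (∫ r in Ioi (0 : ℝ), rotatedTransform a T (I * r) * Complex.exp (-(x * r)))) := by
    refine tendsto_integral_filter_of_dominated_convergence (fun r => C * Real.exp (-x * r))
      ?_ ?_ ((integrableOn_exp_mul_Ioi (neg_lt_zero.2 hx) 0).const_mul C) (ae_of_all _ fun r => ?_)
    · exact Eventually.of_forall fun ε => (integrableOn_rotatedTransform_I_mul_exp ha T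
        (by simpa using hx)).aestronglyMeasurable
    · refine Eventually.of_forall fun ε => (ae_restrict_mem measurableSet_Ioi).mono fun r hr => ?_
      rw [norm_mul, Complex.norm_exp]
      have : (-(((x : ℂ) + ε * I) * r)).re = -x * r := by simp
      rw [this]
      gcongr
      exact hb _ (I_mul_ofReal_mem_quadrant (le_of_lt hr))
    · have hc : Continuous fun ε : ℝ =>
          rotatedTransform a T (I * r) * Complex.exp (-((x + ε * I) * r)) := by fun_prop
      have h := hc.tendsto 0
      simp only [Complex.ofReal_zero, zero_mul, add_zero] at h
      exact h.mono_left nhdsWithin_le_nhds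
  have hre := (Complex.continuous_re.tendsto _).comp hlim
  rw [re_integral_rotatedTransform ha T hx] at hre
  refine hre.congr' ?_
  filter_upwards [self_mem_nhdsWithin] with ε hε
  have hε' : 0 < ε := hε
  have h1 := integral_laplace_mul_inv_sub ha T (ξ := x + ε * I) (by simpa using hx)
    (by simpa using hε')
  have h2 : ∀ τ : ℝ, ((g τ : ℂ) * ((τ : ℂ) - (x + ε * I))⁻¹).re =
      g τ * ((τ - x) / ((τ - x) ^ 2 + ε ^ 2)) := fun τ => by
    have e1 : ((τ : ℂ) - (x + ε * I)).re = τ - x := by simp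
    have e2 : ((τ : ℂ) - (x + ε * I)).im = -ε := by simp
    rw [Complex.re_ofReal_mul, Complex.inv_re, Complex.normSq_apply, e1, e2]
    ring_nf
  have hint : IntegrableOn (fun τ : ℝ => (g τ : ℂ) * ((τ : ℂ) - (x + ε * I))⁻¹) (Ioi 0) := by
    have hne : ∀ τ : ℝ, (τ : ℂ) - (x + ε * I) ≠ 0 := fun τ h => by
      have := congrArg Complex.im h
      simp at this
      exact hε'.ne' this
    refine Integrable.mul_bdd (c := ε⁻¹) hg.ofReal
      (Continuous.inv₀ (by fun_prop) hne).aestronglyMeasurable (ae_of_all _ fun τ => ?_)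
    rw [norm_inv]
    refine inv_anti₀ hε' ?_
    have h := Complex.abs_im_le_norm ((τ : ℂ) - (x + ε * I))
    simpa [abs_of_pos hε'] using h
  simp only [Function.comp_apply]
  rw [← h1]
  have h3 := integral_re hint
  simp only [RCLike.re_eq_complex_re, h2] at h3
  exact h3.symm

theorem hasPrincipalValue_laplace (ha : 0 < a) (T : ℝ) {κ x : ℝ} (hκ : 0 < κ) (hx : 0 < x) :
    HasPrincipalValue (fun t => -κ⁻¹ * laplace (fun r => r * density a T r) (t / κ)) x
      (-κ⁻¹ * laplace (fun r => (rotatedTransform a T (I * r)).re) (x / κ)) := by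
  have hw' := integrableOn_mul_density ha T
  have hg := integrableOn_laplace (integrableOn_density ha T) hw'
  have hxκ : 0 < x / κ := div_pos hx hκ
  have hd := (hasDerivAt_laplace hw' hxκ).differentiableAt
  have hlim := tendsto_integral_laplace_poisson ha T hxκ
  set g := laplace fun r => r * density a T r with hgdef
  have hgκ : IntegrableOn (fun t => g (t / κ)) (Ioi 0) := by
    have h := (integrableOn_Ioi_comp_mul_left_iff g 0 (inv_pos.2 hκ)).2 (by simpa using hg)
    simpa only [div_eq_inv_mul] using h
  refine hasPrincipalValue_of_tendsto (hgκ.const_mul _) hx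
    ((hd.comp x (differentiableAt_id.div_const κ)).const_mul _) ?_
  have hε : Tendsto (fun ε : ℝ => ε / κ) (𝓝[>] 0) (𝓝[>] 0) := by
    refine tendsto_nhdsWithin_iff.2 ⟨?_, ?_⟩
    · have hc : Continuous fun ε : ℝ => ε / κ := by fun_prop
      have h := hc.tendsto 0
      rw [zero_div] at h
      exact h.mono_left nhdsWithin_le_nhds
    · filter_upwards [self_mem_nhdsWithin] with ε hε
      exact div_pos hε hκ
  refine ((hlim.comp hε).const_mul (-κ⁻¹)).congr fun ε => ?_
  have h := integral_comp_mul_left_Ioi (fun t => g (t / κ) * ((t - x) / ((t - x) ^ 2 + ε ^ 2))) 0 hκ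
  rw [mul_zero, smul_eq_mul, eq_inv_mul_iff_mul_eq₀ hκ.ne'] at h
  simp only [mul_assoc]
  rw [integral_const_mul, ← h, Function.comp_apply, ← integral_const_mul κ]
  congr 1
  refine setIntegral_congr_fun measurableSet_Ioi fun τ _ => ?_
  have e1 : κ * τ / κ = τ := by field_simp
  have e2 : (τ - x / κ) ^ 2 + (ε / κ) ^ 2 = ((κ * τ - x) ^ 2 + ε ^ 2) / κ ^ 2 := by
    field_simp
  simp only [e1, e2]
  have e3 : τ - x / κ = (κ * τ - x) / κ := by field_simp
  rw [e3]
  -- The congruence is required for every `ε`, including `ε = 0` at `κ τ = x`, where both sides are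
  -- 0 because division by zero gives 0.
  rcases eq_or_ne ((κ * τ - x) ^ 2 + ε ^ 2) 0 with h0 | h0
  · rw [h0]
    simp
  · field_simp

theorem tendsto_integral_rotatedTransform_comp_mul (ha : 0 < a) (T : ℝ) {κ x : ℝ} (hκ : 0 < κ)
    (hx : 0 < x) :
    Tendsto (fun R : ℝ => ∫ s in (0 : ℝ)..R,
        rotatedTransform a T (κ * s : ℝ) * Complex.exp (I * s * x)) atTop
      (𝓝 ((κ : ℂ)⁻¹ * (I * ∫ y in Ioi (0 : ℝ),
        rotatedTransform a T (I * y) * Complex.exp (-((x / κ : ℝ) * y))))) := by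
  have h := (tendsto_integral_rotatedTransform ha T (ξ := (x / κ : ℝ))
    (by simpa using div_pos hx hκ) (by simp)).comp (tendsto_id.const_mul_atTop hκ)
  refine (h.const_mul (κ : ℂ)⁻¹).congr fun R => ?_
  have h1 := intervalIntegral.integral_comp_mul_left (a := 0) (b := R) (fun s : ℝ =>
    rotatedTransform a T s * Complex.exp (I * (x / κ : ℝ) * s)) hκ.ne'
  rw [mul_zero, Complex.real_smul, Complex.ofReal_inv] at h1
  rw [Function.comp_apply, id, ← h1]
  refine intervalIntegral.integral_congr fun s _ => ?_
  have hκ' : (κ : ℂ) ≠ 0 := by exact_mod_cast hκ.ne'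
  have e : I * ((x / κ : ℝ) : ℂ) * ((κ * s : ℝ) : ℂ) = I * s * x := by
    push_cast
    field_simp
  simp only [e]

theorem continuous_derivTransform_comp (ha : 0 < a) (T κ : ℝ) :
    Continuous fun t : ℝ => derivTransform a T (-(I * κ) * t) :=
  (holoOn_derivTransform ha T).cont.comp_continuous (by fun_prop) fun t => by simp [rightHalf]

/-- Under `t = -s` the negative half of the interval runs along the positive imaginary `p`-axis,
where `K` continues to the cut; the positive half is its complex conjugate. -/
theorem integral_derivTransform_mul_exp (ha : 0 < a) (T x : ℝ) {κ R : ℝ} (hκ : 0 < κ)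
    (hR : 0 ≤ R) :
    ∫ t in (-R)..R, derivTransform a T (-(I * κ) * t) * Complex.exp (-(I * t * x)) =
      (∫ s in (0 : ℝ)..R, rotatedTransform a T (κ * s : ℝ) * Complex.exp (I * s * x)) +
      starRingEnd ℂ
        (∫ s in (0 : ℝ)..R, rotatedTransform a T (κ * s : ℝ) * Complex.exp (I * s * x)) := by
  have hc : Continuous fun t : ℝ =>
      derivTransform a T (-(I * κ) * t) * Complex.exp (-(I * t * x)) :=
    (continuous_derivTransform_comp ha T κ).mul (by fun_prop)
  rw [← intervalIntegral.integral_add_adjacent_intervals (hc.intervalIntegrable (-R) 0)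
    (hc.intervalIntegrable 0 R)]
  congr 1
  · have h := intervalIntegral.integral_comp_neg (a := 0) (b := R) fun t : ℝ =>
      derivTransform a T (-(I * κ) * t) * Complex.exp (-(I * t * x))
    rw [neg_zero] at h
    rw [← h]
    refine intervalIntegral.integral_congr_ae (ae_of_all _ fun s hs => ?_)
    rw [uIoc_of_le hR] at hs
    rw [rotatedTransform_ofReal ha T (mul_pos hκ hs.1)]
    congr 2 <;> push_cast <;> ring
  · rw [intervalIntegral.integral_of_le hR, intervalIntegral.integral_of_le hR, ← integral_conj]
    refine setIntegral_congr_fun measurableSet_Ioc fun s hs => ?_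
    have e : -(I * (κ : ℂ)) * s = I * ((-(κ * s) : ℝ) : ℂ) := by push_cast; ring
    simp only [e]
    rw [derivTransform_neg_I_mul ha T (mul_pos hκ hs.1), map_mul, ← Complex.exp_conj]
    congr 2
    simp

theorem tendsto_integral_derivTransform_mul_exp (ha : 0 < a) (T : ℝ) {κ x : ℝ} (hκ : 0 < κ)
    (hx : 0 < x) :
    Tendsto (fun R : ℝ => 1 / (2 * (Real.pi : ℂ)) *
        ∫ t in (-R)..R, derivTransform a T (-(I * κ) * t) * Complex.exp (-(I * t * x))) atTop
      (𝓝 ((-κ⁻¹ * laplace (fun r => r * density a T r) (x / κ) : ℝ) : ℂ)) := by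
  have h := tendsto_integral_rotatedTransform_comp_mul ha T hκ hx
  have hi := im_integral_rotatedTransform ha T (div_pos hx hκ)
  set J := ∫ y in Ioi (0 : ℝ), rotatedTransform a T (I * y) * Complex.exp (-((x / κ : ℝ) * y))
    with hJ
  have h1 := (h.add ((Complex.continuous_conj.tendsto _).comp h)).const_mul (1 / (2 * (Real.pi : ℂ)))
  have hpi : (Real.pi : ℂ) ≠ 0 := by exact_mod_cast Real.pi_ne_zero
  -- Twice the real part of `i J / κ` is `-2 Im J / κ`, and `Im J` is `π` times the Laplace integral
  -- of `r w(r)`.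
  have e : 1 / (2 * (Real.pi : ℂ)) * ((κ : ℂ)⁻¹ * (I * J) + starRingEnd ℂ ((κ : ℂ)⁻¹ * (I * J))) =
      ((-κ⁻¹ * laplace (fun r => r * density a T r) (x / κ) : ℝ) : ℂ) := by
    rw [Complex.add_conj]
    have h2 : ((κ : ℂ)⁻¹ * (I * J)).re = -κ⁻¹ * J.im := by
      rw [← Complex.ofReal_inv, Complex.re_ofReal_mul]
      simp
    rw [h2, hi]
    push_cast
    field_simp
  rw [← e]
  refine h1.congr' ?_
  filter_upwards [eventually_ge_atTop 0] with R hR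
  rw [integral_derivTransform_mul_exp ha T x hκ hR]
  rfl

end Inversion

/-! ### The solution and its properties -/

section Solution

variable {v : ℝ → ℝ}

theorem integrableOn_mul_laplace_integrand (hv : IntegrableOn v (Ioi 0)) {x : ℝ} (hx : 0 < x) :
    IntegrableOn (fun r => r * v r * Real.exp (-(r * x))) (Ioi 0) := by
  have h : IntegrableOn (fun r => v r * (r * Real.exp (-(r * x)))) (Ioi 0) := by
    refine Integrable.mul_bdd (c := x⁻¹) hv
      (by fun_prop : Continuous fun r : ℝ => r * Real.exp (-(r * x))).aestronglyMeasurable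
      ((ae_restrict_mem measurableSet_Ioi).mono fun r hr => ?_)
    have hr' : 0 < r := hr
    rw [Real.norm_of_nonneg (by positivity)]
    exact mul_exp_neg_mul_le hx
  exact h.congr_fun (fun r _ => by ring) measurableSet_Ioi

theorem integrableOn_mul_mul_laplace_integrand (hv : IntegrableOn v (Ioi 0)) {x : ℝ} (hx : 0 < x) :
    IntegrableOn (fun r => r * (r * v r * Real.exp (-(r * x)))) (Ioi 0) := by
  have h := integrableOn_mul_laplace_integrand (integrableOn_mul_laplace_integrand hv (half_pos hx))
    (half_pos hx)
  refine h.congr_fun (fun r _ => ?_) measurableSet_Ioi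
  simp only [mul_assoc, ← Real.exp_add]
  ring_nf

theorem hasDerivAt_laplace_comp_div (hv : IntegrableOn v (Ioi 0)) {κ x : ℝ} (hκ : 0 < κ)
    (hx : 0 < x) : HasDerivAt (fun x => laplace v (x / κ))
      (-κ⁻¹ * laplace (fun r => r * v r) (x / κ)) x := by
  have h1 : HasDerivAt (fun x => x / κ) (1 / κ) x := (hasDerivAt_id x).div_const κ
  exact (HasDerivAt.comp (h₂ := laplace v) (h := fun x => x / κ) x
    (hasDerivAt_laplace hv (div_pos hx hκ)) h1).congr_deriv (by ring)

/-- At the endpoint the one-sided derivative is the limit of the derivatives at interior points. -/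
theorem hasDerivWithinAt_Ici_of_continuousOn {f f' : ℝ → ℝ} (hf : ContinuousOn f (Ici 0))
    (hf' : ContinuousOn f' (Ici 0)) (h : ∀ x, 0 < x → HasDerivAt f (f' x) x) {x : ℝ} (hx : 0 ≤ x) :
    HasDerivWithinAt f (f' x) (Ici 0) x := by
  rcases hx.eq_or_lt with rfl | hx
  · refine hasDerivWithinAt_Ici_of_tendsto_deriv (s := Ioi 0)
      (fun y hy => (h y hy).differentiableAt.differentiableWithinAt)
      ((hf 0 self_mem_Ici).mono Ioi_subset_Ici_self) self_mem_nhdsWithin ?_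
    refine Tendsto.congr' ?_ ((hf' 0 self_mem_Ici).mono Ioi_subset_Ici_self)
    filter_upwards [self_mem_nhdsWithin] with y hy
    exact (h y hy).deriv.symm
  · exact (h x hx).hasDerivWithinAt

variable {lam k : ℝ}

/-- Under the integral sign the equation is Carleman's relation divided by `π r`, so the combined
integrand vanishes pointwise. -/
theorem laplace_equation {a x : ℝ} (ha : 0 < a) (T : ℝ) (hx : 0 < x) :
    laplace (density a T) x + a / Real.pi * laplace (fun r => (rotatedTransform a T (I * r)).re) x -
      laplace (fun r => r * (r * density a T r)) x = 0 := by
  have h1 := integrableOn_mul_exp (integrableOn_density ha T) hx.le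
  have h2 := (integrableOn_re_rotatedTransform_mul_exp ha T hx).const_mul (a / Real.pi)
  have h3 := integrableOn_mul_laplace_integrand (integrableOn_mul_density ha T) hx
  have h12 : IntegrableOn (fun r : ℝ => density a T r * Real.exp (-(r * x)) +
      a / Real.pi * ((rotatedTransform a T (I * r)).re * Real.exp (-(r * x)))) (Ioi 0) := h1.add h2
  simp only [laplace]
  rw [← integral_const_mul, ← integral_add h1 h2, ← integral_sub h12 h3]
  refine setIntegral_eq_zero_of_forall_eq_zero fun r hr => ?_
  have hr' : 0 < r := hr
  have h4 := one_sub_sq_mul_im ha T hr'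
  rw [im_rotatedTransform T hr'] at h4
  have hpi := Real.pi_pos
  have h5 : (1 - r ^ 2) * density a T r = -(a / Real.pi * (rotatedTransform a T (I * r)).re) := by
    field_simp
    refine mul_left_cancel₀ hr'.ne' ?_
    linear_combination h4
  linear_combination Real.exp (-(r * x)) * h5

theorem isSolution_laplace (hlam : 0 < lam) (hk : 0 < k) (T : ℝ) :
    IsSolution lam k T (fun x => laplace (density (lam / √k) T) (x / √k))
      (fun x => -(√k)⁻¹ * laplace (fun r => r * density (lam / √k) T r) (x / √k))
      (fun x => (√k)⁻¹ ^ 2 * laplace (fun r => r * (r * density (lam / √k) T r)) (x / √k)) := by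
  have hκ : 0 < √k := Real.sqrt_pos.2 hk
  have hsq : √k ^ 2 = k := Real.sq_sqrt hk.le
  have ha : 0 < lam / √k := by positivity
  have hw := integrableOn_density ha T
  have hw' := integrableOn_mul_density ha T
  have hholder : HolderClassOn (fun x => laplace (density (lam / √k) T) (x / √k)) (Ici 0) := by
    have h := holderClassOn_const_mul_laplace (μ := 1) (a := 0) 1 hκ one_pos le_rfl
      (fun x hx => integrableOn_mul_exp hw (by simpa using hx)) (by simpa using hw')
    simpa only [one_mul] using h
  have hholder₁ : HolderClassOn
      (fun x => -(√k)⁻¹ * laplace (fun r => r * density (lam / √k) T r) (x / √k)) (Ici 0) := by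
    -- The density integrates powers below 3/2 and `φ'` uses up one, so any exponent below 1/2 would
    -- serve.
    refine holderClassOn_const_mul_laplace (μ := 1 / 4) (a := 0) _ hκ (by norm_num) (by norm_num)
      (fun x hx => integrableOn_mul_exp hw' (by simpa using hx)) ?_
    refine (integrableOn_rpow_mul_density ha T (β := 5 / 4) (by norm_num) (by norm_num)).congr_fun
      (fun r hr => ?_) measurableSet_Ioi
    have e : r ^ (5 / 4 : ℝ) = r ^ (1 / 4 : ℝ) * r := by
      rw [← Real.rpow_add_one (ne_of_gt hr)]
      norm_num
    simp only [e, zero_div, mul_zero, neg_zero, Real.exp_zero, mul_one]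
    ring
  constructor
  · intro x hx
    exact hasDerivWithinAt_Ici_of_continuousOn hholder.continuousOn hholder₁.continuousOn
      (fun y hy => hasDerivAt_laplace_comp_div hw hκ hy) hx
  · intro x hx
    exact ((hasDerivAt_laplace_comp_div hw' hκ hx).const_mul _).congr_deriv (by ring)
  · exact hholder
  · exact hholder₁
  · intro b hb
    -- Away from 0 the exponential absorbs all powers of `r`, so `φ''` is even Lipschitz on `[b,
    -- ∞)`.
    refine holderClassOn_const_mul_laplace (μ := 1) _ hκ one_pos le_rfl (fun x hx =>
      integrableOn_mul_laplace_integrand hw' ((div_pos hb hκ).trans_le hx)) ?_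
    simpa only [Real.rpow_one] using integrableOn_mul_mul_laplace_integrand hw' (div_pos hb hκ)
  · intro x hx
    refine ⟨_, hasPrincipalValue_laplace ha T hκ hx, ?_⟩
    have h := laplace_equation ha T (div_pos hx hκ)
    have e : k * (√k)⁻¹ ^ 2 = 1 := by
      rw [inv_pow, hsq, mul_inv_cancel₀ hk.ne']
    linear_combination h - laplace (fun r => r * (r * density (lam / √k) T r)) (x / √k) * e
  · simp [laplace, integral_density ha T]
  · exact (tendsto_laplace_atTop hw).comp (tendsto_id.atTop_div_const hκ)

theorem isInverseFourierOf_of_eq {κ a : ℝ} (ha : 0 < a) (hκ : 0 < κ) {K : ℂ → ℂ}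
    (hK : ∀ z ∈ upperHalf, K z = derivTransform a T (-(I * κ) * z)) :
    IsInverseFourierOf (fun x => -κ⁻¹ * laplace (fun r => r * density a T r) (x / κ)) K
      (fun t => derivTransform a T (-(I * κ) * t)) := by
  have hd := holoOn_derivTransform ha T
  have hmem : ∀ z : ℂ, 0 < z.im → 0 < (-(I * κ) * z).re := fun z hz => by
    rw [re_neg_I_mul]
    exact mul_pos hκ hz
  constructor
  · refine DifferentiableOn.congr (hd.diff.comp (s := upperHalf)
      (f := fun z : ℂ => -(I * κ) * z) (by fun_prop) fun z hz => ?_) hK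
    rw [interior_rightHalf]
    exact hmem z hz
  · intro ε hε hε'
    obtain ⟨C, hC, h⟩ := norm_derivTransform_le ha T
    refine Asymptotics.IsBigO.of_bound (C * κ⁻¹) ?_
    have h1 : ∀ᶠ z : ℂ in Bornology.cobounded ℂ, 1 ≤ ‖z‖ :=
      tendsto_norm_cobounded_atTop.eventually_ge_atTop 1
    filter_upwards [h1.filter_mono inf_le_left,
      (eventually_principal.2 fun z hz => hz).filter_mono inf_le_right] with z hz hz'
    have h2 := h (-(I * κ) * z) (hmem z hz').le fun h0 => by
      have := hmem z hz'
      rw [h0] at this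
      simp at this
    have h3 : ‖-(I * (κ : ℂ)) * z‖ = κ * ‖z‖ := by simp [abs_of_pos hκ]
    rw [h3, mul_inv, ← mul_assoc] at h2
    rw [hK z hz', Real.norm_of_nonneg (by positivity)]
    refine h2.trans (mul_le_mul_of_nonneg_left ?_ (by positivity))
    -- `1 / ‖z‖` is at most `‖z‖ ^ (-(1 - ε))` as soon as `‖z‖ ≥ 1`.
    rw [← Real.rpow_neg_one]
    exact Real.rpow_le_rpow_of_exponent_le hz (by linarith)
  · exact continuous_derivTransform_comp ha T κ
  · intro t
    have hc : ContinuousWithinAt (fun z : ℂ => derivTransform a T (-(I * κ) * z)) upperHalf t :=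
      (hd.cont _ (by simp [rightHalf])).comp (by fun_prop) fun z hz => (hmem z hz).le
    exact hc.tendsto.congr' (eventually_nhdsWithin_of_forall fun z hz => (hK z hz).symm)
  · exact fun x hx => tendsto_integral_derivTransform_mul_exp ha T hκ hx

theorem integrableOn_integrandB (hlam : 0 < lam) (hk : 0 < k) {z : ℂ} (hz : z ∈ upperHalf) :
    IntegrableOn (integrandB k
      (fun s => Complex.exp (-logCanonicalB (lam / √k) (I * (√k * s : ℝ)))) z) (Ioi 0) := by
  have hq : 0 < (-(I * √k) * z).re := by
    rw [re_neg_I_mul]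
    exact mul_pos (Real.sqrt_pos.2 hk) hz
  exact (integrableOn_rotated hlam hk hq).congr_fun (fun s _ => (integrandB_eq hk z s).symm)
    measurableSet_Ioi

theorem integrableOn_integrandA (hlam : 0 < lam) (hk : 0 < k) {z : ℂ} (hz : z ∈ upperHalf) :
    IntegrableOn (integrandA lam k
      (fun s => Complex.exp (-logCanonicalA (lam / √k) (I * (√k * s : ℝ)))) z) (Ioi 0) := by
  have hq : 0 < (-(I * √k) * z).re := by
    rw [re_neg_I_mul]
    exact mul_pos (Real.sqrt_pos.2 hk) hz
  exact IntegrableOn.congr_fun ((integrableOn_rotated hlam hk hq).const_mul I)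
    (fun s _ => (integrandA_eq hlam hk z s).symm) measurableSet_Ioi

end Solution

end

end AdhesivePatch

theorem mainTheorem1 (lam k T : ℝ) (hlam : 0 < lam) (hk : 0 < k) :
    ∃ φ dφ ddφ : ℝ → ℝ,
      AdhesivePatch.IsSolution lam k T φ dφ ddφ ∧
      (∃ Xp Xm Kb : ℝ → ℂ,
        AdhesivePatch.IsFactorization (AdhesivePatch.symbolA lam k) Xp Xm ∧
        (∀ z ∈ AdhesivePatch.upperHalf,
          IntegrableOn (AdhesivePatch.integrandA lam k Xm z) (Ioi 0)) ∧
        AdhesivePatch.IsInverseFourierOf dφ (AdhesivePatch.transformA lam k T Xm) Kb) ∧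
      (∃ Xp Xm Kb : ℝ → ℂ,
        AdhesivePatch.IsFactorization (AdhesivePatch.symbolB lam k) Xp Xm ∧
        (∀ z ∈ AdhesivePatch.upperHalf,
          IntegrableOn (AdhesivePatch.integrandB k Xm z) (Ioi 0)) ∧
        AdhesivePatch.IsInverseFourierOf dφ (AdhesivePatch.transformB lam k T Xm) Kb) ∧
      dφ =O[𝓝[>] 0] (fun _ => (1 : ℝ)) := by
  have hκ : 0 < √k := Real.sqrt_pos.2 hk
  have ha : 0 < lam / √k := by positivity
  have hsol := AdhesivePatch.isSolution_laplace hlam hk T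
  refine ⟨_, _, _, hsol,
    ⟨_, _, _, (AdhesivePatch.isLogFactorization_symbolA hlam hk).isFactorization hκ,
      fun z hz => AdhesivePatch.integrableOn_integrandA hlam hk hz,
      AdhesivePatch.isInverseFourierOf_of_eq ha hκ
        fun z hz => AdhesivePatch.transformA_eq hlam hk T hz⟩,
    ⟨_, _, _, (AdhesivePatch.isLogFactorization_symbolB hlam hk).isFactorization hκ,
      fun z hz => AdhesivePatch.integrableOn_integrandB hlam hk hz,
      AdhesivePatch.isInverseFourierOf_of_eq ha hκ
        fun z hz => AdhesivePatch.transformB_eq hlam hk T hz⟩, ?_⟩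
  -- The contact stress is bounded because the Hölder condition makes `φ'` continuous at 0 from the
  -- right.
  exact ((hsol.holder₁.continuousOn 0 self_mem_Ici).mono Ioi_subset_Ici_self).tendsto.isBigO_one ℝ
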